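/- All series are formal series in rational powers of $q$ (respectively power series in $t$) over $\mathbb{C}$. Put $\eta(q)=q^{1/24}\prod_{m\ge 1}(1-q^m)$ and write $\eta_d=\eta(q^d)$. For $c\in\mathbb{C}$ let $T_{g,c}=q^{-1}+c+O(q)$ be the following Hauptmoduln (McKay–Thompson series of the Monster classes $g$ with constant term $c$): $$T_{6A,c}=c+6+\frac{\eta_1^6\eta_3^6}{\eta_2^6\eta_6^6}+64\,\frac{\eta_2^6\eta_6^6}{\eta_1^6\eta_3^6},\qquad T_{10A,c}=c+4+\frac{\eta_1^4\eta_5^4}{\eta_2^4\eta_{10}^4}+16\,\frac{\eta_2^4\eta_{10}^4}{\eta_1^4\eta_5^4},$$ $$T_{12A,c}=c-6+\left(\frac{\eta_2^2\eta_6^2}{\eta_1\eta_3\eta_4\eta_{12}}\right)^{6},\qquad T_{14A,c}=c+3+\frac{\eta_1^3\eta_7^3}{\eta_2^3\eta_{14}^3}+8\,\frac{\eta_2^3\eta_{14}^3}{\eta_1^3\eta_7^3},\qquad T_{15A,c}=c+2+\frac{\eta_1^2\eta_5^2}{\eta_3^2\eta_{15}^2}+9\,\frac{\eta_3^2\eta_{15}^2}{\eta_1^2\eta_5^2}.$$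 With $D=t\frac{d}{dt}$, let $$\begin{aligned}L(b_1,\dots,b_5)={}&D^3-t\,b_1D(D+1)(2D+1)-t^2(D+1)\bigl(b_2D(D+2)+4b_3\bigr)\\&-t^3\,b_4(D+1)(D+2)(2D+3)-t^4\,b_5(D+1)(D+2)(D+3).\end{aligned}$$ Let $s\in\mathbb{C}$ be arbitrary and consider the following six cases of an index $n$, an eta-quotient $\eta_{n+}$, a Hauptmodul $H_n$ and an operator $L_n$: - $n=(6,2)$: $\eta_{n+}=\eta_1\eta_2\eta_3\eta_6$, $H_n=T_{6A,10}$, $L_n=L(6,368,88,1056,3584)$; - $n=(6,3)$: $\eta_{n+}=\eta_1\eta_2\eta_3\eta_6$, $H_n=T_{6A,14}$, $L_n=L(8,360,108,864,2160)$; - $n=10$: $\eta_{n+}=\eta_1\eta_2\eta_5\eta_{10}$, $H_n=T_{10A,4}$, $L_n=L(2,112,28,184,336)$; - $n=12$: $\eta_{n+}=\dfrac{\eta_2^4\eta_6^4}{\eta_1\eta_3\eta_4\eta_{12}}$, $H_n=T_{12A,6}$, $L_n=L(2,80,24,96,0)$; - $n=(14,s)$: $\eta_{n+}=\eta_1\eta_2\eta_7\eta_{14}$,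 $H_n=T_{14A,s}$, $L_n=L(1,59,16,68,80)$; - $n=(15,s)$: $\eta_{n+}=\eta_1\eta_3\eta_5\eta_{15}$, $H_n=T_{15A,s}$, $L_n=L(1,43,12,78,216)$. Let $\sigma_1(n)/24$ be the leading exponent of $\eta_{n+}$ in $q$; it equals $\frac12,\frac12,\frac34,\frac12,1,1$ respectively. For a series $q^a(1+g)$ with $g$ of positive order, put $(q^a(1+g))^r=q^{ra}\sum_k\binom rk g^k$. For a power series $A=\sum_i a_it^i$ put $\mathcal{L}A=\sum_i i!\,a_it^i$, $\mathcal{S}_sA=\mathcal{L}\bigl(e^{st}\cdot\mathcal{L}^{-1}A\bigr)$ and $\mathcal{N}A=\mathcal{S}_{-a_1}A$. **Lemma.** In each of the six cases the following holds. 1. The space of analytic solutions of $L_n$ at $t=0$ (power series with positive radius of convergence annihilated by $L_n$) is one-dimensional, spanned by a series $F_n$ with $F_n(0)=1$. 2. There is exactly one power series $M_n(t)\in\mathbb{C}[[t]]$ such that $$M_n\!\left(\frac1{H_n(q)}\right)=\eta_{n+}\cdot H_n^{\sigma_1(n)/24}.$$ 3. $\mathcal{N}M_n=F_n$. In particular $L_n(\mathcal{N}M_n)=0$.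 -/

import Mathlib

open PowerSeries in
open scoped PowerSeries.WithPiTopology in
/-- The `q`-expansion of `η(q ^ d) = q ^ (d / 24) * ∏_{n ≥ 1} (1 - q ^ (d * n))`, in the field
`HahnSeries ℚ ℂ` of series in rational powers of `q`. -/
noncomputable def etaQ (d : ℕ) : HahnSeries ℚ ℂ :=
  HahnSeries.single ((d : ℚ) / 24) 1 *
    HahnSeries.ofPowerSeries ℚ ℂ (∏' n : ℕ, (1 - (X : PowerSeries ℂ) ^ (d * (n + 1))))

/-- The rational power `f ^ r` of a series `f = q ^ a * (1 + g)` with leading coefficient `1`, where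
`g` has positive order: it is `q ^ (r * a) * ∑_k (r choose k) * g ^ k`. -/
noncomputable def monicPow (f : HahnSeries ℚ ℂ) (r : ℚ) : HahnSeries ℚ ℂ :=
  HahnSeries.single (r * f.order) 1 *
    PowerSeries.heval (f * HahnSeries.single (-f.order) 1 - 1) (PowerSeries.binomialSeries ℂ r)

/-! The McKay-Thompson series `T_{g,c} = q⁻¹ + c + O(q)` of the Monster classes that are used, by
their classical eta-quotient expressions. -/

/-- `T_{6A,c}`, the Hauptmodul of `Γ₀(6)+`:
`q⁻¹ + c + 79 q + 352 q² + 1431 q³ + 4160 q⁴ + 13015 q⁵ + ⋯`. -/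
noncomputable def T6A (c : ℂ) : HahnSeries ℚ ℂ :=
  HahnSeries.C (c + 6) + etaQ 1 ^ 6 * etaQ 3 ^ 6 / (etaQ 2 ^ 6 * etaQ 6 ^ 6)
    + 64 * (etaQ 2 ^ 6 * etaQ 6 ^ 6 / (etaQ 1 ^ 6 * etaQ 3 ^ 6))

/-- `T_{10A,c} = q⁻¹ + c + 22 q + 56 q² + 177 q³ + ⋯`. -/
noncomputable def T10A (c : ℂ) : HahnSeries ℚ ℂ :=
  HahnSeries.C (c + 4) + etaQ 1 ^ 4 * etaQ 5 ^ 4 / (etaQ 2 ^ 4 * etaQ 10 ^ 4)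
    + 16 * (etaQ 2 ^ 4 * etaQ 10 ^ 4 / (etaQ 1 ^ 4 * etaQ 5 ^ 4))

/-- `T_{12A,c} = q⁻¹ + c + 15 q + 32 q² + 87 q³ + ⋯`. -/
noncomputable def T12A (c : ℂ) : HahnSeries ℚ ℂ :=
  HahnSeries.C (c - 6) + (etaQ 2 ^ 2 * etaQ 6 ^ 2 / (etaQ 1 * etaQ 3 * etaQ 4 * etaQ 12)) ^ 6

/-- `T_{14A,c} = q⁻¹ + c + 11 q + 20 q² + 57 q³ + ⋯`. -/
noncomputable def T14A (c : ℂ) : HahnSeries ℚ ℂ :=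
  HahnSeries.C (c + 3) + etaQ 1 ^ 3 * etaQ 7 ^ 3 / (etaQ 2 ^ 3 * etaQ 14 ^ 3)
    + 8 * (etaQ 2 ^ 3 * etaQ 14 ^ 3 / (etaQ 1 ^ 3 * etaQ 7 ^ 3))

/-- `T_{15A,c} = q⁻¹ + c + 8 q + 22 q² + 42 q³ + ⋯`. -/
noncomputable def T15A (c : ℂ) : HahnSeries ℚ ℂ :=
  HahnSeries.C (c + 2) + etaQ 1 ^ 2 * etaQ 5 ^ 2 / (etaQ 3 ^ 2 * etaQ 15 ^ 2)
    + 9 * (etaQ 3 ^ 2 * etaQ 15 ^ 2 / (etaQ 1 ^ 2 * etaQ 5 ^ 2))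

/-- The indices `n` of the six (families of) M-series; for `14` and `15` the constant term `s` of
the Hauptmodul is arbitrary. -/
inductive MIndex : Type
  | six_two
  | six_three
  | ten
  | twelve
  | fourteen (s : ℂ)
  | fifteen (s : ℂ)

/-- The eta-product (eta-quotient for `12`) `η_{n+}`. -/
noncomputable def etaPlus : MIndex → HahnSeries ℚ ℂ
  | .six_two => etaQ 1 * etaQ 2 * etaQ 3 * etaQ 6
  | .six_three => etaQ 1 * etaQ 2 * etaQ 3 * etaQ 6
  | .ten => etaQ 1 * etaQ 2 * etaQ 5 * etaQ 10
  | .twelve => etaQ 2 ^ 4 * etaQ 6 ^ 4 / (etaQ 1 * etaQ 3 * etaQ 4 * etaQ 12)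
  | .fourteen _ => etaQ 1 * etaQ 2 * etaQ 7 * etaQ 14
  | .fifteen _ => etaQ 1 * etaQ 3 * etaQ 5 * etaQ 15

/-- The Hauptmodul `H_n`. -/
noncomputable def hauptmodul : MIndex → HahnSeries ℚ ℂ
  | .six_two => T6A 10
  | .six_three => T6A 14
  | .ten => T10A 4
  | .twelve => T12A 6
  | .fourteen s => T14A s
  | .fifteen s => T15A s

/-- `σ₁(n)`: `24` times the leading exponent of `η_{n+}`, so that `σ₁(n) / 24` is
`1/2, 1/2, 3/4, 1/2, 1, 1`. -/
noncomputable def sigmaOne (n : MIndex) : ℚ := 24 * (etaPlus n).order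

/-- The functional equation `M (1 / H_n(q)) = η_{n+} * H_n ^ (σ₁(n) / 24)` of the M-series. Here
`PowerSeries.heval x M` is the substitution of the series `x` of positive order into `M`. -/
def IsMSeries (n : MIndex) (M : PowerSeries ℂ) : Prop :=
  PowerSeries.heval (hauptmodul n)⁻¹ M = etaPlus n * monicPow (hauptmodul n) (sigmaOne n / 24)

/-- The regularization (Laplace transform) `∑ aᵢ tⁱ ↦ ∑ i! aᵢ tⁱ`. -/
noncomputable def laplace (A : PowerSeries ℂ) : PowerSeries ℂ :=
  PowerSeries.mk fun i => PowerSeries.coeff i A * (i.factorial : ℂ)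

/-- The inverse Laplace transform `∑ aᵢ tⁱ ↦ ∑ (aᵢ / i!) tⁱ`. -/
noncomputable def laplaceInv (A : PowerSeries ℂ) : PowerSeries ℂ :=
  PowerSeries.mk fun i => PowerSeries.coeff i A / (i.factorial : ℂ)

/-- The shifted regularization `A ↦ laplace (exp (s t) * A)`. -/
noncomputable def laplaceShift (s : ℂ) (A : PowerSeries ℂ) : PowerSeries ℂ :=
  laplace (PowerSeries.rescale s (PowerSeries.exp ℂ) * A)

/-- The regular shift `S_s`. -/
noncomputable def regularShift (s : ℂ) (A : PowerSeries ℂ) : PowerSeries ℂ :=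
  laplaceShift s (laplaceInv A)

/-- The normalization `𝒩 A = S_{-a₁} A`. -/
noncomputable def normalization (A : PowerSeries ℂ) : PowerSeries ℂ :=
  regularShift (-PowerSeries.coeff 1 A) A

/-- Multiplication by the coordinate `t`. -/
noncomputable def tOp : Module.End ℂ (PowerSeries ℂ) := LinearMap.mulLeft ℂ PowerSeries.X

/-- The operator `D = t d/dt`. -/
noncomputable def eulerOp : Module.End ℂ (PowerSeries ℂ) :=
  tOp * (PowerSeries.derivative ℂ : Module.End ℂ (PowerSeries ℂ))

/-- The normalized operator `L(b₁, b₂, b₃, b₄, b₅)` of type `D3`; the product is composition. -/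
noncomputable def opD3 (b₁ b₂ b₃ b₄ b₅ : ℂ) : Module.End ℂ (PowerSeries ℂ) :=
  eulerOp ^ 3
    - tOp * (b₁ • (eulerOp * (eulerOp + 1) * (2 * eulerOp + 1)))
    - tOp ^ 2 * ((eulerOp + 1) * (b₂ • (eulerOp * (eulerOp + 2)) + (4 * b₃) • 1))
    - tOp ^ 3 * (b₄ • ((eulerOp + 1) * (eulerOp + 2) * (2 * eulerOp + 3)))
    - tOp ^ 4 * (b₅ • ((eulerOp + 1) * (eulerOp + 2) * (eulerOp + 3)))

/-- The operator `L_n`. -/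
noncomputable def operatorL : MIndex → Module.End ℂ (PowerSeries ℂ)
  | .six_two => opD3 6 368 88 1056 3584
  | .six_three => opD3 8 360 108 864 2160
  | .ten => opD3 2 112 28 184 336
  | .twelve => opD3 2 80 24 96 0
  | .fourteen _ => opD3 1 59 16 68 80
  | .fifteen _ => opD3 1 43 12 78 216

/-- The power series `F` has a positive radius of convergence, i.e. is the germ of a function that
is analytic at `0`. -/
def IsAnalyticSeries (F : PowerSeries ℂ) : Prop :=
  0 < (FormalMultilinearSeries.ofScalars ℂ fun i => PowerSeries.coeff i F).radius

/-- `F` is the normalized generator `1 + O(t)` of the space of analytic solutions at `0` of the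
operator `L`, and this space is one-dimensional. -/
structure IsAnalyticGenerator (L : Module.End ℂ (PowerSeries ℂ)) (F : PowerSeries ℂ) : Prop where
  analytic : IsAnalyticSeries F
  solution : L F = 0
  constantCoeff_eq_one : PowerSeries.constantCoeff F = 1
  spans : ∀ G : PowerSeries ℂ, IsAnalyticSeries G → L G = 0 → ∃ c : ℂ, G = c • F

/-! Write `θ = q d/dq`, `τ = 1/H_n`, and let `a` be the linear coefficient of `M_n`. Normalization
is a Möbius change of coordinate: `(𝒩M)(t) = (1 - aτ) M(τ)` for `t = τ/(1 - aτ)`, that is `1/t = H_n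
- a` (`subst_normalization`). So the claim is that `E(q) = (1 - aτ) M_n(τ)`, a form of weight 2, is
annihilated by `L_n` as a function of `t(q)`. Since `L_n` is a symmetric square, two relations
suffice: `ω² = E² p(t)` for `ω = θt/t`, and `2θl - l² = E² κ(t)` for `l = θE/E`, where `p` and `κ`
are polynomials built from the `bᵢ` (`Uniformization.opD3_eq_zero`).

Both relations are checked algebraically. Polynomials `m, ρ, c` determine formal series `v, P, ψ =
θP/P, r = √ρ(v)` by a closed differential system (`exists_modularSystem`). With `t = vT(v)/Q(v)` and
`E = P Q(v)/√η(v)` the two relations become polynomial identities in `v`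
(`ParametrizationCertificate.exists_uniformization`).

It remains to recognize eta quotients in the formal system. Polynomial identities show that suitable
combinations `6ψ + P(±a(v) + b(v) r)` solve Ramanujan's differential equation. A solution with
constant term `d` is determined by its coefficient at `q^d` (`IsRamanujan.ext`), and this
coefficient is read off from the discriminant; hence the combinations equal `d E₂(q^d)`
(`EisensteinPair.eq_scaledE2`). As `d E₂(q^d)/24` is the logarithmic derivative of `η(q^d)`,
comparing logarithmic derivatives expresses the eta quotients through `v` and `P`. The only analytic
input is of level one: Ramanujan's equation for `E₂`, which holds because a weight 8 form without
constant term vanishes. Case 12 is level six after `q ↦ -q`.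

Uniqueness and convergence come from the coefficient recurrence of `L_n`, whose leading factor is
`n³`. -/

namespace MSeries
open PowerSeries

/-- The derivation `X * d/dX` of the ring of formal power series. -/
noncomputable def theta : Derivation ℂ ℂ⟦X⟧ ℂ⟦X⟧ := (X : ℂ⟦X⟧) • PowerSeries.derivative ℂ

theorem theta_apply (f : ℂ⟦X⟧) : theta f = X * PowerSeries.derivative ℂ f := rfl

@[simp]
theorem coeff_theta (f : ℂ⟦X⟧) (n : ℕ) : coeff n (theta f) = n * coeff n f := by
  rw [theta_apply]
  cases n with
  | zero => simp
  | succ n => rw [coeff_succ_X_mul, coeff_derivative]; push_cast; ring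

/-! ### Holomorphic functions on the upper half plane and their `q`-expansions -/

section Eisenstein

open UpperHalfPlane ModularForm Derivative EisensteinSeries
open scoped Manifold MatrixGroups Real

/-- `f` is holomorphic on the upper half plane with `q`-expansion `a`. -/
structure HasQExpansion (f : ℍ → ℂ) (a : ℂ⟦X⟧) : Prop where
  holo : MDiff f
  hasSum : ∀ τ : ℍ, HasSum (fun m ↦ coeff m a • Function.Periodic.qParam 1 τ ^ m) (f τ)

namespace HasQExpansion

variable {f g : ℍ → ℂ} {a b : ℂ⟦X⟧}

theorem bounded (h : HasQExpansion f a) : IsBoundedAtImInfty f :=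
  isBoundedAtImInfty_of_hasSum_qExpansion one_pos h.hasSum

theorem periodic (h : HasQExpansion f a) : Function.Periodic (f ∘ ofComplex) ((1 : ℝ) : ℂ) := by
  intro w
  by_cases! hw : 0 < w.im
  · have hw1 : 0 < (w + (1 : ℝ)).im := by simp [hw]
    simp only [Function.comp_apply, ofComplex_apply_of_im_pos hw1, ofComplex_apply_of_im_pos hw]
    refine (h.hasSum ⟨_, hw1⟩).unique ?_
    have := h.hasSum ⟨w, hw⟩
    have e : Function.Periodic.qParam 1 (w + (1 : ℝ)) = Function.Periodic.qParam 1 w := by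
      simp [Function.Periodic.qParam, mul_add, Complex.exp_add]
    simp only at this ⊢
    rwa [e]
  · have : (w + (1 : ℝ)).im ≤ 0 := by simpa using hw
    rw [Function.comp_apply, Function.comp_apply, ofComplex_apply_of_im_nonpos this,
      ofComplex_apply_of_im_nonpos hw]

theorem analyticAt (h : HasQExpansion f a) : AnalyticAt ℂ (cuspFunction 1 f) 0 :=
  analyticAt_cuspFunction_zero one_pos h.periodic h.holo h.bounded

theorem qExpansion_eq (h : HasQExpansion f a) : qExpansion 1 f = a := by
  ext m
  have h1 := (hasFPowerSeriesOnBall_cuspFunction (c := fun m ↦ coeff m a) one_pos h.analyticAt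
    h.hasSum).hasFPowerSeriesAt
  have h2 : HasFPowerSeriesAt (cuspFunction 1 f)
      (.ofScalars ℂ fun m ↦ coeff m (qExpansion 1 f)) 0 := by
    simpa [qExpansion_coeff, div_eq_mul_inv, mul_comm] using h.analyticAt.hasFPowerSeriesAt
  simpa using (congr_arg (FormalMultilinearSeries.coeff · m)
    (h1.eq_formalMultilinearSeries h2)).symm

theorem of_qExpansion (hp : Function.Periodic (f ∘ ofComplex) ((1 : ℝ) : ℂ)) (hd : MDiff f)
    (hb : IsBoundedAtImInfty f) (hq : qExpansion 1 f = a) : HasQExpansion f a :=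
  ⟨hd, fun τ ↦ by rw [← hq]; exact hasSum_qExpansion one_pos hp hd hb τ⟩

theorem mul (hf : HasQExpansion f a) (hg : HasQExpansion g b) : HasQExpansion (f * g) (a * b) := by
  refine of_qExpansion (hf.periodic.mul hg.periodic) (hf.holo.mul hg.holo)
    (hf.bounded.mul hg.bounded) ?_
  rw [qExpansion_mul hf.analyticAt hg.analyticAt, hf.qExpansion_eq, hg.qExpansion_eq]

theorem add (hf : HasQExpansion f a) (hg : HasQExpansion g b) : HasQExpansion (f + g) (a + b) :=
  ⟨hf.holo.add hg.holo, fun τ ↦ by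
    simpa [add_mul] using (hf.hasSum τ).add (hg.hasSum τ)⟩

theorem smul (c : ℂ) (hf : HasQExpansion f a) : HasQExpansion (c • f) (c • a) :=
  ⟨hf.holo.const_smul c, fun τ ↦ by
    simpa [mul_assoc] using (hf.hasSum τ).mul_left c⟩

/-- Here `f = G(q)` with `G` holomorphic on the unit disc, so `(2πi)⁻¹ d/dτ` becomes `q d/dq` by the
chain rule, and the Taylor series of `G'` converges on the whole disc. -/
theorem normalizedDeriv (hf : HasQExpansion f a) : HasQExpansion (D f) (theta a) := by
  refine ⟨normalizedDerivOfComplex_mdifferentiable hf.holo, fun τ ↦ ?_⟩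
  set G := cuspFunction 1 f with hG
  have hGd : DifferentiableOn ℂ G (Metric.ball 0 1) :=
    differentiableOn_cuspFunction_ball one_pos hf.periodic hf.holo hf.bounded
  set q : ℂ := Function.Periodic.qParam 1 τ with hq
  have hq1 : q ∈ Metric.ball (0 : ℂ) 1 := by
    simpa using Function.Periodic.norm_qParam_lt_one one_pos τ.im_pos
  have hcoef (n : ℕ) : iteratedDeriv n G 0 = n.factorial * coeff n a := by
    have := qExpansion_coeff (h := 1) f n
    rw [hf.qExpansion_eq] at this
    rw [this, mul_inv_cancel_left₀ (by exact_mod_cast n.factorial_ne_zero)]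
  have key : HasSum (fun n : ℕ ↦ ((n + 1 : ℕ) : ℂ) * coeff (n + 1) a * q ^ n) (deriv G q) := by
    have := Complex.hasSum_taylorSeries_on_ball (hGd.deriv Metric.isOpen_ball) hq1
    refine this.congr_fun fun n ↦ ?_
    rw [← iteratedDeriv_succ', hcoef]
    have : (n.factorial : ℂ) ≠ 0 := by exact_mod_cast n.factorial_ne_zero
    simp [Nat.factorial_succ]
    field_simp
  have hder : D f τ = q * deriv G q := by
    have h1 : (f ∘ ofComplex) =ᶠ[nhds (τ : ℂ)] fun w ↦ G (Function.Periodic.qParam 1 w) := by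
      filter_upwards [isOpen_upperHalfPlaneSet.mem_nhds τ.im_pos] with w hw
      rw [Function.comp_apply, ofComplex_apply_of_im_pos hw]
      exact (eq_cuspFunction ⟨w, hw⟩ one_ne_zero hf.periodic).symm
    have h2 : HasDerivAt (fun w : ℂ ↦ Function.Periodic.qParam 1 w) (2 * π * Complex.I * q) τ := by
      simp only [hq, Function.Periodic.qParam, Complex.ofReal_one, div_one]
      have := ((hasDerivAt_id (τ : ℂ)).const_mul (2 * π * Complex.I)).cexp
      simpa [mul_comm] using this
    have h3 : HasDerivAt G (deriv G q) q :=
      (hGd.differentiableAt (Metric.isOpen_ball.mem_nhds hq1)).hasDerivAt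
    have h4 : HasDerivAt (fun w ↦ G (Function.Periodic.qParam 1 w))
        (deriv G q * (2 * π * Complex.I * q)) τ := h3.comp (τ : ℂ) h2
    rw [normalizedDerivOfComplex, h1.deriv_eq, h4.deriv]
    have : (2 * π * Complex.I : ℂ) ≠ 0 := Complex.two_pi_I_ne_zero
    field_simp
  -- The constant term of `theta a` is zero, so the sum may start at index 1, which matches the
  -- factor `q` in front of `G'`.
  rw [hder, ← hasSum_nat_add_iff' 1]
  simp only [coeff_theta, smul_eq_mul, Finset.range_one, Finset.sum_singleton, CharP.cast_eq_zero,
    zero_mul, sub_zero]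
  refine (key.mul_left q).congr_fun fun n ↦ ?_
  rw [pow_succ]; ring

end HasQExpansion

/-- The `q`-expansion of the Eisenstein series `E₂`. -/
noncomputable def eisensteinTwo : ℂ⟦X⟧ :=
  PowerSeries.mk fun m ↦ if m = 0 then 1 else -24 * (ArithmeticFunction.sigma 1 m : ℂ)

theorem hasQExpansion_E2 : HasQExpansion E2 eisensteinTwo :=
  ⟨E2_mdifferentiable, fun τ ↦ by
    simpa [eisensteinTwo, Function.Periodic.qParam] using hasSum_qExpansion_E2 (z := τ)⟩

end Eisenstein

end MSeries

/-! ### Ramanujan's differential equation for `E₂` -/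

namespace MSeries
open PowerSeries

section Eisenstein

open UpperHalfPlane ModularForm Derivative EisensteinSeries
open scoped Manifold MatrixGroups Real

theorem normalizedDeriv_D2 (γ : SL(2, ℤ)) (z : ℍ) :
    D (D2 γ) z = -(γ 1 0 / denom γ z) ^ 2 := by
  have h1 : (D2 γ ∘ ofComplex) =ᶠ[nhds (z : ℂ)]
      fun w ↦ (2 * π * Complex.I * γ 1 0) / ((γ 1 0 : ℂ) * w + γ 1 1) := by
    filter_upwards [isOpen_upperHalfPlaneSet.mem_nhds z.im_pos] with w hw
    rw [Function.comp_apply, ofComplex_apply_of_im_pos hw, D2, ModularGroup.denom_apply]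
  have hz : ((γ 1 0 : ℂ) * z + γ 1 1) ≠ 0 := by
    rw [← ModularGroup.denom_apply]; exact denom_ne_zero _ z
  have h2 : HasDerivAt (fun w : ℂ ↦ (2 * π * Complex.I * γ 1 0) / ((γ 1 0 : ℂ) * w + γ 1 1))
      (-((2 * π * Complex.I * γ 1 0) * γ 1 0) / ((γ 1 0 : ℂ) * z + γ 1 1) ^ 2) z := by
    have h3 : HasDerivAt (fun w : ℂ ↦ (γ 1 0 : ℂ) * w + γ 1 1) (γ 1 0 : ℂ) z := by
      simpa using ((hasDerivAt_id (z : ℂ)).const_mul (γ 1 0 : ℂ)).add_const (γ 1 1 : ℂ)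
    simpa using (hasDerivAt_const (z : ℂ) (2 * π * Complex.I * γ 1 0)).fun_div h3 hz
  rw [normalizedDerivOfComplex, h1.deriv_eq, h2.deriv, ModularGroup.denom_apply]
  have : (2 * π * Complex.I : ℂ) ≠ 0 := Complex.two_pi_I_ne_zero
  field_simp

theorem mdifferentiable_D2 (γ : SL(2, ℤ)) : MDiff (D2 γ) := by
  rw [UpperHalfPlane.mdifferentiable_iff]
  intro w hw
  have hz : ((γ 1 0 : ℂ) * w + γ 1 1) ≠ 0 := by
    have := denom_ne_zero (γ : GL (Fin 2) ℝ) (⟨w, hw⟩ : ℍ)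
    rwa [ModularGroup.denom_apply] at this
  have h2 : DifferentiableAt ℂ
      (fun w : ℂ ↦ (2 * π * Complex.I * γ 1 0) / ((γ 1 0 : ℂ) * w + γ 1 1)) w := by
    fun_prop (disch := exact hz)
  refine (h2.congr_of_eventuallyEq ?_).differentiableWithinAt
  filter_upwards [isOpen_upperHalfPlaneSet.mem_nhds hw] with w hw
  rw [Function.comp_apply, ofComplex_apply_of_im_pos hw, D2, ModularGroup.denom_apply]

/-- The Serre derivative of `E₂`, a modular form of weight `4`. -/
noncomputable def serreE2 : ℍ → ℂ := D E2 + (-1 / 12 : ℂ) • (E2 * E2)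

/-- `E₂` fails to be modular by a multiple of `c/(cτ + d)`. The defects of `D E₂`, linear and
quadratic in this quantity, are exactly those of `E₂²/12`. -/
theorem serreE2_slash (γ : SL(2, ℤ)) : serreE2 ∣[(4 : ℤ)] γ = serreE2 := by
  have hE := E2_slash_action γ
  have h1 := normalizedDerivOfComplex_SL_slash (k := 2) E2_mdifferentiable (γ := γ)
  have h2 : D (E2 ∣[(2 : ℤ)] γ) = D E2 - (1 / (2 * riemannZeta 2)) • D (D2 γ) := by
    rw [hE, normalizedDerivOfComplex_sub _ _ E2_mdifferentiable
      ((mdifferentiable_D2 γ).const_smul _), normalizedDerivOfComplex_smul _ _ (mdifferentiable_D2 γ)]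
  have h3 : (E2 * E2) ∣[(4 : ℤ)] γ = (E2 ∣[(2 : ℤ)] γ) * (E2 ∣[(2 : ℤ)] γ) :=
    ModularForm.mul_slash_SL2 2 2 γ E2 E2
  have h4 : serreE2 ∣[(4 : ℤ)] γ = (D E2 ∣[(4 : ℤ)] γ) + (-1 / 12 : ℂ) •
      ((E2 ∣[(2 : ℤ)] γ) * (E2 ∣[(2 : ℤ)] γ)) := by
    rw [serreE2, SlashAction.add_slash, ModularForm.SL_smul_slash, h3]
  ext z
  have h5 := congrFun (h1.symm.trans h2) z
  have h6 := congrFun hE z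
  rw [h4]
  simp only [Pi.sub_apply, Pi.smul_apply, smul_eq_mul, Pi.add_apply, Pi.mul_apply,
    normalizedDeriv_D2, D2, serreE2] at h5 h6 ⊢
  rw [h6] at h5 ⊢
  have hpi : (π : ℂ) ≠ 0 := by exact_mod_cast Real.pi_ne_zero
  have hI := Complex.I_ne_zero
  have hd : denom γ z ≠ 0 := denom_ne_zero _ z
  have h7 : (D E2 ∣[(4 : ℤ)] γ) z = _ := eq_add_of_sub_eq h5
  rw [h7, riemannZeta_two]
  field_simp
  ring_nf
  simp only [Complex.I_pow_three, Complex.I_sq]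
  ring

/-- The Ramanujan differential equations, in terms of a series `y` of weight `2` alone. -/
def IsRamanujan (y : ℂ⟦X⟧) : Prop :=
  2 * theta (y * (y ^ 2 - 12 * theta y) - 3 * theta (y ^ 2 - 12 * theta y)) =
    y * (y * (y ^ 2 - 12 * theta y) - 3 * theta (y ^ 2 - 12 * theta y)) -
      (y ^ 2 - 12 * theta y) ^ 2

theorem HasQExpansion.serreDerivative {f : ℍ → ℂ} {a : ℂ⟦X⟧} (k : ℂ) (hf : HasQExpansion f a) :
    HasQExpansion (serreDerivative k f) (theta a + (-k / 12) • (eisensteinTwo * a)) := by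
  have : Derivative.serreDerivative k f = D f + (-k / 12) • (E2 * f) := by
    ext z
    simp only [serreDerivative_apply, Pi.add_apply, Pi.smul_apply, Pi.mul_apply, smul_eq_mul]
    ring
  rw [this]
  exact hf.normalizedDeriv.add ((hasQExpansion_E2.mul hf).smul _)

/-- There are no cusp forms of weight 8 and level one: the Sturm bound `8/12` is below 1. -/
theorem eq_zero_of_hasQExpansion {f : ℍ → ℂ} {a : ℂ⟦X⟧} (hf : HasQExpansion f a)
    (hs : ∀ γ : SL(2, ℤ), f ∣[(8 : ℤ)] γ = f) (h0 : constantCoeff a = 0) : a = 0 := by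
  let F : ModularForm 𝒮ℒ 8 :=
    { toFun := f
      slash_action_eq' := fun _ ⟨γ, hγ⟩ ↦ hγ ▸ hs γ
      holo' := hf.holo
      bdd_at_cusps' {c} hc := by
        rw [Subgroup.IsArithmetic.isCusp_iff_isCusp_SL2Z] at hc
        rw [OnePoint.isBoundedAt_iff_forall_SL2Z hc]
        intro γ _
        rw [hs γ]
        exact hf.bounded }
  have hq : qExpansion 1 F = a := hf.qExpansion_eq
  have hF : F = 0 := by
    refine sturm_bound_levelOne (k := 8) (f := F) ?_
    rw [hq]
    have : (1 : ℕ∞) ≤ a.order := by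
      rw [Order.one_le_iff_ne_zero]
      simpa [order_ne_zero_iff_constCoeff_eq_zero] using h0
    exact lt_of_lt_of_le (by norm_num) this
  rw [← hq, hF]
  exact qExpansion_zero 1

/-- Up to constants, `serreE2` is `E₄`, its Serre derivative is `E₆`, and the next Serre derivative
is a multiple of `E₄²`. Eliminating `E₄` and `E₆` leaves one equation for `E₂` alone. -/
theorem isRamanujan_eisensteinTwo : IsRamanujan eisensteinTwo := by
  set y := eisensteinTwo with hy
  have h1 : HasQExpansion serreE2 (theta y + (-1 / 12 : ℂ) • (y * y)) :=
    hasQExpansion_E2.normalizedDeriv.add ((hasQExpansion_E2.mul hasQExpansion_E2).smul _)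
  have h2 := h1.serreDerivative 4
  have h3 := h2.serreDerivative 6
  -- The constant terms run `-1/12`, `1/36`, `-1/72`, each Serre derivative of weight `k`
  -- multiplying by `-k/12`. The factor 2 makes `2 (1/12)²` cancel the last one.
  have h4 := h3.add ((h1.mul h1).smul 2)
  have hs4 := serreE2_slash
  have hs6 (γ : SL(2, ℤ)) := serreDerivative_slash_invariant h1.holo (hs4 γ)
  have hs8 (γ : SL(2, ℤ)) := serreDerivative_slash_invariant (k := 6) h2.holo (hs6 γ)
  have hmul (γ : SL(2, ℤ)) : (serreE2 * serreE2) ∣[(8 : ℤ)] γ = serreE2 * serreE2 := by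
    have := ModularForm.mul_slash_SL2 4 4 γ serreE2 serreE2
    rw [hs4] at this
    exact this
  have hc : constantCoeff eisensteinTwo = 1 := by simp [eisensteinTwo]
  have ht (f : ℂ⟦X⟧) : constantCoeff (theta f) = 0 := by simp [theta_apply]
  have h5 := eq_zero_of_hasQExpansion h4 (fun γ ↦ by
    rw [SlashAction.add_slash, ModularForm.SL_smul_slash, hmul]
    congr 1
    exact hs8 γ) (by
    simp only [map_add, map_mul, ht, smul_eq_C_mul, hy, hc, constantCoeff_C]
    norm_num)
  have hn (n : ℕ) [n.AtLeastTwo] : theta (OfNat.ofNat n : ℂ⟦X⟧) = 0 :=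
    theta.map_natCast n
  have hC (c : ℂ) : theta (C c) = 0 := by simp [theta_apply]
  have hk : (12 : ℂ⟦X⟧) * C (1 / 12) = 1 := by
    rw [← map_ofNat (C (R := ℂ)), ← map_mul]; norm_num
  have e1 : C (-1 / 12 : ℂ) = -C (1 / 12 : ℂ) := by rw [← map_neg]; norm_num
  have e4 : C (-4 / 12 : ℂ) = -(4 * C (1 / 12 : ℂ)) := by
    rw [← map_ofNat (C (R := ℂ)), ← map_mul, ← map_neg]; norm_num
  have e6 : C (-6 / 12 : ℂ) = -(6 * C (1 / 12 : ℂ)) := by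
    rw [← map_ofNat (C (R := ℂ)), ← map_mul, ← map_neg]; norm_num
  rw [IsRamanujan]
  rw [← hy] at h5
  simp only [smul_eq_C_mul, e1, e4, e6, map_ofNat] at h5
  have hC := hC (1 / 12)
  generalize C (1 / 12 : ℂ) = k at h5 hk hC
  simp only [map_add, map_sub, map_neg, Derivation.leibniz, Derivation.leibniz_pow, hC, hn,
    smul_eq_mul, nsmul_eq_mul] at h5 ⊢
  generalize theta (theta (theta y)) = y3 at *
  generalize theta (theta y) = y2 at *
  generalize theta y = y1 at *
  clear_value y
  -- What remains is polynomial algebra in `y`, its first three derivatives and the constant `k`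
  -- with `12 k = 1`.
  grind

end Eisenstein

end MSeries

/-! ### Formal solutions of Ramanujan's equation -/

namespace MSeries
open PowerSeries

theorem theta_ofNat (n : ℕ) [n.AtLeastTwo] : theta (ofNat(n) : ℂ⟦X⟧) = 0 :=
  theta.map_natCast n

theorem theta_natCast (n : ℕ) : theta (n : ℂ⟦X⟧) = 0 := theta.map_natCast n

theorem theta_C (c : ℂ) : theta (C c) = 0 := by simp [theta_apply]

theorem constantCoeff_theta (f : ℂ⟦X⟧) : constantCoeff (theta f) = 0 := by simp [theta_apply]

theorem constantCoeff_ofNat (n : ℕ) [n.AtLeastTwo] :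
    constantCoeff (ofNat(n) : ℂ⟦X⟧) = (ofNat(n) : ℂ) := map_ofNat _ n

theorem X_pow_dvd_theta {f : ℂ⟦X⟧} {n : ℕ} (h : X ^ n ∣ f) : X ^ n ∣ theta f := by
  rw [X_pow_dvd_iff] at h ⊢
  intro m hm
  rw [coeff_theta, h m hm, mul_zero]

/-- This is the linearization device: when two series agree below order `n`, the order `n`
coefficient of a difference of nonlinear expressions depends linearly on that of the series. -/
theorem coeff_mul_of_X_pow_dvd {e : ℂ⟦X⟧} {n : ℕ} (h : X ^ n ∣ e) (f : ℂ⟦X⟧) :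
    coeff n (f * e) = constantCoeff f * coeff n e := by
  obtain ⟨e, rfl⟩ := h
  rw [mul_left_comm, coeff_X_pow_mul', coeff_X_pow_mul']
  simp

theorem coeff_ofNat_mul (k n : ℕ) [k.AtLeastTwo] (f : ℂ⟦X⟧) :
    coeff n ((ofNat(k) : ℂ⟦X⟧) * f) = (ofNat(k) : ℂ) * coeff n f := by
  rw [← map_ofNat (C (R := ℂ)), coeff_C_mul]

/-- The weight `4` form `d² E₄(q ^ d)` attached to `d E₂(q ^ d)`. -/
noncomputable def formFour (y : ℂ⟦X⟧) : ℂ⟦X⟧ := y ^ 2 - 12 * theta y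

/-- The weight `6` form `d³ E₆(q ^ d)` attached to `d E₂(q ^ d)`. -/
noncomputable def formSix (y : ℂ⟦X⟧) : ℂ⟦X⟧ := y * formFour y - 3 * theta (formFour y)

theorem isRamanujan_iff (y : ℂ⟦X⟧) :
    IsRamanujan y ↔ 2 * theta (formSix y) = y * formSix y - formFour y ^ 2 := Iff.rfl

theorem isRamanujan_natCast (d : ℕ) : IsRamanujan (d : ℂ⟦X⟧) := by
  simp only [isRamanujan_iff, formSix, formFour, theta_natCast, Derivation.leibniz_pow,
    Derivation.leibniz, smul_zero, mul_zero, sub_zero, add_zero]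
  ring

section

variable {y y' : ℂ⟦X⟧} {c : ℂ} {n : ℕ}

theorem constantCoeff_formFour (h0 : constantCoeff y = c) :
    constantCoeff (formFour y) = c ^ 2 := by
  simp [formFour, constantCoeff_theta, h0]

theorem constantCoeff_formSix (h0 : constantCoeff y = c) :
    constantCoeff (formSix y) = c ^ 3 := by
  simp [formSix, constantCoeff_formFour h0, constantCoeff_theta, h0]
  ring

theorem formFour_sub : formFour y - formFour y' = (y + y') * (y - y') - 12 * theta (y - y') := by
  simp only [formFour, map_sub]; ring

theorem formSix_sub : formSix y - formSix y' = formFour y * (y - y') +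
    y' * (formFour y - formFour y') - 3 * theta (formFour y - formFour y') := by
  simp only [formSix, map_sub]; ring

theorem X_pow_dvd_formFour_sub (he : X ^ n ∣ y - y') : X ^ n ∣ formFour y - formFour y' := by
  rw [formFour_sub]
  exact dvd_sub (he.mul_left _) ((X_pow_dvd_theta he).mul_left _)

theorem X_pow_dvd_formSix_sub (he : X ^ n ∣ y - y') : X ^ n ∣ formSix y - formSix y' := by
  have h4 := X_pow_dvd_formFour_sub he
  rw [formSix_sub]
  exact dvd_sub (dvd_add (he.mul_left _) (h4.mul_left _)) ((X_pow_dvd_theta h4).mul_left _)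

theorem coeff_formFour_sub (he : X ^ n ∣ y - y') (h0 : constantCoeff y = c)
    (h0' : constantCoeff y' = c) :
    coeff n (formFour y - formFour y') = (2 * c - 12 * n) * coeff n (y - y') := by
  rw [formFour_sub, map_sub, coeff_mul_of_X_pow_dvd he, coeff_ofNat_mul, coeff_theta, map_add, h0,
    h0']
  ring

theorem coeff_formSix_sub (he : X ^ n ∣ y - y') (h0 : constantCoeff y = c)
    (h0' : constantCoeff y' = c) : coeff n (formSix y - formSix y') =
      (c ^ 2 + (c - 3 * n) * (2 * c - 12 * n)) * coeff n (y - y') := by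
  rw [formSix_sub, map_sub, map_add, coeff_mul_of_X_pow_dvd he,
    coeff_mul_of_X_pow_dvd (X_pow_dvd_formFour_sub he), coeff_ofNat_mul, coeff_theta,
    coeff_formFour_sub he h0 h0', constantCoeff_formFour h0, h0']
  ring

/-- Linearizing at the first order `n` where two solutions might differ gives the indicial
polynomial `72 n² (n - c)`. It vanishes only at `n = 0` and at the resonance `n = c`. -/
theorem IsRamanujan.coeff_sub (h : IsRamanujan y) (h' : IsRamanujan y') (h0 : constantCoeff y = c)
    (h0' : constantCoeff y' = c) (he : X ^ n ∣ y - y') (hn : n ≠ 0) (hc : (n : ℂ) ≠ c) :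
    coeff n (y - y') = 0 := by
  rw [isRamanujan_iff] at h h'
  have h4 := X_pow_dvd_formFour_sub he
  have h6 := X_pow_dvd_formSix_sub he
  have key : 2 * theta (formSix y - formSix y') = formSix y * (y - y') +
      y' * (formSix y - formSix y') - (formFour y + formFour y') * (formFour y - formFour y') := by
    rw [map_sub]; linear_combination h - h'
  have := congrArg (coeff n) key
  rw [coeff_ofNat_mul, coeff_theta, map_sub _ (_ + _), map_add, coeff_mul_of_X_pow_dvd he,
    coeff_mul_of_X_pow_dvd h4, coeff_mul_of_X_pow_dvd h6, coeff_formSix_sub he h0 h0',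
    coeff_formFour_sub he h0 h0', map_add, constantCoeff_formFour h0, constantCoeff_formFour h0',
    constantCoeff_formSix h0, h0'] at this
  have h2 : (72 * n ^ 2 * (n - c) : ℂ) * coeff n (y - y') = 0 := by linear_combination this
  refine (mul_eq_zero.mp h2).resolve_left ?_
  have : (n : ℂ) ≠ 0 := by exact_mod_cast hn
  simp [this, sub_ne_zero.mpr hc]

/-- The constant `d` is itself a solution, and no resonance occurs below order `d`. -/
theorem IsRamanujan.X_pow_dvd_sub {d : ℕ} (h : IsRamanujan y) (h0 : constantCoeff y = d) :
    X ^ d ∣ y - (d : ℂ⟦X⟧) := by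
  rw [X_pow_dvd_iff]
  intro m
  induction m using Nat.strong_induction_on with | _ m ih =>
  intro hm
  rcases eq_or_ne m 0 with rfl | hm0
  · simp [h0]
  · refine h.coeff_sub (isRamanujan_natCast d) h0 (by simp) ?_ hm0 (by exact_mod_cast hm.ne)
    rw [X_pow_dvd_iff]
    exact fun k hk ↦ ih k hk (hk.trans hm)

theorem IsRamanujan.ext {d : ℕ} (h : IsRamanujan y) (h' : IsRamanujan y')
    (h0 : constantCoeff y = d) (h0' : constantCoeff y' = d) (hd : coeff d y = coeff d y') :
    y = y' := by
  ext m
  rw [← sub_eq_zero, ← map_sub]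
  induction m using Nat.strong_induction_on with | _ m ih =>
  rcases eq_or_ne m 0 with rfl | hm0
  · simp [h0, h0']
  rcases eq_or_ne m d with rfl | hmd
  · simp [hd]
  · refine h.coeff_sub h' h0 h0' ?_ hm0 (by exact_mod_cast hmd)
    rw [X_pow_dvd_iff]
    exact ih

theorem formFour_natCast (d : ℕ) : formFour (d : ℂ⟦X⟧) = (d : ℂ⟦X⟧) ^ 2 := by
  simp [formFour]

theorem formSix_natCast (d : ℕ) : formSix (d : ℂ⟦X⟧) = (d : ℂ⟦X⟧) ^ 3 := by
  rw [formSix, formFour_natCast, Derivation.leibniz_pow, theta_natCast]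
  simp; ring

/-- The constant solution has discriminant `(d²)³ - (d³)² = 0`, so the leading term is linear in the
free coefficient of `y` at order `d`. This lets the discriminant detect that coefficient. -/
theorem IsRamanujan.X_pow_dvd_discriminant {d : ℕ} (h : IsRamanujan y)
    (h0 : constantCoeff y = d) :
    X ^ d ∣ formFour y ^ 3 - formSix y ^ 2 ∧
      coeff d (formFour y ^ 3 - formSix y ^ 2) = -72 * d ^ 5 * coeff d (y - (d : ℂ⟦X⟧)) := by
  have he := h.X_pow_dvd_sub h0
  have h0' : constantCoeff (d : ℂ⟦X⟧) = d := by simp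
  have h4 := X_pow_dvd_formFour_sub he
  have h6 := X_pow_dvd_formSix_sub he
  have e4 := coeff_formFour_sub he h0 h0'
  have e6 := coeff_formSix_sub he h0 h0'
  rw [formFour_natCast] at h4 e4
  rw [formSix_natCast] at h6 e6
  have key : formFour y ^ 3 - formSix y ^ 2 =
      (formFour y ^ 2 + formFour y * (d : ℂ⟦X⟧) ^ 2 + (d : ℂ⟦X⟧) ^ 4) *
        (formFour y - (d : ℂ⟦X⟧) ^ 2) - (formSix y + (d : ℂ⟦X⟧) ^ 3) *
        (formSix y - (d : ℂ⟦X⟧) ^ 3) := by ring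
  rw [key]
  refine ⟨dvd_sub (h4.mul_left _) (h6.mul_left _), ?_⟩
  rw [map_sub, coeff_mul_of_X_pow_dvd h4, coeff_mul_of_X_pow_dvd h6, e4, e6]
  simp only [map_add, map_mul, map_pow, constantCoeff_formFour h0, constantCoeff_formSix h0,
    map_natCast]
  ring

end

/-- The series `d E₂(q ^ d)`. -/
noncomputable def scaledE2 (d : ℕ) : ℂ⟦X⟧ := (d : ℂ⟦X⟧) * subst (X ^ d : ℂ⟦X⟧) eisensteinTwo

theorem hasSubst_X_pow {d : ℕ} (hd : d ≠ 0) : HasSubst (X ^ d : ℂ⟦X⟧) :=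
  HasSubst.of_constantCoeff_zero' (by simp [hd])

theorem theta_subst_X_pow {d : ℕ} (hd : d ≠ 0) (f : ℂ⟦X⟧) :
    theta (subst (X ^ d : ℂ⟦X⟧) f) = (d : ℂ⟦X⟧) * subst (X ^ d : ℂ⟦X⟧) (theta f) := by
  rw [theta_apply, theta_apply, derivative_subst (hasSubst_X_pow hd),
    subst_mul (hasSubst_X_pow hd), subst_X (hasSubst_X_pow hd), derivative_pow, derivative_X]
  obtain ⟨k, rfl⟩ := Nat.exists_eq_succ_of_ne_zero hd
  simp only [Nat.succ_eq_add_one, Nat.add_sub_cancel]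
  ring

/-- The equation is homogeneous of weight 8, with `y` and `theta` both of weight 2; the substitution
`q ↦ q^d` costs a factor `d` per `theta`, hence `d ^ 4` overall. -/
theorem isRamanujan_scaledE2 {d : ℕ} (hd : d ≠ 0) : IsRamanujan (scaledE2 d) := by
  have hs (f : ℂ⟦X⟧) : subst (X ^ d : ℂ⟦X⟧) f = substAlgHom (hasSubst_X_pow hd) f := by
    rw [coe_substAlgHom]
  have ht (f : ℂ⟦X⟧) := theta_subst_X_pow hd f
  simp only [hs] at ht
  have h := congrArg (fun f ↦ (d : ℂ⟦X⟧) ^ 4 * subst (X ^ d : ℂ⟦X⟧) f) isRamanujan_eisensteinTwo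
  rw [IsRamanujan, scaledE2]
  simp only [map_sub, Derivation.leibniz, Derivation.leibniz_pow, theta_natCast, theta_ofNat,
    ht, smul_eq_mul, nsmul_eq_mul, hs, map_mul, map_pow, map_ofNat, map_add,
    map_natCast, map_zero] at h ⊢
  linear_combination h

theorem constantCoeff_scaledE2 {d : ℕ} (hd : d ≠ 0) : constantCoeff (scaledE2 d) = d := by
  rw [scaledE2, map_mul, constantCoeff_subst_X_pow hd]
  simp [eisensteinTwo]

theorem coeff_scaledE2 {d : ℕ} (hd : d ≠ 0) : coeff d (scaledE2 d) = -24 * d := by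
  rw [scaledE2, ← map_natCast (C (R := ℂ)), coeff_C_mul, coeff_subst_X_pow hd]
  simp [eisensteinTwo, Nat.div_self (Nat.pos_of_ne_zero hd)]
  ring

end MSeries

/-! ### Existence of the formal differential systems -/

namespace MSeries
open PowerSeries

/-- Contraction principle for the `X`-adic topology: each application of `G` makes one more
coefficient agree. -/
theorem exists_fixedPoint {ι : Type*} (G : (ι → ℂ⟦X⟧) → ι → ℂ⟦X⟧)
    (hG : ∀ n x y, (∀ i, (X : ℂ⟦X⟧) ^ n ∣ x i - y i) → ∀ i, (X : ℂ⟦X⟧) ^ (n + 1) ∣ G x i - G y i) :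
    ∃ x, G x = x := by
  set s : ℕ → ι → ℂ⟦X⟧ := fun n ↦ G^[n] 0 with hs
  have hsucc (n) : s (n + 1) = G (s n) := Function.iterate_succ_apply' G n 0
  have h1 (n) : ∀ i, (X : ℂ⟦X⟧) ^ n ∣ s (n + 1) i - s n i := by
    induction n with
    | zero => simp
    | succ n ih => rw [hsucc (n + 1), hsucc n]; rw [hsucc n] at ih; exact hG n _ _ ih
  have h2 (n k) : ∀ i, (X : ℂ⟦X⟧) ^ n ∣ s (n + k) i - s n i := by
    induction k with
    | zero => simp
    | succ k ih =>
      intro i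
      rw [← sub_add_sub_cancel _ (s (n + k) i)]
      exact dvd_add ((pow_dvd_pow X (Nat.le_add_right n k)).trans (h1 (n + k) i)) (ih i)
  -- The coefficient at `k` is stable from the iterate `k + 1` on.
  let x : ι → ℂ⟦X⟧ := fun i ↦ PowerSeries.mk fun k ↦ coeff k (s (k + 1) i)
  have h3 (n i) : (X : ℂ⟦X⟧) ^ n ∣ x i - s n i := by
    rw [X_pow_dvd_iff]
    intro k hk
    obtain ⟨l, rfl⟩ := Nat.exists_eq_add_of_lt hk
    have := X_pow_dvd_iff.mp (h2 (k + 1) l i) k (Nat.lt_succ_self k)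
    rw [map_sub, coeff_mk, ← neg_eq_zero, neg_sub, ← map_sub]
    rwa [add_right_comm] at this
  refine ⟨x, funext fun i ↦ ?_⟩
  ext n
  have h4 := hG n _ _ (h3 n) i
  rw [← hsucc] at h4
  have h5 := dvd_sub h4 (h3 (n + 1) i)
  rw [sub_sub_sub_cancel_right] at h5
  rw [← sub_eq_zero, ← map_sub]
  exact X_pow_dvd_iff.mp h5 n (Nat.lt_succ_self n)

/-- Inverse of `theta` on series without constant term. -/
noncomputable def thetaInv (f : ℂ⟦X⟧) : ℂ⟦X⟧ := PowerSeries.mk fun n ↦ coeff n f / n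

/-- Inverse of `f ↦ d/dX (X * f)`. -/
noncomputable def thetaSuccInv (f : ℂ⟦X⟧) : ℂ⟦X⟧ := PowerSeries.mk fun n ↦ coeff n f / (n + 1 : ℕ)

theorem theta_thetaInv (f : ℂ⟦X⟧) : theta (thetaInv (X * f)) = X * f := by
  ext n
  rw [coeff_theta, thetaInv, coeff_mk]
  cases n with
  | zero => simp
  | succ n => exact mul_div_cancel₀ _ (by exact_mod_cast n.succ_ne_zero)

theorem theta_X_mul_thetaSuccInv (f : ℂ⟦X⟧) : theta (X * thetaSuccInv f) = X * f := by
  ext n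
  rw [coeff_theta]
  cases n with
  | zero => simp
  | succ n =>
    rw [coeff_succ_X_mul, coeff_succ_X_mul, thetaSuccInv, coeff_mk]
    exact mul_div_cancel₀ _ (by exact_mod_cast n.succ_ne_zero)

theorem constantCoeff_thetaInv (f : ℂ⟦X⟧) : constantCoeff (thetaInv f) = 0 := by
  simp [thetaInv]

theorem X_pow_dvd_thetaInv_sub {f g : ℂ⟦X⟧} {n : ℕ} (h : X ^ n ∣ f - g) :
    X ^ n ∣ thetaInv f - thetaInv g := by
  rw [X_pow_dvd_iff] at h ⊢
  intro m hm
  rw [map_sub, thetaInv, thetaInv, coeff_mk, coeff_mk, ← sub_div, ← map_sub, h m hm, zero_div]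

theorem X_pow_dvd_thetaSuccInv_sub {f g : ℂ⟦X⟧} {n : ℕ} (h : X ^ n ∣ f - g) :
    X ^ n ∣ thetaSuccInv f - thetaSuccInv g := by
  rw [X_pow_dvd_iff] at h ⊢
  intro m hm
  rw [map_sub, thetaSuccInv, thetaSuccInv, coeff_mk, coeff_mk, ← sub_div, ← map_sub, h m hm,
    zero_div]

open Polynomial in
theorem dvd_aeval_sub {k a b : ℂ⟦X⟧} (h : k ∣ a - b) (p : ℂ[X]) : k ∣ aeval a p - aeval b p := by
  rw [aeval_def, aeval_def, ← eval_map, ← eval_map]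
  exact h.trans (sub_dvd_eval_sub a b _)

theorem constantCoeff_aeval {v : ℂ⟦X⟧} (hv : constantCoeff v = 0) (p : Polynomial ℂ) :
    constantCoeff (Polynomial.aeval v p) = p.coeff 0 := by
  have h := dvd_aeval_sub (k := X) (a := v) (b := 0) (by rw [sub_zero, X_dvd_iff, hv]) p
  rw [X_dvd_iff, map_sub, sub_eq_zero] at h
  rw [h, ← Polynomial.coeff_zero_eq_aeval_zero']
  simp

/-- A power series `v` together with a weight `2` form `P`, its logarithmic derivative `ψ` and
a square root `r` of a polynomial in `v`, forming a closed differential system. -/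
structure DifferentialSystem (m ρ c : Polynomial ℂ) (v P ψ r : ℂ⟦X⟧) : Prop where
  theta_v : theta v = v * Polynomial.aeval v m * P * r
  theta_P : theta P = P * ψ
  theta_ψ : 2 * theta ψ = ψ ^ 2 + P ^ 2 * v * Polynomial.aeval v c
  theta_r : 2 * theta r = Polynomial.aeval v ρ.derivative * v * Polynomial.aeval v m * P
  r_sq : r ^ 2 = Polynomial.aeval v ρ

/-- A differential system with the initial values of a uniformizer `v = X + ⋯`. -/
structure ModularSystem (m ρ c : Polynomial ℂ) (v P ψ r : ℂ⟦X⟧) : Prop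
    extends DifferentialSystem m ρ c v P ψ r where
  const_v : constantCoeff v = 0
  coeff_v : coeff 1 v = 1
  const_P : constantCoeff P = 1
  const_ψ : constantCoeff ψ = 0
  const_r : constantCoeff r = 1

theorem two_mul_C_half : (2 : ℂ⟦X⟧) * C (1 / 2) = 1 := by
  rw [← map_ofNat (C (R := ℂ)), ← map_mul]; norm_num

theorem eq_zero_of_theta_eq_zero {f : ℂ⟦X⟧} (h : theta f = 0) (h0 : constantCoeff f = 0) :
    f = 0 := by
  ext n
  cases n with
  | zero => simpa using h0
  | succ n =>
    have := congrArg (coeff (n + 1)) h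
    rw [coeff_theta, map_zero] at this
    simpa using (mul_eq_zero.mp this).resolve_left (by exact_mod_cast n.succ_ne_zero)

theorem theta_aeval (p : Polynomial ℂ) (v : ℂ⟦X⟧) :
    theta (Polynomial.aeval v p) = Polynomial.aeval v p.derivative * theta v := by
  induction p using Polynomial.induction_on' with
  | add p q hp hq => simp only [map_add, hp, hq, add_mul]
  | monomial n a =>
    rw [Polynomial.derivative_monomial, Polynomial.aeval_monomial, Polynomial.aeval_monomial,
      Derivation.leibniz, Derivation.leibniz_pow, Derivation.map_algebraMap]
    simp
    ring

theorem exists_X_mul_eq {f : ℂ⟦X⟧} (h : constantCoeff f = 0) : ∃ g, f = X * g :=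
  X_dvd_iff.mpr h

/-- Put `v = X g` and `ψ = X χ` and integrate the four equations for `g, P, r, χ`; the resulting map
is an `X`-adic contraction. The algebraic relation for `r` is not imposed but follows from the
differential equations. -/
theorem exists_modularSystem (m ρ c : Polynomial ℂ) (hm : m.coeff 0 = 1) (hρ : ρ.coeff 0 = 1) :
    ∃ v P ψ r, ModularSystem m ρ c v P ψ r := by
  set H : ℂ⟦X⟧ := C (1 / 2) with hH
  have hH2 : 2 * H = 1 := two_mul_C_half
  let e (p : Polynomial ℂ) (g : ℂ⟦X⟧) : ℂ⟦X⟧ := Polynomial.aeval (X * g) p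
  let nP (P χ : ℂ⟦X⟧) : ℂ⟦X⟧ := 1 + thetaInv (X * (P * χ))
  let nr (g P : ℂ⟦X⟧) : ℂ⟦X⟧ := 1 + thetaInv (X * (H * e ρ.derivative g * g * e m g * P))
  -- The equations for `g` and `χ` carry no spare factor `X`. They are therefore fed the updated
  -- values `nP`, `nr` and `ng`, which have already gained an order; in the `g` equation the
  -- remaining dependence on `g` gains one because `m P r - 1` has no constant term.
  let ng (g P χ : ℂ⟦X⟧) : ℂ⟦X⟧ := 1 + thetaInv (g * (e m g * nP P χ * nr g P - 1))
  let nχ (g P χ : ℂ⟦X⟧) : ℂ⟦X⟧ := thetaSuccInv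
    (H * (X * χ ^ 2 + nP P χ ^ 2 * ng g P χ * e c (ng g P χ)))
  have hx {n} {a b : ℂ⟦X⟧} (h : X ^ n ∣ a - b) : X ^ (n + 1) ∣ X * a - X * b := by
    rw [← mul_sub, pow_succ']; exact mul_dvd_mul_left _ h
  have hx' {n} {a b : ℂ⟦X⟧} (h : X ^ n ∣ a - b) :
      X ^ n ∣ X * a - X * b := (pow_dvd_pow _ n.le_succ).trans (hx h)
  have hone {n} {a b : ℂ⟦X⟧} (h : X ^ n ∣ a - b) :
      X ^ n ∣ 1 + a - (1 + b) := by rwa [add_sub_add_left_eq_sub]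
  have hadd {n} {a b a' b' : ℂ⟦X⟧} (h : X ^ n ∣ a - b) (h' : X ^ n ∣ a' - b') :
      X ^ n ∣ a + a' - (b + b') := by rw [add_sub_add_comm]; exact dvd_add h h'
  have hsq {n} {a b : ℂ⟦X⟧} (h : X ^ n ∣ a - b) :
      X ^ n ∣ a ^ 2 - b ^ 2 := h.trans (sub_dvd_pow_sub_pow a b 2)
  have hcl {n} (k : ℂ⟦X⟧) {a b : ℂ⟦X⟧} (h : X ^ n ∣ a - b) :
      X ^ n ∣ k * a - k * b := by rw [← mul_sub]; exact h.mul_left _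
  have cP (P χ) : constantCoeff (nP P χ) = 1 := by simp [nP, constantCoeff_thetaInv]
  have cr (g P) : constantCoeff (nr g P) = 1 := by simp [nr, constantCoeff_thetaInv]
  have cx (g : ℂ⟦X⟧) : constantCoeff (X * g) = 0 := by simp
  have cg (g P χ) : constantCoeff (e m g * nP P χ * nr g P - 1) = 0 := by
    rw [map_sub, map_mul, map_mul, constantCoeff_aeval (cx g), hm, cP, cr]; simp
  let G : (Fin 4 → ℂ⟦X⟧) → Fin 4 → ℂ⟦X⟧ := fun y ↦
    ![ng (y 0) (y 1) (y 3), nP (y 1) (y 3), nr (y 0) (y 1), nχ (y 0) (y 1) (y 3)]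
  obtain ⟨y, hy⟩ := exists_fixedPoint G fun n y y' h ↦ by
    have h0 := h 0
    have h1 := h 1
    have h3 := h 3
    have dP := hone (X_pow_dvd_thetaInv_sub (hx (dvd_mul_sub_mul h1 h3)))
    have dm := dvd_aeval_sub (hx h0) m
    have dr := hone (X_pow_dvd_thetaInv_sub (hx (dvd_mul_sub_mul (dvd_mul_sub_mul (dvd_mul_sub_mul
      (hcl H (dvd_aeval_sub (hx' h0) ρ.derivative)) h0) (dvd_aeval_sub (hx' h0) m)) h1)))
    have dq := dvd_mul_sub_mul (dvd_mul_sub_mul dm dP) dr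
    have dg : X ^ (n + 1) ∣ ng (y 0) (y 1) (y 3) - ng (y' 0) (y' 1) (y' 3) := by
      refine hone (X_pow_dvd_thetaInv_sub ?_)
      set q := e m (y 0) * nP (y 1) (y 3) * nr (y 0) (y 1)
      set q' := e m (y' 0) * nP (y' 1) (y' 3) * nr (y' 0) (y' 1)
      have : y 0 * (q - 1) - y' 0 * (q' - 1) = (y 0 - y' 0) * (q - 1) + y' 0 * (q - q') := by ring
      rw [this]
      refine dvd_add ?_ (Dvd.dvd.mul_left dq _)
      rw [pow_succ]
      exact mul_dvd_mul h0 (X_dvd_iff.mpr (cg _ _ _))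
    have dχ := X_pow_dvd_thetaSuccInv_sub (hcl H (hadd (hx (hsq h3)) (dvd_mul_sub_mul
      (dvd_mul_sub_mul (hsq dP) dg) (dvd_aeval_sub (hx' dg) c))))
    simp only [Fin.forall_fin_succ, IsEmpty.forall_iff, and_true]
    exact ⟨dg, dP, dr, dχ⟩
  have eg : ng (y 0) (y 1) (y 3) = y 0 := congrFun hy 0
  have eP : nP (y 1) (y 3) = y 1 := congrFun hy 1
  have er : nr (y 0) (y 1) = y 2 := congrFun hy 2
  have eχ : nχ (y 0) (y 1) (y 3) = y 3 := congrFun hy 3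
  have tP : theta (y 1) = X * (y 1 * y 3) := by
    conv_lhs => rw [← eP]
    simp only [nP]
    rw [map_add, theta.map_one_eq_zero, theta_thetaInv, zero_add]
  have tr : theta (y 2) = X * (H * e ρ.derivative (y 0) * y 0 * e m (y 0) * y 1) := by
    conv_lhs => rw [← er]
    simp only [nr]
    rw [map_add, theta.map_one_eq_zero, theta_thetaInv, zero_add]
  have tg : theta (y 0) = y 0 * (e m (y 0) * y 1 * y 2 - 1) := by
    conv_lhs => rw [← eg]
    simp only [ng]
    rw [eP, er]
    obtain ⟨k, hk⟩ := exists_X_mul_eq (cg (y 0) (y 1) (y 3))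
    rw [eP, er] at hk
    rw [hk, mul_left_comm, map_add, theta.map_one_eq_zero, theta_thetaInv, zero_add]
  have tχ : theta (X * y 3) = X * (H * (X * y 3 ^ 2 + y 1 ^ 2 * y 0 * e c (y 0))) := by
    conv_lhs => rw [← eχ]
    simp only [nχ]
    rw [eP, eg, theta_X_mul_thetaSuccInv]
  have tX : theta X = X := by simp [theta_apply]
  have tv : theta (X * y 0) = X * y 0 * e m (y 0) * y 1 * y 2 := by
    rw [Derivation.leibniz, smul_eq_mul, smul_eq_mul, tX, tg]; ring
  have c1 : constantCoeff (y 1) = 1 := by rw [← eP, cP]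
  have c2 : constantCoeff (y 2) = 1 := by rw [← er, cr]
  have c0 : constantCoeff (y 0) = 1 := by
    rw [← eg]; simp [ng, constantCoeff_thetaInv]
  refine ⟨X * y 0, y 1, X * y 3, y 2, ⟨tv, by rw [tP]; ring, ?_, ?_, ?_⟩, by simp, ?_, c1, by simp,
    c2⟩
  · rw [tχ]
    simp only [e]
    linear_combination (X * (X * y 3 ^ 2 + y 1 ^ 2 * y 0 * e c (y 0))) * hH2
  · rw [tr]
    simp only [e]
    linear_combination X * (e ρ.derivative (y 0) * y 0 * e m (y 0) * y 1) * hH2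
  -- The derivative of `r² - ρ(v)` is zero, and so is its constant term.
  · rw [← sub_eq_zero]
    apply eq_zero_of_theta_eq_zero
    · rw [map_sub, theta_aeval, tv, Derivation.leibniz_pow, tr]
      simp only [e, smul_eq_mul, nsmul_eq_mul]
      push_cast
      linear_combination (X * (e ρ.derivative (y 0) * y 0 * e m (y 0) * y 1) * y 2) * hH2
    · rw [map_sub, constantCoeff_aeval (cx _), hρ, map_pow, c2]; simp
  · rw [← zero_add 1, coeff_succ_X_mul, coeff_zero_eq_constantCoeff, c0]

end MSeries

/-! ### Eisenstein series inside a differential system -/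

namespace MSeries
open PowerSeries

/-- The polynomial identities that make `6 ψ + P (a(v) + b(v) r)`, in a modular system, the
logarithmic derivative of a form `Δ(q ^ d)`; changing the sign of `a` gives the same for `d'`. -/
structure EisensteinPair (m ρ c a b : Polynomial ℂ) (d d' : ℕ) where
  z₀ : Polynomial ℂ
  z₁ : Polynomial ℂ
  w₀ : Polynomial ℂ
  w₁ : Polynomial ℂ
  D₀ : Polynomial ℂ
  D₁ : Polynomial ℂ
  s : Polynomial ℂ
  E : Polynomial ℂ
  K : Polynomial ℂ
  U : Polynomial ℂ
  hz₀ : z₀ = a ^ 2 + b ^ 2 * ρ - 36 * .X * c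
    - 6 * .X * m * (2 * b.derivative * ρ + b * ρ.derivative) := by simp [Polynomial.C_ofNat]; ring
  hz₁ : z₁ = 2 * a * b - 12 * .X * m * a.derivative := by simp [Polynomial.C_ofNat]; ring
  hw₀ : 2 * w₀ = 2 * (a * z₀ + b * z₁ * ρ)
    - 3 * .X * m * (2 * z₁.derivative * ρ + z₁ * ρ.derivative) := by simp [Polynomial.C_ofNat]; ring
  hw₁ : w₁ = a * z₁ + b * z₀ - 3 * .X * m * z₀.derivative := by simp [Polynomial.C_ofNat]; ring
  h₀ : .X * m * (2 * w₁.derivative * ρ + w₁ * ρ.derivative) =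
    a * w₀ + b * w₁ * ρ - (z₀ ^ 2 + z₁ ^ 2 * ρ) := by simp [Polynomial.C_ofNat]; ring
  h₁ : 2 * .X * m * w₀.derivative = a * w₁ + b * w₀ - 2 * z₀ * z₁ := by
    simp [Polynomial.C_ofNat]; ring
  ha : a.eval 0 + b.eval 0 = d := by norm_num
  ha' : -a.eval 0 + b.eval 0 = d' := by norm_num
  hs : ρ - s ^ 2 = .X ^ (d + 1) * E := by ring
  hs0 : s.eval 0 = 1 := by norm_num
  hD₀ : z₀ ^ 3 + 3 * z₀ * z₁ ^ 2 * ρ - (w₀ ^ 2 + w₁ ^ 2 * ρ) = D₀ := by ring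
  hD₁ : 3 * z₀ ^ 2 * z₁ + z₁ ^ 3 * ρ - 2 * w₀ * w₁ = D₁ := by ring
  hK : D₀ + D₁ * s = .X ^ d * K := by ring
  hK0 : K.eval 0 = 1728 * d ^ 6 := by norm_num
  hN : D₀ ^ 2 - D₁ ^ 2 * ρ = .X ^ (d + d') * U := by ring
  hU0 : U.eval 0 = 1728 ^ 2 * (d * d') ^ 6 := by norm_num

section

variable {m ρ c : Polynomial ℂ} {v P ψ r : ℂ⟦X⟧}

/-- The derivative of a function on the curve `r² = ρ(v)`. -/
theorem DifferentialSystem.two_mul_theta (S : DifferentialSystem m ρ c v P ψ r) (p q : Polynomial ℂ) :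
    2 * theta (Polynomial.aeval v p + Polynomial.aeval v q * r) =
      P * (Polynomial.aeval v (2 * .X * m * p.derivative) * r +
        Polynomial.aeval v (.X * m * (2 * q.derivative * ρ + q * ρ.derivative))) := by
  have hr := S.theta_r
  have hr2 := S.r_sq
  simp only [map_add, map_mul, map_ofNat, Polynomial.aeval_X, Derivation.leibniz, theta_aeval,
    smul_eq_mul, S.theta_v]
  linear_combination Polynomial.aeval v q * hr +
    2 * Polynomial.aeval v q.derivative * v * Polynomial.aeval v m * P * hr2

/-- The involution of differential systems that induces the Atkin-Lehner involution `d ↔ d'`. -/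
theorem DifferentialSystem.neg (S : DifferentialSystem m ρ c v P ψ r) :
    DifferentialSystem m ρ c v (-P) ψ (-r) where
  theta_v := by rw [S.theta_v]; ring
  theta_P := by rw [map_neg, S.theta_P]; ring
  theta_ψ := by rw [S.theta_ψ]; ring
  theta_r := by rw [map_neg]; linear_combination -S.theta_r
  r_sq := by rw [← S.r_sq]; ring

variable {a b : Polynomial ℂ} {d d' : ℕ}

/-- Everything lives in the module spanned by `1` and `r` over polynomials in `v`, where `theta` is
explicit. The certificate records the weight 4 form as `P²(z₀ + z₁ r)`, the weight 6 form as `P³(w₀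
+ w₁ r)` and the discriminant as `P⁶(D₀ + D₁ r)`; `h₀` and `h₁` are the two components of
Ramanujan's equation. -/
theorem EisensteinPair.forms (D : EisensteinPair m ρ c a b d d')
    (S : DifferentialSystem m ρ c v P ψ r) {y : ℂ⟦X⟧}
    (hy : y = 6 * ψ + P * (Polynomial.aeval v a + Polynomial.aeval v b * r)) :
    IsRamanujan y ∧ formFour y ^ 3 - formSix y ^ 2 =
      P ^ 6 * (Polynomial.aeval v D.D₀ + Polynomial.aeval v D.D₁ * r) := by
  have hr2 := S.r_sq
  have hab := S.two_mul_theta a b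
  have hz := S.two_mul_theta D.z₀ D.z₁
  have hw := S.two_mul_theta D.w₀ D.w₁
  have ev {p q : Polynomial ℂ} (h : p = q) := congrArg (Polynomial.aeval v) h
  have e1 := ev D.hz₀
  have e2 := ev D.hz₁
  have e3 := ev D.hw₀
  have e4 := ev D.hw₁
  have e5 := ev D.h₀
  have e6 := ev D.h₁
  have e7 := ev D.hD₀
  have e8 := ev D.hD₁
  simp only [map_add, map_mul, map_ofNat, map_sub, map_pow, Polynomial.aeval_X] at *
  have two : (2 : ℂ⟦X⟧) ≠ 0 := fun h ↦ by simpa [h] using two_mul_C_half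
  have f4 : formFour y = P ^ 2 * (Polynomial.aeval v D.z₀ + Polynomial.aeval v D.z₁ * r) := by
    rw [formFour, hy, map_add, Derivation.leibniz, Derivation.leibniz, S.theta_P, theta_ofNat,
      map_add]
    simp only [smul_eq_mul]
    linear_combination -36 * S.theta_ψ - 6 * P * hab - P ^ 2 * e1 - P ^ 2 * r * e2 +
      P ^ 2 * Polynomial.aeval v b ^ 2 * hr2
  have f6 : formSix y = P ^ 3 * (Polynomial.aeval v D.w₀ + Polynomial.aeval v D.w₁ * r) := by
    apply mul_left_cancel₀ two
    rw [formSix, f4, hy, Derivation.leibniz, Derivation.leibniz_pow, S.theta_P, map_add]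
    simp only [smul_eq_mul, nsmul_eq_mul]
    push_cast
    linear_combination -3 * P ^ 2 * hz - P ^ 3 * e3 - 2 * P ^ 3 * r * e4 +
      2 * P ^ 3 * Polynomial.aeval v b * Polynomial.aeval v D.z₁ * hr2
  constructor
  · rw [isRamanujan_iff, f6, f4, hy, Derivation.leibniz, Derivation.leibniz_pow, S.theta_P, map_add]
    simp only [smul_eq_mul, nsmul_eq_mul]
    push_cast
    linear_combination P ^ 3 * hw + P ^ 4 * e5 + P ^ 4 * r * e6 -
      P ^ 4 * (Polynomial.aeval v b * Polynomial.aeval v D.w₁ - Polynomial.aeval v D.z₁ ^ 2) * hr2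
  · rw [f6, f4]
    linear_combination P ^ 6 * e7 + P ^ 6 * r * e8 + P ^ 6 *
      (3 * Polynomial.aeval v D.z₀ * Polynomial.aeval v D.z₁ ^ 2 +
        r * Polynomial.aeval v D.z₁ ^ 3 - Polynomial.aeval v D.w₁ ^ 2) * hr2

/-- Both combinations solve Ramanujan's equation, so only the free coefficients at `d` and `d'` need
to be found. The first comes from the leading term of `D₀ + D₁ r`, computed with the truncation `s`
of `√ρ`. The second comes from the norm `D₀² - D₁² ρ`, the product of the two conjugate
discriminants up to `P¹²`, which avoids expanding `√ρ` to order `d'`. -/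
theorem EisensteinPair.eq_scaledE2 (D : EisensteinPair m ρ c a b d d')
    (S : ModularSystem m ρ c v P ψ r) (hd : d ≠ 0) (hd' : d' ≠ 0) :
    6 * ψ + P * (Polynomial.aeval v a + Polynomial.aeval v b * r) = scaledE2 d ∧
    6 * ψ + P * (-Polynomial.aeval v a + Polynomial.aeval v b * r) = scaledE2 d' := by
  have cc (p : Polynomial ℂ) : constantCoeff (Polynomial.aeval v p) = p.eval 0 := by
    rw [constantCoeff_aeval S.const_v, Polynomial.coeff_zero_eq_eval_zero]
  have hv : X ∣ v := X_dvd_iff.mpr S.const_v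
  set y := 6 * ψ + P * (Polynomial.aeval v a + Polynomial.aeval v b * r) with hy
  set y' := 6 * ψ + P * (-Polynomial.aeval v a + Polynomial.aeval v b * r) with hy'
  obtain ⟨h, hD⟩ := D.forms S.toDifferentialSystem hy
  -- Replacing `(P, r)` by `(-P, -r)` preserves the system and changes the sign of `a` only.
  obtain ⟨h', hD'⟩ := D.forms S.neg (y := y') (by rw [hy']; ring)
  have h0 : constantCoeff y = d := by
    simp [hy, cc, S.const_P, S.const_ψ, S.const_r, D.ha]
  have h0' : constantCoeff y' = d' := by
    simp [hy', cc, S.const_P, S.const_ψ, S.const_r, D.ha']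
  obtain ⟨g, rfl⟩ := hv
  have hg : constantCoeff g = 1 := by
    have := S.coeff_v
    rwa [← zero_add 1, coeff_succ_X_mul, coeff_zero_eq_constantCoeff] at this
  set A := fun p : Polynomial ℂ ↦ Polynomial.aeval (X * g) p with hA
  have eK := congrArg A D.hK
  have es := congrArg A D.hs
  have eN := congrArg A D.hN
  simp only [hA, map_add, map_mul, map_sub, map_pow, Polynomial.aeval_X] at eK es eN
  have hrs : IsUnit (r + A D.s) := by
    rw [isUnit_iff_constantCoeff, map_add, cc, S.const_r, D.hs0]
    norm_num
  obtain ⟨u, hu⟩ := hrs.exists_right_inv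
  -- Since `(r - s)(r + s) = ρ - s²` and `r + s` has constant term 2, `s` approximates `r` beyond
  -- order `d`.
  have hrs' : r - A D.s = (X * g) ^ (d + 1) * (A D.E * u) := by
    linear_combination (r - A D.s) * (-hu) + u * (S.r_sq + es)
  have hsum : A D.D₀ + A D.D₁ * r =
      X ^ d * (g ^ d * (A D.K + A D.D₁ * X * g * (A D.E * u))) := by
    linear_combination eK + A D.D₁ * hrs'
  have hcoeff (n : ℕ) (k : ℂ⟦X⟧) : coeff n (X ^ n * k) = constantCoeff k := by
    simp [coeff_X_pow_mul']
  obtain ⟨hdiv, hco⟩ := h.X_pow_dvd_discriminant h0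
  obtain ⟨⟨k, hk⟩, hco'⟩ := h'.X_pow_dvd_discriminant h0'
  have cK : constantCoeff (A D.K) = _ := cc D.K
  have hdc : (d : ℂ) ≠ 0 := by exact_mod_cast hd
  have hdc' : (d' : ℂ) ≠ 0 := by exact_mod_cast hd'
  have hcd (e : ℕ) (he : e ≠ 0) : coeff e (e : ℂ⟦X⟧) = 0 := by
    rw [← map_natCast (C (R := ℂ)), coeff_C, if_neg he]
  -- The leading coefficient `K(0) = 1728 d⁶` equals `-72 d⁵` times the coefficient of `y`, as for
  -- `Δ(q^d)`.
  have k1 : coeff d y = -24 * d := by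
    rw [hD, hsum, mul_left_comm, hcoeff] at hco
    simp only [map_mul, map_pow, map_add, hg, cK, D.hK0, S.const_P, constantCoeff_X, map_sub,
      hcd d hd] at hco
    have : (d : ℂ) ^ 5 ≠ 0 := pow_ne_zero _ hdc
    apply mul_left_cancel₀ this
    linear_combination (1 / 72) * hco
  -- Dividing the leading coefficient `1728² (d d')⁶` of the product by `1728 d⁶` leaves `1728 d'⁶`.
  have k2 : coeff d' y' = -24 * d' := by
    have hprod : (X : ℂ⟦X⟧) ^ (d + d') * (P ^ 6 * (g ^ d * (A D.K + A D.D₁ * X * g * (A D.E * u)))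
        * k) = X ^ (d + d') * (P ^ 12 * (g ^ (d + d') * A D.U)) := by
      have hD'' := hD'
      rw [hk] at hD''
      have e1 : (A D.D₀ + A D.D₁ * r) * (A D.D₀ + A D.D₁ * -r) =
          (X * g) ^ (d + d') * A D.U := by
        rw [← eN, ← S.r_sq]; ring
      rw [hsum] at e1
      linear_combination P ^ 12 * e1 + P ^ 6 * (X ^ d * (g ^ d *
        (A D.K + A D.D₁ * X * g * (A D.E * u)))) * hD''
    have hprod' := congrArg constantCoeff (mul_left_cancel₀ (pow_ne_zero _ X_ne_zero) hprod)
    have cU : constantCoeff (A D.U) = _ := cc D.U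
    simp only [map_mul, map_pow, map_add, hg, cK, D.hK0, S.const_P, constantCoeff_X, cU, D.hU0]
      at hprod'
    rw [hk, hcoeff] at hco'
    rw [map_sub, hcd d' hd'] at hco'
    have : (d' : ℂ) ^ 5 * d ^ 6 ≠ 0 := mul_ne_zero (pow_ne_zero _ hdc') (pow_ne_zero _ hdc)
    apply mul_left_cancel₀ this
    rw [hco'] at hprod'
    linear_combination (-1 / 72 / 1728) * hprod'
  exact ⟨h.ext (isRamanujan_scaledE2 hd) h0 (constantCoeff_scaledE2 hd)
      (k1.trans (coeff_scaledE2 hd).symm),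
    h'.ext (isRamanujan_scaledE2 hd') h0' (constantCoeff_scaledE2 hd')
      (k2.trans (coeff_scaledE2 hd').symm)⟩

end

end MSeries

/-! ### Eisenstein certificates at levels 6, 10, 14 and 15 -/

namespace MSeries
open Polynomial

/-- Here `v` will turn out to be `(η₂η₆/η₁η₃)⁶`. The polynomial `s` is a Taylor truncation of `√ρ`,
here `1 + 10 X`. -/
noncomputable def eisensteinPairSix_1_3 : EisensteinPair
    (1) (1 + 20 * X + 64 * X ^ 2) (-8 - 64 * X) (-1 - 16 * X) (2) 1 3 where
  z₀ := 5 + 160 * X + 1280 * X ^ 2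
  z₁ := -4 + 128 * X
  w₀ := -13 - 408 * X - 9984 * X ^ 2 - 53248 * X ^ 3
  w₁ := 14 - 224 * X - 7168 * X ^ 2
  D₀ := 864 * X - 5184 * X ^ 2 + 663552 * X ^ 3 + 3538944 * X ^ 4
  D₁ := 864 * X - 13824 * X ^ 2 - 442368 * X ^ 3
  s := 1 + 10 * X
  E := -36
  K := 1728 - 10368 * X + 82944 * X ^ 2 - 884736 * X ^ 3
  U := 2176782336

noncomputable def eisensteinPairSix_2_6 : EisensteinPair
    (1) (1 + 20 * X + 64 * X ^ 2) (-8 - 64 * X) (-2 - 8 * X) (4) 2 6 where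
  z₀ := 20 + 160 * X + 320 * X ^ 2
  z₁ := -16 + 32 * X
  w₀ := -104 - 1248 * X - 3264 * X ^ 2 - 6656 * X ^ 3
  w₁ := 112 + 224 * X - 896 * X ^ 2
  D₀ := 55296 * X ^ 2 + 663552 * X ^ 3 - 331776 * X ^ 4 + 3538944 * X ^ 5
  D₁ := 55296 * X ^ 2 + 110592 * X ^ 3 - 442368 * X ^ 4
  s := 1 + 10 * X - 18 * X ^ 2
  E := 360 - 324 * X
  K := 110592 + 1327104 * X - 663552 * X ^ 2 - 2875392 * X ^ 3 + 7962624 * X ^ 4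
  U := 8916100448256

/-- At level ten the eta quotient is `v/(1 - 4v)` rather than `v`, so the norm of the discriminant
also involves `1 - 4v`: here `U` is `1728² 5⁶ (1 - 4X)¹²`. At the other three levels `U` is
constant. -/
noncomputable def eisensteinPairTen_1_5 : EisensteinPair
    (1 - 4 * X) (1 + 4 * X - 16 * X ^ 2) (4 + 44 * X - 480 * X ^ 2 + 960 * X ^ 3) (-2 - 8 * X) (3 -
    36 * X) 1 5 where
  z₀ := 13 + 68 * X + 496 * X ^ 2 - 576 * X ^ 3
  z₁ := -12 + 192 * X + 192 * X ^ 2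
  w₀ := -62 + 120 * X - 6432 * X ^ 2 - 17792 * X ^ 3 + 55296 * X ^ 4
  w₁ := 63 - 756 * X - 5040 * X ^ 2 - 4032 * X ^ 3
  D₀ := 864 * X - 31104 * X ^ 2 + 492480 * X ^ 3 - 4465152 * X ^ 4 + 38568960 * X ^ 5 - 247283712
    * X ^ 6 + 857751552 * X ^ 7 - 1397882880 * X ^ 8 + 828112896 * X ^ 9
  D₁ := 864 * X - 32832 * X ^ 2 + 566784 * X ^ 3 - 5944320 * X ^ 4 + 29859840 * X ^ 5 - 57065472 *
    X ^ 6 - 3538944 * X ^ 7 + 77856768 * X ^ 8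
  s := 1 + 2 * X
  E := -20
  K := 1728 - 62208 * X + 993600 * X ^ 2 - 9275904 * X ^ 3 + 56540160 * X ^ 4 - 244629504 * X ^ 5
    + 740081664 * X ^ 6 - 1327104000 * X ^ 7 + 983826432 * X ^ 8
  U := 46656000000 - 2239488000000 * X + 49268736000000 * X ^ 2 - 656916480000000 * X ^ 3 +
    5912248320000000 * X ^ 4 - 37838389248000000 * X ^ 5 + 176579149824000000 * X ^ 6 -
    605414227968000000 * X ^ 7 + 1513535569920000000 * X ^ 8 - 2690729902080000000 * X ^ 9 +
    3228875882496000000 * X ^ 10 - 2348273369088000000 * X ^ 11 + 782757789696000000 * X ^ 12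

noncomputable def eisensteinPairTen_2_10 : EisensteinPair
    (1 - 4 * X) (1 + 4 * X - 16 * X ^ 2) (4 + 44 * X - 480 * X ^ 2 + 960 * X ^ 3) (-4 + 8 * X) (6 -
    36 * X) 2 10 where
  z₀ := 52 - 208 * X + 64 * X ^ 2 + 576 * X ^ 3
  z₁ := -48 + 288 * X - 192 * X ^ 2
  w₀ := -496 + 2976 * X + 960 * X ^ 2 - 37504 * X ^ 3 + 55296 * X ^ 4
  w₁ := 504 - 4032 * X + 8064 * X ^ 2 - 4032 * X ^ 3
  D₀ := 55296 * X ^ 2 - 663552 * X ^ 3 + 663552 * X ^ 4 + 22118400 * X ^ 5 - 105615360 * X ^ 6 +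
    74760192 * X ^ 7 + 465371136 * X ^ 8 - 828112896 * X ^ 9
  D₁ := 55296 * X ^ 2 - 774144 * X ^ 3 + 2764800 * X ^ 4 + 7741440 * X ^ 5 - 72990720 * X ^ 6 +
    152174592 * X ^ 7 - 77856768 * X ^ 8
  s := 1 + 2 * X - 10 * X ^ 2
  E := 40 - 100 * X
  K := 110592 - 1327104 * X + 1327104 * X ^ 2 + 43130880 * X ^ 3 - 190771200 * X ^ 4 + 3538944 * X
    ^ 5 + 1421770752 * X ^ 6 - 2505572352 * X ^ 7 + 778567680 * X ^ 8
  U := 191102976000000 - 4586471424000000 * X + 45864714240000000 * X ^ 2 - 244611809280000000 * X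
    ^ 3 + 733835427840000000 * X ^ 4 - 1174136684544000000 * X ^ 5 + 782757789696000000 * X ^ 6

noncomputable def eisensteinPairFourteen_1_7 : EisensteinPair
    (1) (1 + 14 * X + 61 * X ^ 2 + 112 * X ^ 3 + 64 * X ^ 4) (-8 - 88 * X - 288 * X ^ 2 - 256 * X ^
    3) (-3 - 24 * X - 48 * X ^ 2) (4) 1 7 where
  z₀ := 25 + 320 * X + 2080 * X ^ 2 + 6400 * X ^ 3 + 6400 * X ^ 4
  z₁ := -24 + 96 * X + 768 * X ^ 2
  w₀ := -171 - 2304 * X - 18792 * X ^ 2 - 132480 * X ^ 3 - 541440 * X ^ 4 - 1050624 * X ^ 5 -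
    700416 * X ^ 6
  w₁ := 172 + 608 * X - 7616 * X ^ 2 - 55040 * X ^ 3 - 88064 * X ^ 4
  D₀ := 864 * X - 2592 * X ^ 2 + 43200 * X ^ 4 - 331776 * X ^ 5 + 1990656 * X ^ 6 + 90243072 * X ^
    7 + 371589120 * X ^ 8 + 509607936 * X ^ 9 + 226492416 * X ^ 10
  D₁ := 864 * X - 8640 * X ^ 2 + 55296 * X ^ 3 - 304128 * X ^ 4 + 1658880 * X ^ 5 - 9732096 * X ^
    6 - 38928384 * X ^ 7 - 28311552 * X ^ 8
  s := 1 + 7 * X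
  E := 12 + 112 * X + 64 * X ^ 2
  K := 1728 - 5184 * X - 5184 * X ^ 2 + 126144 * X ^ 3 - 801792 * X ^ 4 + 3870720 * X ^ 5 -
    16809984 * X ^ 6 + 70778880 * X ^ 7 + 311427072 * X ^ 8 + 226492416 * X ^ 9
  U := 351298031616

noncomputable def eisensteinPairFourteen_2_14 : EisensteinPair
    (1) (1 + 14 * X + 61 * X ^ 2 + 112 * X ^ 3 + 64 * X ^ 4) (-8 - 88 * X - 288 * X ^ 2 - 256 * X ^
    3) (-6 - 24 * X - 24 * X ^ 2) (8) 2 14 where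
  z₀ := 100 + 800 * X + 2080 * X ^ 2 + 2560 * X ^ 3 + 1600 * X ^ 4
  z₁ := -96 - 96 * X + 192 * X ^ 2
  w₀ := -1368 - 16416 * X - 67680 * X ^ 2 - 132480 * X ^ 3 - 150336 * X ^ 4 - 147456 * X ^ 5 -
    87552 * X ^ 6
  w₁ := 1376 + 6880 * X + 7616 * X ^ 2 - 4864 * X ^ 3 - 11008 * X ^ 4
  D₀ := 55296 * X ^ 2 + 995328 * X ^ 3 + 5806080 * X ^ 4 + 11280384 * X ^ 5 + 1990656 * X ^ 6 -
    2654208 * X ^ 7 + 2764800 * X ^ 8 - 10616832 * X ^ 10 + 28311552 * X ^ 11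
  D₁ := 55296 * X ^ 2 + 608256 * X ^ 3 + 1216512 * X ^ 4 - 1658880 * X ^ 5 + 2433024 * X ^ 6 -
    3538944 * X ^ 7 + 4423680 * X ^ 8 - 3538944 * X ^ 9
  s := 1 + 7 * X + 6 * X ^ 2
  E := 28 + 28 * X
  K := 110592 + 1990656 * X + 11612160 * X ^ 2 + 21786624 * X ^ 3 + 110592 * X ^ 4 + 884736 * X ^
    5 - 2985984 * X ^ 6 + 6193152 * X ^ 7 - 8847360 * X ^ 8 + 7077888 * X ^ 9
  U := 1438916737499136

noncomputable def eisensteinPairFifteen_1_5 : EisensteinPair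
    (1) (1 + 10 * X + 47 * X ^ 2 + 90 * X ^ 3 + 81 * X ^ 4) (-6 - 69 * X - 234 * X ^ 2 - 324 * X ^
    3) (-2 - 18 * X - 54 * X ^ 2) (3) 1 5 where
  z₀ := 13 + 198 * X + 1755 * X ^ 2 + 6318 * X ^ 3 + 9477 * X ^ 4
  z₁ := -12 + 108 * X + 972 * X ^ 2
  w₀ := -62 - 810 * X - 12312 * X ^ 2 - 112266 * X ^ 3 - 542376 * X ^ 4 - 1220346 * X ^ 5 -
    1220346 * X ^ 6
  w₁ := 63 - 8505 * X ^ 2 - 61236 * X ^ 3 - 137781 * X ^ 4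
  D₀ := 864 * X - 6912 * X ^ 2 + 31104 * X ^ 3 - 93312 * X ^ 4 + 13646880 * X ^ 5 + 108335232 * X
    ^ 6 + 374134464 * X ^ 7 + 612220032 * X ^ 8 + 459165024 * X ^ 9
  D₁ := 864 * X - 11232 * X ^ 2 + 77760 * X ^ 3 - 349920 * X ^ 4 - 12597120 * X ^ 5 - 39680928 * X
    ^ 6 - 51018336 * X ^ 7
  s := 1 + 5 * X
  E := 22 + 90 * X + 81 * X ^ 2
  K := 1728 - 13824 * X + 52704 * X ^ 2 - 54432 * X ^ 3 - 699840 * X ^ 4 + 5668704 * X ^ 5 +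
    124711488 * X ^ 6 + 357128352 * X ^ 7 + 459165024 * X ^ 8
  U := 46656000000

noncomputable def eisensteinPairFifteen_3_15 : EisensteinPair
    (1) (1 + 10 * X + 47 * X ^ 2 + 90 * X ^ 3 + 81 * X ^ 4) (-6 - 69 * X - 234 * X ^ 2 - 324 * X ^
    3) (-6 - 18 * X - 18 * X ^ 2) (9) 3 15 where
  z₀ := 117 + 702 * X + 1755 * X ^ 2 + 1782 * X ^ 3 + 1053 * X ^ 4
  z₁ := -108 - 108 * X + 108 * X ^ 2
  w₀ := -1674 - 15066 * X - 60264 * X ^ 2 - 112266 * X ^ 3 - 110808 * X ^ 4 - 65610 * X ^ 5 -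
    45198 * X ^ 6
  w₁ := 1701 + 6804 * X + 8505 * X ^ 2 - 5103 * X ^ 4
  D₀ := 629856 * X ^ 3 + 7558272 * X ^ 4 + 41570496 * X ^ 5 + 108335232 * X ^ 6 + 122821920 * X ^
    7 - 7558272 * X ^ 8 + 22674816 * X ^ 9 - 45349632 * X ^ 10 + 51018336 * X ^ 11
  D₁ := 629856 * X ^ 3 + 4408992 * X ^ 4 + 12597120 * X ^ 5 + 3149280 * X ^ 6 - 6298560 * X ^ 7 +
    8188128 * X ^ 8 - 5668704 * X ^ 9
  s := 1 + 5 * X + 11 * X ^ 2 - 10 * X ^ 3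
  E := 60 + 220 * X - 100 * X ^ 2
  K := 1259712 + 15116544 * X + 83140992 * X ^ 2 + 216670464 * X ^ 3 + 226748160 * X ^ 4 -
    122192064 * X ^ 5 - 42830208 * X ^ 6 + 79361856 * X ^ 7 - 93218688 * X ^ 8 + 56687040 * X ^
    9
  U := 24794911296000000

end MSeries

/-! ### Euler products and their logarithmic derivatives -/

namespace MSeries
open PowerSeries

/-- The partial products of `∏_{n ≥ 1} (1 - X ^ (d * n))`. -/
noncomputable def eulerPartial (d N : ℕ) : ℂ⟦X⟧ :=
  ∏ n ∈ Finset.range N, (1 - (X : ℂ⟦X⟧) ^ (d * (n + 1)))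

/-- The geometric series `∑_{k ≥ 1} X ^ (m * k)`. -/
noncomputable def geomSeries (m : ℕ) : ℂ⟦X⟧ :=
  PowerSeries.mk fun k ↦ if m ∣ k ∧ k ≠ 0 then 1 else 0

theorem one_sub_X_pow_mul_geomSeries {m : ℕ} (hm : m ≠ 0) :
    (1 - X ^ m) * geomSeries m = X ^ m := by
  ext k
  rw [sub_mul, one_mul, map_sub, coeff_X_pow_mul', coeff_X_pow, geomSeries, coeff_mk]
  by_cases hk : m ≤ k
  · obtain ⟨j, rfl⟩ := Nat.exists_eq_add_of_le hk
    rcases eq_or_ne j 0 with rfl | hj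
    · simp [hm]
    · simp [hm, hj]
  · have : ¬ (m ∣ k ∧ k ≠ 0) := fun h ↦ hk (Nat.le_of_dvd (Nat.pos_of_ne_zero h.2) h.1)
    rw [if_neg hk, if_neg this, if_neg (by omega), sub_zero]

theorem theta_X_pow (m : ℕ) : theta ((X : ℂ⟦X⟧) ^ m) = (m : ℂ⟦X⟧) * X ^ m := by
  ext k
  rw [coeff_theta, ← map_natCast (C (R := ℂ)), coeff_C_mul, coeff_X_pow]
  split_ifs with h <;> simp [h]

theorem theta_eulerPartial {d : ℕ} (hd : d ≠ 0) (N : ℕ) : theta (eulerPartial d N) =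
    -eulerPartial d N *
      ∑ n ∈ Finset.range N, ((d * (n + 1) : ℕ) : ℂ⟦X⟧) * geomSeries (d * (n + 1)) := by
  induction N with
  | zero => simp [eulerPartial]
  | succ N ih =>
    rw [eulerPartial, Finset.prod_range_succ, ← eulerPartial, Derivation.leibniz, ih, map_sub,
      theta.map_one_eq_zero, theta_X_pow, Finset.sum_range_succ]
    simp only [smul_eq_mul]
    linear_combination eulerPartial d N * ((d * (N + 1) : ℕ) : ℂ⟦X⟧) *
      one_sub_X_pow_mul_geomSeries (m := d * (N + 1)) (Nat.mul_ne_zero hd N.succ_ne_zero)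

theorem X_pow_dvd_eulerPartial_sub {d : ℕ} (hd : d ≠ 0) (N k : ℕ) :
    X ^ (N + 1) ∣ eulerPartial d (N + k) - eulerPartial d N := by
  induction k with
  | zero => simp
  | succ k ih =>
    rw [← add_assoc, eulerPartial, Finset.prod_range_succ, ← eulerPartial, mul_sub, mul_one,
      sub_right_comm]
    refine dvd_sub ih (Dvd.dvd.mul_left (pow_dvd_pow _ ?_) _)
    calc N + 1 ≤ 1 * (N + k + 1) := by omega
      _ ≤ _ := Nat.mul_le_mul_right _ (Nat.pos_of_ne_zero hd)

open scoped PowerSeries.WithPiTopology in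
/-- The product `∏_{n ≥ 1} (1 - X ^ (d * n))`. -/
noncomputable def eulerProduct (d : ℕ) : ℂ⟦X⟧ := ∏' n : ℕ, (1 - (X : ℂ⟦X⟧) ^ (d * (n + 1)))

open scoped PowerSeries.WithPiTopology in
-- The infinite product converges coefficientwise because the factors tend to 1 in order; every
-- factor omitted from the `N`-th partial product is 1 modulo `X ^ (N + 1)`.
theorem X_pow_dvd_eulerProduct_sub {d : ℕ} (hd : d ≠ 0) (N : ℕ) :
    X ^ (N + 1) ∣ eulerProduct d - eulerPartial d N := by
  have hm : Multipliable fun n : ℕ ↦ (1 - (X : ℂ⟦X⟧) ^ (d * (n + 1))) := by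
    simp_rw [sub_eq_add_neg]
    apply WithPiTopology.multipliable_one_add_of_tendsto_order_atTop_nhds_top
    refine ENat.tendsto_nhds_top_iff_natCast_lt.mpr fun k ↦
      Filter.eventually_atTop.mpr ⟨k, fun n hn ↦ ?_⟩
    rw [order_neg, order_X_pow, Nat.cast_lt]
    calc k < 1 * (n + 1) := by omega
      _ ≤ _ := Nat.mul_le_mul_right _ (Nat.pos_of_ne_zero hd)
  have ht := hm.hasProd.tendsto_prod_nat
  rw [X_pow_dvd_iff]
  intro k hk
  have h1 := ((WithPiTopology.continuous_coeff ℂ k).tendsto _).comp ht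
  refine sub_eq_zero.mpr (tendsto_nhds_unique h1 (tendsto_const_nhds.congr' ?_))
  refine Filter.eventually_atTop.mpr ⟨N, fun n hn ↦ ?_⟩
  obtain ⟨j, rfl⟩ := Nat.exists_eq_add_of_le hn
  have := X_pow_dvd_iff.mp (X_pow_dvd_eulerPartial_sub hd N j) k hk
  rw [map_sub, sub_eq_zero] at this
  exact this.symm

theorem constantCoeff_eulerProduct {d : ℕ} (hd : d ≠ 0) : constantCoeff (eulerProduct d) = 1 := by
  have := X_pow_dvd_iff.mp (X_pow_dvd_eulerProduct_sub hd 0) 0 zero_lt_one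
  rw [map_sub, sub_eq_zero] at this
  rw [← coeff_zero_eq_constantCoeff_apply, this]
  simp [eulerPartial]

/-- This is the Lambert series of `E₂`: the coefficient at `d j` collects `d e` over the divisors
`e` of `j`, and for `d j ≤ N` all of these occur among the first `N` terms. -/
theorem X_pow_dvd_sum_geomSeries {d : ℕ} (hd : d ≠ 0) (N : ℕ) :
    X ^ (N + 1) ∣ 24 * (-∑ n ∈ Finset.range N, ((d * (n + 1) : ℕ) : ℂ⟦X⟧) *
      geomSeries (d * (n + 1))) - (scaledE2 d - (d : ℂ⟦X⟧)) := by
  rw [X_pow_dvd_iff]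
  intro k hk
  have hcast (n : ℕ) (f : ℂ⟦X⟧) : coeff k ((n : ℂ⟦X⟧) * f) = n * coeff k f := by
    rw [← map_natCast (C (R := ℂ)), coeff_C_mul]
  have hc : coeff k (d : ℂ⟦X⟧) = if k = 0 then (d : ℂ) else 0 := by
    rw [← map_natCast (C (R := ℂ)), coeff_C]
  rw [map_sub, map_sub, coeff_ofNat_mul, map_neg, map_sum, hc, scaledE2, hcast,
    coeff_subst_X_pow hd]
  simp only [hcast, geomSeries, coeff_mk]
  rcases eq_or_ne k 0 with rfl | hk0
  · simp [eisensteinTwo]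
  by_cases hdk : d ∣ k
  · obtain ⟨j, rfl⟩ := hdk
    have hj : j ≠ 0 := by rintro rfl; simp at hk0
    rw [if_neg hk0, if_pos (Dvd.intro j rfl), Nat.mul_div_cancel_left j (Nat.pos_of_ne_zero hd)]
    have hjN : j < N + 1 := lt_of_le_of_lt (Nat.le_mul_of_pos_left j (Nat.pos_of_ne_zero hd)) hk
    have hs : ∑ n ∈ Finset.range N, ((d * (n + 1) : ℕ) : ℂ) *
        (if d * (n + 1) ∣ d * j ∧ d * j ≠ 0 then 1 else 0) =
        d * ((ArithmeticFunction.sigma 1 j : ℕ) : ℂ) := by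
      have hdiv : j.divisors = (Finset.Ico 1 (N + 1)).filter (· ∣ j) := by
        ext e
        simp only [Nat.mem_divisors, Finset.mem_filter, Finset.mem_Ico]
        refine ⟨fun h ↦ ⟨⟨Nat.pos_of_dvd_of_pos h.1 (Nat.pos_of_ne_zero hj), ?_⟩, h.1⟩,
          fun h ↦ ⟨h.2, hj⟩⟩
        exact (Nat.le_of_dvd (Nat.pos_of_ne_zero hj) h.1).trans_lt hjN
      rw [ArithmeticFunction.sigma_one_apply, hdiv, Finset.sum_filter,
        Finset.sum_Ico_eq_sum_range, Nat.add_sub_cancel, Nat.cast_sum, Finset.mul_sum]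
      refine Finset.sum_congr rfl fun n _ ↦ ?_
      simp only [add_comm 1 n, Nat.mul_dvd_mul_iff_left (Nat.pos_of_ne_zero hd)]
      by_cases h : n + 1 ∣ j <;> simp [h, hd, hj]
    rw [hs]
    simp [eisensteinTwo, hj]
    ring
  · rw [if_neg hk0, if_neg hdk]
    rw [Finset.sum_eq_zero]
    · simp
    · intro n _
      rw [if_neg (fun h ↦ hdk (dvd_of_mul_right_dvd h.1)), mul_zero]

/-- This is `θη/η = E₂/24` for `η(q^d)`; the subtracted `d` accounts for the missing factor
`q^(d/24)`. -/
theorem theta_eulerProduct {d : ℕ} (hd : d ≠ 0) :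
    24 * theta (eulerProduct d) = eulerProduct d * (scaledE2 d - (d : ℂ⟦X⟧)) := by
  rw [← sub_eq_zero]
  ext k
  have hE := X_pow_dvd_eulerProduct_sub hd k
  have hS := X_pow_dvd_sum_geomSeries hd k
  have hT := X_pow_dvd_theta hE
  have hQ := theta_eulerPartial hd k
  refine X_pow_dvd_iff.mp (?_ : X ^ (k + 1) ∣ _) k k.lt_succ_self
  rw [map_sub, hQ] at hT
  convert (hT.mul_left 24).add ((hS.mul_left (eulerPartial d k)).sub (hE.mul_right
    (scaledE2 d - (d : ℂ⟦X⟧)))) using 1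
  ring

end MSeries

/-! ### From a uniformization to an operator of type D3 -/

namespace MSeries
open PowerSeries

theorem injective_subst {t : ℂ⟦X⟧} (h0 : constantCoeff t = 0) (h1 : coeff 1 t ≠ 0) :
    Function.Injective fun f : ℂ⟦X⟧ ↦ subst t f := by
  intro f g hfg
  have ht : HasSubst t := HasSubst.of_constantCoeff_zero' h0
  set s := substInvOfIsUnit t h1.isUnit
  have hs : HasSubst s := HasSubst.substInvOfIsUnit ..
  have h := congrArg (subst s) hfg
  have hst : subst s t = X := subst_substInvOfIsUnit_right _ h0 h1.isUnit
  simp only [subst_comp_subst_apply ht hs, hst, X_subst] at h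
  exact h

theorem theta_subst {t ω : ℂ⟦X⟧} (h0 : constantCoeff t = 0) (hω : theta t = t * ω) (f : ℂ⟦X⟧) :
    theta (subst t f) = ω * subst t (theta f) := by
  have ht : HasSubst t := HasSubst.of_constantCoeff_zero' h0
  rw [theta_apply] at hω
  rw [theta_apply, theta_apply, derivative_subst ht, subst_mul ht, subst_X ht]
  linear_combination subst t (derivative ℂ f) * hω

theorem eulerOp_apply (f : ℂ⟦X⟧) : eulerOp f = theta f := rfl

theorem tOp_apply (f : ℂ⟦X⟧) : tOp f = X * f := rfl

theorem opD3_apply (b₁ b₂ b₃ b₄ b₅ : ℂ) (f : ℂ⟦X⟧) : opD3 b₁ b₂ b₃ b₄ b₅ f =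
    theta (theta (theta f))
      - X * (C b₁ * (2 * theta (theta (theta f)) + 3 * theta (theta f) + theta f))
      - X ^ 2 * (C b₂ * (theta (theta (theta f)) + 3 * theta (theta f) + 2 * theta f) +
        4 * C b₃ * (theta f + f))
      - X ^ 3 * (C b₄ * (2 * theta (theta (theta f)) + 9 * theta (theta f) + 13 * theta f + 6 * f))
      - X ^ 4 * (C b₅ * (theta (theta (theta f)) + 6 * theta (theta f) + 11 * theta f + 6 * f)) := by
  have h2 (g : ℂ⟦X⟧) : (2 : Module.End ℂ ℂ⟦X⟧) g = 2 * g := by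
    rw [← one_add_one_eq_two, ← one_add_one_eq_two]; simp [add_mul]
  have h3 (g : ℂ⟦X⟧) : (3 : Module.End ℂ ℂ⟦X⟧) g = 3 * g := by
    rw [← two_add_one_eq_three, ← two_add_one_eq_three]; simp [add_mul, h2]
  simp only [opD3, LinearMap.sub_apply, LinearMap.add_apply, Module.End.mul_apply, pow_succ,
    pow_zero, Module.End.one_apply, LinearMap.smul_apply, eulerOp_apply, tOp_apply, map_add, h2,
    h3, smul_eq_C_mul, Derivation.leibniz, theta_ofNat, theta_C, smul_eq_mul, map_mul, map_ofNat,
    mul_add, add_mul, one_mul, mul_zero, add_zero]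
  ring

/-- A parametrization `F(t(q)) = E(q)` of a solution of the operator `L(b₁, …, b₅)`. -/
structure Uniformization (b₁ b₂ b₃ b₄ b₅ : ℂ) (t E ω l : ℂ⟦X⟧) : Prop where
  theta_t : theta t = t * ω
  omega_sq : ω ^ 2 = E ^ 2 * (1 - 2 * C b₁ * t - C b₂ * t ^ 2 - 2 * C b₄ * t ^ 3 - C b₅ * t ^ 4)
  theta_E : theta E = E * l
  theta_l : 2 * theta l - l ^ 2 = E ^ 2 * (4 * C b₃ * t ^ 2 + 4 * C b₄ * t ^ 3 + 3 * C b₅ * t ^ 4)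
  const_t : constantCoeff t = 0
  coeff_t : coeff 1 t ≠ 0
  const_E : constantCoeff E = 1

/-- Rewritten in the coordinate `t`, the equation for `l` is the second order equation `2pFF'' =
pF'² + κF² - (θp)FF'`, with primes for `theta`. Differentiating once more cancels the terms in
`F'F''` and `F'²`, and all that is left is `2F` times the third order operator applied to `F`. -/
theorem Uniformization.opD3_eq_zero {b₁ b₂ b₃ b₄ b₅ : ℂ} {t E ω l F : ℂ⟦X⟧}
    (U : Uniformization b₁ b₂ b₃ b₄ b₅ t E ω l) (hF : subst t F = E) :
    opD3 b₁ b₂ b₃ b₄ b₅ F = 0 := by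
  have ht : HasSubst t := HasSubst.of_constantCoeff_zero' U.const_t
  have hE0 : E ≠ 0 := fun h ↦ by simpa [h] using U.const_E
  have hF0 : F ≠ 0 := by
    rintro rfl
    exact hE0 (by rw [← hF, ← coe_substAlgHom ht, map_zero])
  have two : (2 : ℂ⟦X⟧) ≠ 0 := fun h ↦ by simpa [h] using two_mul_C_half
  have hω : ω ≠ 0 := by
    intro h
    have := congrArg constantCoeff U.omega_sq
    simp [h, U.const_E, U.const_t] at this
  have ht' := U.theta_t
  have hωs := U.omega_sq
  have hE' := U.theta_E
  have hl := U.theta_l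
  set f1 : ℂ⟦X⟧ := subst t (theta F) with hf1
  set f2 : ℂ⟦X⟧ := subst t (theta (theta F)) with hf2
  have d0 : E * l = ω * f1 := by rw [← hE', ← hF, theta_subst U.const_t ht']
  have d1 : theta f1 = ω * f2 := theta_subst U.const_t ht' _
  have d2 := congrArg theta d0
  have d3 := congrArg theta hωs
  simp only [map_sub, Derivation.leibniz, Derivation.leibniz_pow, theta_ofNat, theta_C, ht', hE',
    d1, smul_eq_mul, nsmul_eq_mul, theta.map_one_eq_zero] at d2 d3
  push_cast at d2 d3
  have d4 : 2 * theta ω = 2 * E * f1 *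
      (1 - 2 * C b₁ * t - C b₂ * t ^ 2 - 2 * C b₄ * t ^ 3 - C b₅ * t ^ 4) + E ^ 2 *
      (-2 * C b₁ * t - 2 * C b₂ * t ^ 2 - 6 * C b₄ * t ^ 3 - 4 * C b₅ * t ^ 4) := by
    apply mul_left_cancel₀ hω
    linear_combination d3 + 2 * E *
      (1 - 2 * C b₁ * t - C b₂ * t ^ 2 - 2 * C b₄ * t ^ 3 - C b₅ * t ^ 4) * d0
  set p := (1 - 2 * C b₁ * t - C b₂ * t ^ 2 - 2 * C b₄ * t ^ 3 - C b₅ * t ^ 4) with hp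
  -- Eliminating `ω`, `l` and their derivatives leaves a relation among `E`, `f1`, `f2` and `t`, up
  -- to the factor `E²`.
  have d5 : 2 * p * E * f2 = p * f1 ^ 2 +
      (4 * C b₃ * t ^ 2 + 4 * C b₄ * t ^ 3 + 3 * C b₅ * t ^ 4) * E ^ 2 -
      (-2 * C b₁ * t - 2 * C b₂ * t ^ 2 - 6 * C b₄ * t ^ 3 - 4 * C b₅ * t ^ 4) * E * f1 := by
    apply mul_left_cancel₀ (pow_ne_zero 2 hE0)
    linear_combination E ^ 2 * hl - E * f1 * d4 - 2 * E * d2 + (3 * f1 ^ 2 - 2 * E * f2) * hωs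
      + 3 * (E * l + ω * f1) * d0
  have d6 : 2 * (1 - 2 * C b₁ * X - C b₂ * X ^ 2 - 2 * C b₄ * X ^ 3 - C b₅ * X ^ 4) * F *
        theta (theta F) =
      (1 - 2 * C b₁ * X - C b₂ * X ^ 2 - 2 * C b₄ * X ^ 3 - C b₅ * X ^ 4) * theta F ^ 2 +
      (4 * C b₃ * X ^ 2 + 4 * C b₄ * X ^ 3 + 3 * C b₅ * X ^ 4) * F ^ 2 -
      (-2 * C b₁ * X - 2 * C b₂ * X ^ 2 - 6 * C b₄ * X ^ 3 - 4 * C b₅ * X ^ 4) * F * theta F := by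
    -- As `t` is a local coordinate, a relation that holds at `t(q)` holds formally.
    apply injective_subst U.const_t U.coeff_t
    have hs (f : ℂ⟦X⟧) : subst t f = substAlgHom ht f := by rw [coe_substAlgHom]
    have hC (c : ℂ) : substAlgHom ht (C c) = C c := by rw [← hs, subst_C]; rfl
    have hX : substAlgHom ht (X : ℂ⟦X⟧) = t := by rw [← hs, subst_X ht]
    simp only [hs] at hf1 hf2 hF
    simp only [hs, map_add, map_sub, map_mul, map_pow, map_ofNat, map_one, hC, hX, map_neg, hF,
      ← hf1, ← hf2, ← hp]
    linear_combination d5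
  have d7 := congrArg theta d6
  have tX : theta (X : ℂ⟦X⟧) = X := by simp [theta_apply]
  simp only [map_add, map_sub, Derivation.leibniz, Derivation.leibniz_pow, theta_ofNat, theta_C,
    tX, smul_eq_mul, nsmul_eq_mul, theta.map_one_eq_zero, map_neg] at d7
  push_cast at d7
  apply mul_left_cancel₀ (mul_ne_zero two hF0)
  rw [opD3_apply]
  linear_combination d7

end MSeries

/-! ### Uniformizations by rational functions on a differential system -/

namespace MSeries
open PowerSeries

/-- The polynomial identities behind the parametrization of a solution of `L(b₁, …, b₅)` by
`t = v T(v) / Q(v)` and `E = P Q(v) / √η(v)`, in a modular system. -/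
structure ParametrizationCertificate (m ρ c T Q η : Polynomial ℂ) (b₁ b₂ b₃ b₄ b₅ : ℂ) where
  D : Polynomial ℂ
  k : Polynomial ℂ
  hT0 : T.eval 0 ≠ 0 := by norm_num
  hQ0 : Q.eval 0 = 1 := by norm_num
  hη0 : η.eval 0 = 1 := by norm_num
  hD0 : D.eval 0 = 1 := by norm_num
  hω : (T * Q + .X * T.derivative * Q - .X * T * Q.derivative) ^ 2 * m ^ 2 * ρ * η = T ^ 2 *
    (Q ^ 4 - 2 * .C b₁ * (.X * T) * Q ^ 3 - .C b₂ * (.X * T) ^ 2 * Q ^ 2 -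
      2 * .C b₄ * (.X * T) ^ 3 * Q - .C b₅ * (.X * T) ^ 4) := by simp [Polynomial.C_ofNat]; ring
  hk : 2 * k * η * Q = D * .X * m * (2 * Q.derivative * η - Q * η.derivative) := by
    simp [Polynomial.C_ofNat]; ring
  hl : (.X * c * D ^ 2 + .X * m * (2 * ρ * (k.derivative * D - k * D.derivative) +
      ρ.derivative * k * D) - ρ * k ^ 2) * η * Q ^ 2 = D ^ 2 * (4 * .C b₃ * (.X * T) ^ 2 * Q ^ 2 +
      4 * .C b₄ * (.X * T) ^ 3 * Q + 3 * .C b₅ * (.X * T) ^ 4) := by simp [Polynomial.C_ofNat]; ring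

variable {m ρ c T Q η : Polynomial ℂ} {b₁ b₂ b₃ b₄ b₅ : ℂ} {v P ψ r t E : ℂ⟦X⟧}

/-- Logarithmic differentiation with `θv = v m P r` gives `ω` and `l` in terms of `v, P, ψ, r`. The
square of `r` is `ρ(v)`, so both relations reduce to polynomial identities in `v`. -/
theorem ParametrizationCertificate.exists_uniformization
    (K : ParametrizationCertificate m ρ c T Q η b₁ b₂ b₃ b₄ b₅) (S : ModularSystem m ρ c v P ψ r)
    (ht : t * Polynomial.aeval v Q = v * Polynomial.aeval v T)
    (hE : E ^ 2 * Polynomial.aeval v η = P ^ 2 * Polynomial.aeval v Q ^ 2)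
    (hE0 : constantCoeff E = 1) :
    ∃ ω l, Uniformization b₁ b₂ b₃ b₄ b₅ t E ω l := by
  have cc (p : Polynomial ℂ) : constantCoeff (Polynomial.aeval v p) = p.eval 0 := by
    rw [constantCoeff_aeval S.const_v, Polynomial.coeff_zero_eq_eval_zero]
  have ne (p : Polynomial ℂ) (h : p.eval 0 ≠ 0) : Polynomial.aeval v p ≠ 0 := by
    intro h0; rw [← cc, h0, map_zero] at h; exact h rfl
  have two : (2 : ℂ⟦X⟧) ≠ 0 := fun h ↦ by simpa [h] using two_mul_C_half
  have hEne : E ≠ 0 := fun h ↦ by simp [h] at hE0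
  have hv0 : v ≠ 0 := fun h ↦ by simpa [h] using S.coeff_v
  have hC (b : ℂ) : algebraMap ℂ ℂ⟦X⟧ b = C b := rfl
  have nT := ne T K.hT0
  have nQ := ne Q (by rw [K.hQ0]; exact one_ne_zero)
  have nη := ne η (by rw [K.hη0]; exact one_ne_zero)
  have nD := ne K.D (by rw [K.hD0]; exact one_ne_zero)
  have inv (p : Polynomial ℂ) (h : p.eval 0 ≠ 0) : ∃ u, Polynomial.aeval v p * u = 1 :=
    (isUnit_iff_constantCoeff.mpr (by rw [cc]; exact h.isUnit)).exists_right_inv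
  obtain ⟨uT, hT⟩ := inv T K.hT0
  obtain ⟨uQ, hQ⟩ := inv Q (by rw [K.hQ0]; exact one_ne_zero)
  obtain ⟨uD, hD⟩ := inv K.D (by rw [K.hD0]; exact one_ne_zero)
  have tQ := congrArg theta ht
  have tE := congrArg theta hE
  have ev {p q : Polynomial ℂ} (h : p = q) := congrArg (Polynomial.aeval v) h
  have eω := ev K.hω
  have ek := ev K.hk
  have el := ev K.hl
  simp only [Derivation.leibniz, Derivation.leibniz_pow, theta_aeval, S.theta_v, S.theta_P,
    smul_eq_mul, nsmul_eq_mul] at tQ tE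
  push_cast at tQ tE
  simp only [map_add, map_mul, map_ofNat, map_sub, map_pow, Polynomial.aeval_X,
    Polynomial.aeval_C, hC] at eω ek el
  have hct : constantCoeff t = 0 := by
    have := congrArg constantCoeff ht
    simpa [cc, K.hQ0, S.const_v] using this
  have tl := S.theta_ψ
  have tr := S.theta_r
  have hr2 := S.r_sq
  have hcv := S.const_v
  have hvt := S.coeff_v
  set aT := Polynomial.aeval v T
  set aT' := Polynomial.aeval v T.derivative
  set aQ := Polynomial.aeval v Q
  set aQ' := Polynomial.aeval v Q.derivative
  set aη := Polynomial.aeval v η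
  set aη' := Polynomial.aeval v η.derivative
  set am := Polynomial.aeval v m
  set aρ := Polynomial.aeval v ρ
  set aρ' := Polynomial.aeval v ρ.derivative
  set ac := Polynomial.aeval v c
  set aD := Polynomial.aeval v K.D with haD
  set aD' := Polynomial.aeval v K.D.derivative
  set ak := Polynomial.aeval v K.k with hak
  set ak' := Polynomial.aeval v K.k.derivative
  set ω := (aT * aQ + v * aT' * aQ - v * aT * aQ') * am * P * r * uT * uQ with hωdef
  set l := ψ + ak * P * r * uD with hl
  have hω : ω * (aT * aQ) = (aT * aQ + v * aT' * aQ - v * aT * aQ') * am * P * r := by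
    linear_combination (aT * aQ + v * aT' * aQ - v * aT * aQ') * am * P * r * (uQ * aQ * hT + hQ)
  have hDl : aD * l = aD * ψ + ak * P * r := by
    linear_combination ak * P * r * hD
  have hDl' := congrArg theta hDl
  simp only [map_add, Derivation.leibniz, haD, hak, theta_aeval, S.theta_v, S.theta_P,
    smul_eq_mul] at hDl'
  simp only [← haD, ← hak] at hDl'
  have hx : aQ ^ 4 * (1 - 2 * C b₁ * t - C b₂ * t ^ 2 - 2 * C b₄ * t ^ 3 - C b₅ * t ^ 4) =
      aQ ^ 4 - 2 * C b₁ * (v * aT) * aQ ^ 3 - C b₂ * (v * aT) ^ 2 * aQ ^ 2 -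
      2 * C b₄ * (v * aT) ^ 3 * aQ - C b₅ * (v * aT) ^ 4 := by
    rw [← ht]; ring
  have hy : aQ ^ 4 * (4 * C b₃ * t ^ 2 + 4 * C b₄ * t ^ 3 + 3 * C b₅ * t ^ 4) =
      4 * C b₃ * (v * aT) ^ 2 * aQ ^ 2 + 4 * C b₄ * (v * aT) ^ 3 * aQ + 3 * C b₅ * (v * aT) ^ 4 := by
    rw [← ht]; ring
  refine ⟨ω, l, ?_, ?_, ?_, ?_, hct, ?_, hE0⟩
  · apply mul_left_cancel₀ (mul_ne_zero (mul_ne_zero nQ nQ) nT)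
    linear_combination aQ * aT * tQ - aQ * t * hω -
      aQ * am * P * r * (aT + v * aT') * ht
  · apply mul_left_cancel₀ (mul_ne_zero (pow_ne_zero 2 (mul_ne_zero nT nQ)) (mul_ne_zero nη (pow_ne_zero 2 nQ)))
    linear_combination aη * aQ ^ 2 * (ω * (aT * aQ) +
      (aT * aQ + v * aT' * aQ - v * aT * aQ') * am * P * r) * hω +
      aη * aQ ^ 2 * (aT * aQ + v * aT' * aQ - v * aT * aQ') ^ 2 * am ^ 2 * P ^ 2 * hr2 +
      P ^ 2 * aQ ^ 2 * eω - aT ^ 2 * aQ ^ 4 *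
      (1 - 2 * C b₁ * t - C b₂ * t ^ 2 - 2 * C b₄ * t ^ 3 - C b₅ * t ^ 4) * hE -
      aT ^ 2 * P ^ 2 * aQ ^ 2 * hx
  · apply mul_left_cancel₀ (mul_ne_zero (mul_ne_zero (mul_ne_zero two hEne) (pow_ne_zero 2 nη))
      (mul_ne_zero nQ nD))
    linear_combination aη * aQ * aD * tE - aQ * aD * aη' * v * am * P * r * hE -
      2 * E ^ 2 * aη ^ 2 * aQ * hDl - 2 * aη * aQ * (aD * ψ + ak * P * r) * hE -
      P ^ 3 * r * aQ ^ 2 * ek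
  · apply mul_left_cancel₀ (mul_ne_zero (mul_ne_zero nη (pow_ne_zero 2 nQ)) (pow_ne_zero 2 nD))
    linear_combination aη * aQ ^ 2 * (2 * aD * hDl' - 2 * aD' * v * am * P * r * hDl +
      aD ^ 2 * tl + aD * ak * P * tr - (aD * l + aD * ψ + ak * P * r) * hDl +
      (2 * aD * ak' * v * am - 2 * aD' * ak * v * am - ak ^ 2) * P ^ 2 * hr2) + P ^ 2 * el -
      aQ ^ 2 * aD ^ 2 * (4 * C b₃ * t ^ 2 + 4 * C b₄ * t ^ 3 + 3 * C b₅ * t ^ 4) * hE -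
      P ^ 2 * aD ^ 2 * hy
  · have hg : X ∣ t := X_dvd_iff.mpr hct
    obtain ⟨g, rfl⟩ := hg
    obtain ⟨w, rfl⟩ := X_dvd_iff.mpr hcv
    rw [← zero_add 1, coeff_succ_X_mul, coeff_zero_eq_constantCoeff_apply] at hvt ⊢
    have h1 : g * aQ = w * aT := by
      apply mul_left_cancel₀ X_ne_zero
      linear_combination ht
    have := congrArg constantCoeff h1
    rw [map_mul, map_mul, cc, cc, K.hQ0, hvt] at this
    intro h
    rw [h] at this
    exact K.hT0 (by linear_combination -this)

end MSeries

/-! ### Parametrization certificates of the six cases -/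

namespace MSeries
open Polynomial

/-- `Q/v = 1/v + 12 + 64v` is `H_n - 4`, and `η = (1 + 8X)²`, so that `E = P Q/(1 + 8v)`. -/
noncomputable def certificateSixTwo : ParametrizationCertificate (1) (1 + 20 * X + 64 * X ^ 2)
    (-8 - 64 * X) (1) (1 + 12 * X + 64 * X ^ 2) (1 + 16 * X + 64 * X ^ 2) 6 368 88 1056 3584 where
  D := (1 + 12 * X + 64 * X ^ 2) * (1 + 8 * X)
  k := X * ((12 + 128 * X) * (1 + 8 * X) - 8 * (1 + 12 * X + 64 * X ^ 2))

/-- Here `η` is `ρ` itself, so `E = P Q/r`, and `D` contains the whole of `η`. -/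
noncomputable def certificateSixThree : ParametrizationCertificate (1) (1 + 20 * X + 64 * X ^ 2)
    (-8 - 64 * X) (1) (1 + 14 * X + 64 * X ^ 2) (1 + 20 * X + 64 * X ^ 2) 8 360 108 864 2160 where
  D := (1 + 14 * X + 64 * X ^ 2) * (1 + 20 * X + 64 * X ^ 2)
  k := X * ((14 + 128 * X) * (1 + 20 * X + 64 * X ^ 2) -
    (1 + 14 * X + 64 * X ^ 2) * (10 + 64 * X))

noncomputable def certificateTen : ParametrizationCertificate (1 - 4 * X)
    (1 + 4 * X - 16 * X ^ 2) (4 + 44 * X - 480 * X ^ 2 + 960 * X ^ 3) (1 - 4 * X)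
    (1 - 2 * X + 8 * X ^ 2) (1) 2 112 28 184 336 where
  D := 1 - 2 * X + 8 * X ^ 2
  k := X * (1 - 4 * X) * (-2 + 16 * X)

/-- Stated in the level six coordinate, before `q ↦ -q`; this explains the sign `T = -1`. -/
noncomputable def certificateTwelve : ParametrizationCertificate (1) (1 + 20 * X + 64 * X ^ 2)
    (-8 - 64 * X) (-1) (1 + 4 * X) (1) 2 80 24 96 0 where
  D := 1 + 4 * X
  k := 4 * X

noncomputable def certificateFourteen : ParametrizationCertificate (1)
    (1 + 14 * X + 61 * X ^ 2 + 112 * X ^ 3 + 64 * X ^ 4)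
    (-8 - 88 * X - 288 * X ^ 2 - 256 * X ^ 3) (1) (1 + 4 * X + 8 * X ^ 2) (1) 1 59 16 68 80 where
  D := 1 + 4 * X + 8 * X ^ 2
  k := X * (4 + 16 * X)

noncomputable def certificateFifteen : ParametrizationCertificate (1)
    (1 + 10 * X + 47 * X ^ 2 + 90 * X ^ 3 + 81 * X ^ 4)
    (-6 - 69 * X - 234 * X ^ 2 - 324 * X ^ 3) (1) (1 + 3 * X + 9 * X ^ 2) (1) 1 43 12 78 216 where
  D := 1 + 3 * X + 9 * X ^ 2
  k := X * (3 + 18 * X)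

end MSeries

/-! ### The regular shift as a Möbius substitution -/

namespace MSeries
open PowerSeries

section shift

variable {s : ℂ} {u b : ℂ⟦X⟧}

/-- With `u = 1/(1 - sX)` and `b = X u`, the relation for `b` is Pascal's recurrence. -/
theorem coeff_mul_pow_eq_choose (hu : (1 - C s * X) * u = 1) (hb : (1 - C s * X) * b = X)
    (n j : ℕ) : coeff n (u * b ^ j) = n.choose j * s ^ (n - j) := by
  have h0 : u = 1 + X * (C s * u) := by linear_combination hu
  have h1 (j) : u * b ^ (j + 1) = X * (u * b ^ j + C s * (u * b ^ (j + 1))) := by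
    linear_combination (u * b ^ j) * hb
  induction n generalizing j with
  | zero =>
    cases j with
    | zero => rw [pow_zero, mul_one, h0]; simp
    | succ j => rw [h1]; simp
  | succ n ih =>
    cases j with
    | zero =>
      rw [pow_zero, mul_one, h0, map_add, coeff_succ_X_mul, coeff_C_mul, coeff_one,
        if_neg n.succ_ne_zero]
      have := ih 0
      rw [pow_zero, mul_one] at this
      rw [this]
      simp [pow_succ']
    | succ j =>
      rw [h1, coeff_succ_X_mul, map_add, coeff_C_mul, ih, ih, Nat.choose_succ_succ,
        Nat.add_sub_add_right]
      rcases lt_or_ge j n with h | h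
      · obtain ⟨k, rfl⟩ := Nat.exists_eq_add_of_lt h
        rw [show j + k + 1 - j = k + 1 by omega, show j + k + 1 - (j + 1) = k by omega]
        push_cast; ring
      · rw [Nat.choose_eq_zero_of_lt (Nat.lt_succ_of_le h)]
        push_cast; ring

theorem coeff_regularShift (A : ℂ⟦X⟧) (n : ℕ) : coeff n (regularShift s A) =
    ∑ j ∈ Finset.range (n + 1), coeff j A * (n.choose j * s ^ (n - j)) := by
  rw [regularShift, laplaceShift, laplace, coeff_mk, mul_comm (rescale s _), coeff_mul,
    Finset.Nat.sum_antidiagonal_eq_sum_range_succ_mk, Finset.sum_mul]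
  refine Finset.sum_congr rfl fun j hj ↦ ?_
  have hj' : j ≤ n := Nat.lt_succ_iff.mp (Finset.mem_range.mp hj)
  rw [laplaceInv, coeff_mk, coeff_rescale, coeff_exp, Nat.cast_choose ℂ hj']
  have h1 : (j.factorial : ℂ) ≠ 0 := by exact_mod_cast j.factorial_ne_zero
  have h2 : ((n - j).factorial : ℂ) ≠ 0 := by exact_mod_cast (n - j).factorial_ne_zero
  simp
  field_simp

/-- The factorials of the two Laplace transforms combine to binomial coefficients, which are the
coefficients of `bʲ/(1 - sX)`. -/
theorem regularShift_eq (hu : (1 - C s * X) * u = 1) (hb : (1 - C s * X) * b = X) (A : ℂ⟦X⟧) :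
    regularShift s A = u * subst b A := by
  have hb0 : constantCoeff b = 0 := by simpa using congrArg constantCoeff hb
  have hbs : HasSubst b := HasSubst.of_constantCoeff_zero' hb0
  ext n
  obtain ⟨B, hB⟩ : X ^ (n + 1) ∣ A - (trunc (n + 1) A : ℂ⟦X⟧) := by
    rw [X_pow_dvd_iff]
    intro m hm
    rw [map_sub, Polynomial.coeff_coe, coeff_trunc, if_pos hm, sub_self]
  have hX : X ^ (n + 1) ∣ b ^ (n + 1) := pow_dvd_pow_of_dvd (X_dvd_iff.mpr hb0) _
  have hA : subst b A = subst b (trunc (n + 1) A : ℂ⟦X⟧) + b ^ (n + 1) * subst b B := by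
    have h := congrArg (subst b) hB
    rw [subst_sub hbs, subst_mul hbs, subst_pow hbs, subst_X hbs] at h
    linear_combination h
  rw [hA, mul_add, map_add, X_pow_dvd_iff.mp ((hX.mul_right _).mul_left u) n n.lt_succ_self,
    add_zero, subst_coe hbs, coeff_regularShift,
    Polynomial.aeval_eq_sum_range' (natDegree_trunc_lt A n), Finset.mul_sum, map_sum]
  refine Finset.sum_congr rfl fun j hj ↦ ?_
  rw [coeff_trunc, if_pos (Finset.mem_range.mp hj), ← coeff_mul_pow_eq_choose hu hb,
    mul_smul_comm, coeff_smul, smul_eq_mul]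

/-- From `1/t = 1/τ - a` one gets `t/(1 + at) = τ` and `1/(1 + at) = 1 - aτ`. Normalization
therefore shifts the constant term of the Hauptmodul. -/
theorem subst_normalization {M τ t : ℂ⟦X⟧} (hτ : constantCoeff τ = 0)
    (ht : t * (1 - C (coeff 1 M) * τ) = τ) :
    subst t (normalization M) = (1 - C (coeff 1 M) * τ) * subst τ M := by
  set a := coeff 1 M with ha
  have ht0 : constantCoeff t = 0 := by simpa [hτ] using congrArg constantCoeff ht
  have hts : HasSubst t := HasSubst.of_constantCoeff_zero' ht0
  obtain ⟨u, hu⟩ := IsUnit.exists_right_inv (a := 1 - C (-a) * X)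
    (isUnit_iff_constantCoeff.mpr (by simp))
  have hb : (1 - C (-a) * X) * (X * u) = X := by linear_combination X * hu
  have hbs : HasSubst (X * u) := HasSubst.of_constantCoeff_zero' (by simp)
  rw [normalization, ← ha, regularShift_eq hu hb, subst_mul hts, subst_comp_subst_apply hbs hts]
  have hC (c : ℂ) : substAlgHom hts (C c) = C c := by rw [coe_substAlgHom, subst_C]; rfl
  have hX : substAlgHom hts (X : ℂ⟦X⟧) = t := by rw [coe_substAlgHom, subst_X hts]
  have h1 := congrArg (substAlgHom hts) hu
  simp only [map_mul, map_sub, map_neg, map_one, hC, hX] at h1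
  rw [coe_substAlgHom] at h1
  have h2 : subst t u = 1 - C a * τ := by
    linear_combination (1 - C a * τ) * h1 - C a * subst t u * ht
  have h3 : subst t (X * u) = τ := by
    rw [subst_mul hts, subst_X hts, h2, ht]
  rw [h2, h3]

end shift

/-! ### Growth and uniqueness of solutions -/

section recurrence

variable (b₁ b₂ b₃ b₄ b₅ : ℂ)

theorem coeff_X_pow_mul_shift (k n : ℕ) (f : ℂ⟦X⟧) :
    coeff n (X ^ k * f) = if k ≤ n then coeff (n - k) f else 0 := coeff_X_pow_mul' f k n

/-- The equation reads `n³ aₙ =` a combination of the four preceding coefficients with factors cubic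
in `n`, so `aₙ` is bounded by a fixed multiple of the earlier terms. In particular a solution
without constant term is zero. -/
theorem exists_coeff_bound : ∃ R : ℝ, 0 < R ∧ ∀ G : ℂ⟦X⟧, opD3 b₁ b₂ b₃ b₄ b₅ G = 0 →
    ∀ n, ‖coeff n G‖ ≤ R ^ n * ‖coeff 0 G‖ := by
  -- The number 24 bounds every polynomial factor by `24 (m + 1)³`, and `m + 1 ≤ n` for a preceding
  -- index `m`. The ratio `R` adds up the four terms.
  set K : ℝ := 24 * (‖b₁‖ + ‖b₂‖ + ‖b₃‖ + ‖b₄‖ + ‖b₅‖) with hK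
  have hK0 : 0 ≤ K := by positivity
  set R : ℝ := 1 + 4 * K with hR
  have hR1 : 1 ≤ R := by linarith
  refine ⟨R, by linarith, fun G hG n ↦ ?_⟩
  induction n using Nat.strong_induction_on with | _ n ih =>
  rcases Nat.eq_zero_or_pos n with rfl | hn
  · simp
  have hc := congrArg (coeff n) hG
  have hN (k : ℕ) [k.AtLeastTwo] (i : ℕ) (f : ℂ⟦X⟧) :
    coeff i ((ofNat(k) : ℂ⟦X⟧) * f) = (ofNat(k) : ℂ) * coeff i f := coeff_ofNat_mul k i f
  rw [opD3_apply, ← pow_one (X : ℂ⟦X⟧), ← pow_mul, ← pow_mul, ← pow_mul] at hc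
  simp only [map_sub, coeff_X_pow_mul_shift, mul_assoc, hN, coeff_C_mul, map_add, coeff_theta,
    one_mul, map_zero] at hc
  have hb (k : ℕ) (hk : 1 ≤ k) (w : ℕ → ℂ) (hw : ∀ m : ℕ, ‖w m‖ ≤ K * (m + 1) ^ 3) :
      ‖if k ≤ n then w (n - k) * coeff (n - k) G else 0‖ ≤
        n ^ 3 * (K * R ^ (n - 1) * ‖coeff 0 G‖) := by
    split_ifs with h
    · have h1 := ih (n - k) (by omega)
      have h2 : R ^ (n - k) ≤ R ^ (n - 1) := pow_le_pow_right₀ hR1 (by omega)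
      have h3 : ((n - k : ℕ) : ℝ) + 1 ≤ n := by
        have : n - k + 1 ≤ n := by omega
        exact_mod_cast this
      rw [norm_mul]
      calc _ ≤ (K * ((n - k : ℕ) + 1) ^ 3) * (R ^ (n - k) * ‖coeff 0 G‖) := by
            gcongr; exact hw _
        _ ≤ (K * n ^ 3) * (R ^ (n - 1) * ‖coeff 0 G‖) := by gcongr
        _ = _ := by ring
    · rw [norm_zero]; positivity
  have hw (b : ℂ) (m p : ℕ) (hp : p ≤ 24 * (m + 1) ^ 3) :
      ‖b * (p : ℂ)‖ ≤ 24 * ‖b‖ * ((m : ℝ) + 1) ^ 3 := by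
    rw [norm_mul, Complex.norm_natCast]
    have : (p : ℝ) ≤ 24 * ((m : ℝ) + 1) ^ 3 := by exact_mod_cast hp
    nlinarith [norm_nonneg b]
  have hm (m : ℕ) : (0 : ℝ) ≤ ((m : ℝ) + 1) ^ 3 := by positivity
  have h1 := norm_nonneg b₁
  have h2 := norm_nonneg b₂
  have h3 := norm_nonneg b₃
  have h4 := norm_nonneg b₄
  have h5 := norm_nonneg b₅
  have w1 := hb 1 le_rfl (fun m ↦ b₁ * (2 * m ^ 3 + 3 * m ^ 2 + m : ℕ)) fun m ↦
    (hw _ m _ (by nlinarith [sq_nonneg m])).trans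
      (mul_le_mul_of_nonneg_right (by rw [hK]; linarith) (hm m))
  have w2 := hb 2 (by norm_num)
    (fun m ↦ b₂ * (m ^ 3 + 3 * m ^ 2 + 2 * m : ℕ) + b₃ * (4 * (m + 1) : ℕ)) fun m ↦ by
      refine ((norm_add_le _ _).trans (add_le_add (hw _ m _ (by nlinarith [sq_nonneg m]))
        (hw _ m _ (by nlinarith [sq_nonneg m])))).trans ?_
      rw [← add_mul]
      exact mul_le_mul_of_nonneg_right (by rw [hK]; linarith) (hm m)
  have w3 := hb 3 (by norm_num) (fun m ↦ b₄ * (2 * m ^ 3 + 9 * m ^ 2 + 13 * m + 6 : ℕ)) fun m ↦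
    (hw _ m _ (by nlinarith [sq_nonneg m])).trans
      (mul_le_mul_of_nonneg_right (by rw [hK]; linarith) (hm m))
  have w4 := hb 4 (by norm_num) (fun m ↦ b₅ * (m ^ 3 + 6 * m ^ 2 + 11 * m + 6 : ℕ)) fun m ↦
    (hw _ m _ (by nlinarith [sq_nonneg m])).trans
      (mul_le_mul_of_nonneg_right (by rw [hK]; linarith) (hm m))
  set I1 := ite (1 ≤ n) _ _
  set I2 := ite (2 ≤ n) _ _
  set I3 := ite (3 ≤ n) _ _
  set I4 := ite (4 ≤ n) _ _
  have he : (n : ℂ) ^ 3 * coeff n G = I1 + I2 + I3 + I4 := by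
    simp only [I1, I2, I3, I4]
    push_cast
    split_ifs at hc ⊢ <;> linear_combination hc
  have hn3 : (0 : ℝ) < (n : ℝ) ^ 3 := by positivity
  have hle : (n : ℝ) ^ 3 * ‖coeff n G‖ ≤ n ^ 3 * (4 * K * R ^ (n - 1) * ‖coeff 0 G‖) := by
    calc (n : ℝ) ^ 3 * ‖coeff n G‖ = ‖(n : ℂ) ^ 3 * coeff n G‖ := by simp
      _ ≤ ‖I1‖ + ‖I2‖ + ‖I3‖ + ‖I4‖ := by rw [he]; exact norm_add₄_le
      _ ≤ _ := by linarith
  have hle' := le_of_mul_le_mul_left hle hn3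
  refine hle'.trans ?_
  gcongr
  obtain ⟨k, rfl⟩ := Nat.exists_eq_succ_of_ne_zero hn.ne'
  rw [pow_succ']
  simp only [Nat.succ_eq_add_one, Nat.add_sub_cancel]
  gcongr
  linarith

/-- The geometric bound gives the radius of convergence of `F`; applied to `G - G(0) F` it gives
zero. -/
theorem isAnalyticGenerator_opD3 {F : ℂ⟦X⟧} (hF : opD3 b₁ b₂ b₃ b₄ b₅ F = 0)
    (h0 : constantCoeff F = 1) : IsAnalyticGenerator (opD3 b₁ b₂ b₃ b₄ b₅) F := by
  obtain ⟨R, hR, hb⟩ := exists_coeff_bound b₁ b₂ b₃ b₄ b₅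
  refine ⟨?_, hF, h0, fun G _ hG ↦ ⟨constantCoeff G, ?_⟩⟩
  · refine lt_of_lt_of_le (ENNReal.coe_pos.mpr (Real.toNNReal_pos.mpr (inv_pos.mpr hR)))
      (FormalMultilinearSeries.le_radius_of_bound _ ‖coeff 0 F‖ fun n ↦ ?_)
    rw [FormalMultilinearSeries.ofScalars_norm, Real.coe_toNNReal _ (inv_pos.mpr hR).le]
    calc ‖coeff n F‖ * R⁻¹ ^ n ≤ R ^ n * ‖coeff 0 F‖ * R⁻¹ ^ n := by
          gcongr; exact hb F hF n
      _ = _ := by rw [inv_pow]; field_simp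
  · have h := hb (G - constantCoeff G • F) (by rw [map_sub, map_smul, hG, hF]; simp)
    have hc : coeff 0 (G - constantCoeff G • F) = 0 := by simp [h0]
    rw [hc] at h
    ext n
    have := h n
    rw [norm_zero, mul_zero, norm_le_zero_iff, map_sub, sub_eq_zero] at this
    exact this

end recurrence

end MSeries

/-! ### Translation from rational powers of `q` to power series -/

namespace MSeries
open PowerSeries

/-- The embedding of power series in `q` into series in rational powers of `q`. -/
noncomputable abbrev toHahn : ℂ⟦X⟧ →+* HahnSeries ℚ ℂ := HahnSeries.ofPowerSeries ℚ ℂ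

theorem coeff_toHahn_natCast (f : ℂ⟦X⟧) (n : ℕ) : (toHahn f).coeff n = coeff n f :=
  HahnSeries.ofPowerSeries_apply_coeff f n

theorem coeff_toHahn_of_notMem (f : ℂ⟦X⟧) {g : ℚ} (hg : ∀ n : ℕ, (n : ℚ) ≠ g) :
    (toHahn f).coeff g = 0 := by
  rw [toHahn, HahnSeries.ofPowerSeries_apply]
  refine HahnSeries.embDomain_of_notMem_range ?_
  rintro ⟨n, hn⟩
  exact hg n hn

theorem zero_lt_orderTop_toHahn {f : ℂ⟦X⟧} (hf : constantCoeff f = 0) :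
    0 < (toHahn f).orderTop := by
  by_cases h0 : toHahn f = 0
  · simp [h0]
  rw [← HahnSeries.order_eq_orderTop_of_ne_zero h0, ← WithTop.coe_zero, WithTop.coe_lt_coe]
  by_contra! h
  apply (HahnSeries.coeff_order_eq_zero.not.mpr h0)
  by_cases hn : ∃ n : ℕ, (n : ℚ) = (toHahn f).order
  · obtain ⟨n, hn⟩ := hn
    have : n = 0 := by
      rw [← hn] at h
      exact_mod_cast le_antisymm h (Nat.cast_nonneg n)
    rw [← hn, coeff_toHahn_natCast, this, coeff_zero_eq_constantCoeff_apply, hf]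
  · push Not at hn
    exact coeff_toHahn_of_notMem f hn

/-- Both evaluations are sums that are finite in each coefficient, and nothing occurs at exponents
outside the natural numbers. -/
theorem heval_toHahn {τ : ℂ⟦X⟧} (hτ : constantCoeff τ = 0) (M : ℂ⟦X⟧) :
    heval (toHahn τ) M = toHahn (subst τ M) := by
  have hs : HasSubst τ := HasSubst.of_constantCoeff_zero' hτ
  have key (g : ℚ) : (heval (toHahn τ) M).coeff g =
      ∑ᶠ n, coeff n M • (toHahn (τ ^ n)).coeff g := by
    rw [coeff_heval]
    refine finsum_congr fun n ↦ ?_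
    rw [HahnSeries.SummableFamily.coeff_apply,
      HahnSeries.SummableFamily.powerSeriesFamily_of_orderTop_pos (zero_lt_orderTop_toHahn hτ),
      ← map_pow, HahnSeries.coeff_smul]
  ext g
  rw [key]
  by_cases hg : ∃ n : ℕ, (n : ℚ) = g
  · obtain ⟨n, rfl⟩ := hg
    simp only [coeff_toHahn_natCast]
    exact (coeff_subst' hs M n).symm
  · push Not at hg
    simp only [coeff_toHahn_of_notMem _ hg, smul_zero, finsum_zero]

theorem order_single_mul_toHahn {f : ℂ⟦X⟧} (hf : constantCoeff f = 1) (a : ℚ) :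
    (HahnSeries.single a 1 * toHahn f).order = a := by
  have h0 : (toHahn f).coeff 0 = 1 := by
    rw [← Nat.cast_zero, coeff_toHahn_natCast, coeff_zero_eq_constantCoeff_apply, hf]
  have hne : toHahn f ≠ 0 := fun h ↦ by simp [h] at h0
  have hs : HahnSeries.single a (1 : ℂ) ≠ 0 := by simp
  rw [HahnSeries.order_mul hs hne, HahnSeries.order_single one_ne_zero]
  have : (toHahn f).order = 0 := by
    refine le_antisymm (HahnSeries.order_le_of_coeff_ne_zero (by rw [h0]; exact one_ne_zero)) ?_
    rw [HahnSeries.le_order_iff_forall hne]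
    intro g hg
    exact coeff_toHahn_of_notMem f fun n hn ↦ by
      rw [← hn] at hg
      exact absurd hg (not_lt.mpr (Nat.cast_nonneg n))
  rw [this, add_zero]

theorem monicPow_single_mul_toHahn {f : ℂ⟦X⟧} (hf : constantCoeff f = 1) (a r : ℚ) :
    monicPow (HahnSeries.single a 1 * toHahn f) r =
      HahnSeries.single (r * a) 1 * toHahn (subst (f - 1) (PowerSeries.binomialSeries ℂ r)) := by
  rw [monicPow, order_single_mul_toHahn hf, mul_right_comm, HahnSeries.single_mul_single,
    add_neg_cancel, mul_one, HahnSeries.single_zero_one, one_mul, ← map_one toHahn, ← map_sub,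
    heval_toHahn (by simp [hf])]

theorem binomialSeries_pow (r : ℚ) (k : ℕ) :
    PowerSeries.binomialSeries ℂ r ^ k = PowerSeries.binomialSeries ℂ (k * r) := by
  induction k with
  | zero => simp
  | succ k ih => rw [pow_succ, ih, ← binomialSeries_add]; push_cast; ring_nf

theorem subst_binomialSeries_pow {f : ℂ⟦X⟧} (hf : constantCoeff f = 1) {r : ℚ} {p k : ℕ}
    (hr : k * r = p) : subst (f - 1) (PowerSeries.binomialSeries ℂ r) ^ k = f ^ p := by
  have hs : HasSubst (f - 1) := HasSubst.of_constantCoeff_zero' (by simp [hf])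
  have hX : substAlgHom hs (X : ℂ⟦X⟧) = f - 1 := by rw [coe_substAlgHom, subst_X hs]
  rw [← subst_pow hs, binomialSeries_pow, hr, binomialSeries_nat, ← coe_substAlgHom hs, map_pow,
    map_add, map_one, hX, add_sub_cancel]

theorem constantCoeff_subst_of_zero {t : ℂ⟦X⟧} (ht : constantCoeff t = 0) (F : ℂ⟦X⟧) :
    constantCoeff (subst t F) = constantCoeff F := by
  have hs : HasSubst t := HasSubst.of_constantCoeff_zero' ht
  obtain ⟨B, hB⟩ : X ∣ F - C (constantCoeff F) := X_dvd_iff.mpr (by simp)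
  have h := congrArg (fun f ↦ constantCoeff (substAlgHom hs f)) hB
  have hC (c : ℂ) : substAlgHom hs (C c) = C c := by rw [coe_substAlgHom, subst_C]; rfl
  have hX : substAlgHom hs (X : ℂ⟦X⟧) = t := by rw [coe_substAlgHom, subst_X hs]
  simp only [map_sub, hC, map_mul, hX, ht, zero_mul, constantCoeff_C, sub_eq_zero] at h
  rwa [coe_substAlgHom] at h

theorem coeff_one_subst_of_zero {t : ℂ⟦X⟧} (ht : constantCoeff t = 0) (F : ℂ⟦X⟧) :
    coeff 1 (subst t F) = coeff 1 F * coeff 1 t := by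
  have hs : HasSubst t := HasSubst.of_constantCoeff_zero' ht
  obtain ⟨B, hB⟩ : X ∣ F - C (constantCoeff F) := X_dvd_iff.mpr (by simp)
  have h := congrArg (fun f ↦ coeff 1 (substAlgHom hs f)) hB
  have h' := congrArg (coeff 1) hB
  have hC (c : ℂ) : substAlgHom hs (C c) = C c := by rw [coe_substAlgHom, subst_C]; rfl
  have hX : substAlgHom hs (X : ℂ⟦X⟧) = t := by rw [coe_substAlgHom, subst_X hs]
  simp only [map_sub, hC, map_mul, hX, coeff_one_mul, ht] at h h'
  rw [coe_substAlgHom, constantCoeff_subst_of_zero ht] at h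
  simp at h h'
  rw [h, h', mul_comm]

/-- The cofactor of `f - g` in `f ^ k - g ^ k` has constant term `k`. Rational powers can thus be
compared through integral ones. -/
theorem eq_of_pow_eq_pow {f g : ℂ⟦X⟧} {k : ℕ} (hk : k ≠ 0) (hf : constantCoeff f = 1)
    (hg : constantCoeff g = 1) (h : f ^ k = g ^ k) : f = g := by
  have h1 := geom_sum₂_mul f g k
  rw [h, sub_self] at h1
  refine sub_eq_zero.mp ((mul_eq_zero.mp h1).resolve_left fun h2 ↦ ?_)
  have := congrArg constantCoeff h2
  simp [hf, hg] at this
  exact hk this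

/-- The data from which the M-series is determined: the inverse `τ = X u` of the Hauptmodul, the
product `Φ` of the eta-quotient without its leading power `q ^ (p / k)`, and the value `Mq` of the
M-series at `τ`. -/
structure MSeriesData (n : MIndex) (u Φ Mq : ℂ⟦X⟧) (p k : ℕ) : Prop where
  hk : k ≠ 0
  hauptmodul_mul : hauptmodul n * toHahn (X * u) = 1
  etaPlus_eq : etaPlus n = HahnSeries.single ((p : ℚ) / k) 1 * toHahn Φ
  pow_eq : Mq ^ k * u ^ p = Φ ^ k
  const_u : constantCoeff u = 1
  const_Φ : constantCoeff Φ = 1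
  const_Mq : constantCoeff Mq = 1

variable {n : MIndex} {u Φ Mq : ℂ⟦X⟧} {p k : ℕ}

/-- The fractional leading powers `q^(p/k)` and `q^(-p/k)` cancel. The remaining factor `Φ
(1/u)^(p/k)` is identified with `Mq` by taking `k`-th powers. -/
theorem MSeriesData.isMSeries_iff (S : MSeriesData n u Φ Mq p k) (M : ℂ⟦X⟧) :
    IsMSeries n M ↔ subst (X * u) M = Mq := by
  obtain ⟨w, hw⟩ := (isUnit_iff_constantCoeff.mpr
    (by rw [S.const_u]; exact isUnit_one) : IsUnit u).exists_right_inv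
  have hw1 : constantCoeff w = 1 := by
    have := congrArg constantCoeff hw
    rwa [map_mul, S.const_u, one_mul, map_one] at this
  have hH : hauptmodul n = HahnSeries.single (-1) 1 * toHahn w := by
    have h1 : (HahnSeries.single (-1 : ℚ) (1 : ℂ) * toHahn w) * toHahn (X * u) = 1 := by
      rw [map_mul, toHahn, HahnSeries.ofPowerSeries_X, mul_mul_mul_comm,
        HahnSeries.single_mul_single, ← map_mul, mul_comm w, hw]
      simp
    have h2 : toHahn (X * u) ≠ 0 := fun h ↦ by simp [h] at h1
    exact mul_right_cancel₀ h2 (S.hauptmodul_mul.trans h1.symm)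
  have hkq : (k : ℚ) ≠ 0 := by exact_mod_cast S.hk
  have hσ : sigmaOne n / 24 = (p : ℚ) / k := by
    rw [sigmaOne, S.etaPlus_eq, order_single_mul_toHahn S.const_Φ]; ring
  set B : ℂ⟦X⟧ := subst (w - 1) (PowerSeries.binomialSeries ℂ ((p : ℚ) / k)) with hB
  have hBk : B ^ k = w ^ p := subst_binomialSeries_pow hw1 (by field_simp)
  have hB1 : constantCoeff B = 1 := by
    rw [hB, constantCoeff_subst_of_zero (by simp [hw1])]; simp
  have hΦB : Φ * B = Mq := by
    refine eq_of_pow_eq_pow S.hk (by simp [S.const_Φ, hB1]) S.const_Mq ?_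
    rw [mul_pow, hBk, ← S.pow_eq, mul_assoc, ← mul_pow, hw, one_pow, mul_one]
  rw [IsMSeries, hσ, inv_eq_of_mul_eq_one_right S.hauptmodul_mul,
    heval_toHahn (by simp), S.etaPlus_eq, hH, monicPow_single_mul_toHahn hw1, ← hB,
    mul_mul_mul_comm, HahnSeries.single_mul_single, ← map_mul, hΦB]
  have : (p : ℚ) / k + p / k * (-1) = 0 := by ring
  rw [this, mul_one, HahnSeries.single_zero_one, one_mul]
  exact (HahnSeries.ofPowerSeries_injective).eq_iff

/-- As `X * u` is a local coordinate, `M` is `Mq` composed with its compositional inverse, and no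
other series is possible. -/
theorem MSeriesData.exists_generator (S : MSeriesData n u Φ Mq p k) {b₁ b₂ b₃ b₄ b₅ : ℂ}
    (hL : operatorL n = opD3 b₁ b₂ b₃ b₄ b₅) {t E ω l : ℂ⟦X⟧}
    (ht : t * (1 - C (coeff 1 Mq) * (X * u)) = X * u)
    (hE : E = (1 - C (coeff 1 Mq) * (X * u)) * Mq)
    (U : Uniformization b₁ b₂ b₃ b₄ b₅ t E ω l) :
    ∃ F : ℂ⟦X⟧, IsAnalyticGenerator (operatorL n) F ∧
      ∃ M : ℂ⟦X⟧, (IsMSeries n M ∧ ∀ M' : ℂ⟦X⟧, IsMSeries n M' → M' = M) ∧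
        normalization M = F := by
  have hτ0 : constantCoeff (X * u) = 0 := by simp
  have hτ1 : coeff 1 (X * u) = 1 := by
    rw [← zero_add 1, coeff_succ_X_mul, coeff_zero_eq_constantCoeff_apply, S.const_u]
  have hunit : IsUnit (coeff 1 (X * u)) := by rw [hτ1]; exact isUnit_one
  have hs : HasSubst (X * u) := HasSubst.of_constantCoeff_zero' hτ0
  set M := subst (substInvOfIsUnit (X * u) hunit) Mq with hM
  have hMq : subst (X * u) M = Mq := by
    rw [hM, subst_comp_subst_apply (HasSubst.substInvOfIsUnit ..) hs,
      subst_substInvOfIsUnit_left _ hτ0, X_subst]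
  have hM1 : coeff 1 M = coeff 1 Mq := by
    rw [← hMq, coeff_one_subst_of_zero hτ0, hτ1, mul_one]
  have hF : subst t (normalization M) = E := by
    rw [subst_normalization hτ0 (by rw [hM1]; exact ht), hM1, hMq, hE]
  refine ⟨normalization M, ?_, M, ⟨(S.isMSeries_iff M).mpr hMq, fun M' hM' ↦ ?_⟩, rfl⟩
  · rw [hL]
    refine isAnalyticGenerator_opD3 _ _ _ _ _ (U.opD3_eq_zero hF) ?_
    rw [← constantCoeff_subst_of_zero U.const_t, hF, U.const_E]
  · exact injective_subst hτ0 hunit.ne_zero (((S.isMSeries_iff M').mp hM').trans hMq.symm)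

end MSeries

/-! ### Comparison by logarithmic derivatives -/

namespace MSeries
open PowerSeries

/-- `f` is a series with constant term `1` and logarithmic derivative `L / 24`. -/
structure HasLogDeriv (f L : ℂ⟦X⟧) : Prop where
  theta_eq : 24 * theta f = f * L
  const : constantCoeff f = 1

namespace HasLogDeriv

variable {f g L L' : ℂ⟦X⟧}

theorem mul (hf : HasLogDeriv f L) (hg : HasLogDeriv g L') : HasLogDeriv (f * g) (L + L') where
  theta_eq := by
    rw [Derivation.leibniz, smul_eq_mul, smul_eq_mul]
    linear_combination f * hg.theta_eq + g * hf.theta_eq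
  const := by rw [map_mul, hf.const, hg.const, mul_one]

theorem pow (hf : HasLogDeriv f L) (n : ℕ) : HasLogDeriv (f ^ n) (n * L) := by
  induction n with
  | zero => exact ⟨by simp, by simp⟩
  | succ n ih =>
    have := ih.mul hf
    rwa [← pow_succ, ← add_one_mul, ← Nat.cast_succ] at this

/-- The quotient `f/g` has derivative zero and constant term 1. -/
theorem eq (hf : HasLogDeriv f L) (hg : HasLogDeriv g L') (h : L = L') : f = g := by
  obtain ⟨w, hw⟩ := (isUnit_iff_constantCoeff.mpr
    (by rw [hg.const]; exact isUnit_one) : IsUnit g).exists_right_inv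
  have hw1 : constantCoeff w = 1 := by
    have := congrArg constantCoeff hw
    rwa [map_mul, hg.const, one_mul, map_one] at this
  have h24 : (24 : ℂ⟦X⟧) ≠ 0 := fun h ↦ by
    have := congrArg constantCoeff h
    rw [constantCoeff_ofNat, map_zero] at this
    norm_num at this
  have hw' := congrArg theta hw
  rw [Derivation.leibniz, smul_eq_mul, smul_eq_mul, theta.map_one_eq_zero] at hw'
  have : theta (f * w - 1) = 0 := by
    rw [map_sub, theta.map_one_eq_zero, Derivation.leibniz, smul_eq_mul, smul_eq_mul, sub_zero]
    refine (mul_eq_zero.mp (?_ : (24 : ℂ⟦X⟧) * _ = 0)).resolve_left h24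
    linear_combination 24 * f * w * hw' - 24 * f * theta w * hw + w * hf.theta_eq -
      f * w ^ 2 * hg.theta_eq - f * w * L' * hw + w * f * h
  have := eq_zero_of_theta_eq_zero this (by simp [hf.const, hw1])
  linear_combination g * this - (f - g) * hw - g * hw

end HasLogDeriv

theorem hasLogDeriv_eulerProduct {d : ℕ} (hd : d ≠ 0) :
    HasLogDeriv (eulerProduct d) (scaledE2 d - (d : ℂ⟦X⟧)) :=
  ⟨theta_eulerProduct hd, constantCoeff_eulerProduct hd⟩

section

variable {m ρ c : Polynomial ℂ} {g P ψ r : ℂ⟦X⟧}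

theorem ModularSystem.const_g (S : ModularSystem m ρ c (X * g) P ψ r) : constantCoeff g = 1 := by
  have := S.coeff_v
  rwa [← zero_add 1, coeff_succ_X_mul, coeff_zero_eq_constantCoeff_apply] at this

theorem ModularSystem.hasLogDeriv_g (S : ModularSystem m ρ c (X * g) P ψ r) :
    HasLogDeriv g (24 * (Polynomial.aeval (X * g) m * P * r - 1)) where
  theta_eq := by
    have h := S.theta_v
    have tX : theta (X : ℂ⟦X⟧) = X := by simp [theta_apply]
    rw [Derivation.leibniz, smul_eq_mul, smul_eq_mul, tX] at h
    apply mul_left_cancel₀ (X_ne_zero : (X : ℂ⟦X⟧) ≠ 0)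
    linear_combination 24 * h
  const := S.const_g

theorem ModularSystem.hasLogDeriv_P {v : ℂ⟦X⟧} (S : ModularSystem m ρ c v P ψ r) :
    HasLogDeriv P (24 * ψ) :=
  ⟨by rw [S.theta_P]; ring, S.const_P⟩

/-- Needed for the linear coefficient of the M-series: to first order `P` and `ψ` have the same
coefficient, and that of `ψ` comes from the inhomogeneous term. -/
theorem ModularSystem.coeff_one_P {v : ℂ⟦X⟧} (S : ModularSystem m ρ c v P ψ r) :
    coeff 1 P = c.eval 0 / 2 := by
  have h1 := congrArg (coeff 1) S.theta_P
  have h2 := congrArg (coeff 1) S.theta_ψ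
  simp only [coeff_theta, coeff_one_mul, S.const_P, S.const_ψ, constantCoeff_theta,
    constantCoeff_ofNat, pow_two, map_add,
    constantCoeff_aeval S.const_v, Polynomial.coeff_zero_eq_eval_zero, S.coeff_v, S.const_v,
    map_mul (constantCoeff (R := ℂ))] at h1 h2
  push_cast at h1 h2
  linear_combination h1 + h2 / 2

theorem ModularSystem.coeff_one_r {v : ℂ⟦X⟧} (S : ModularSystem m ρ c v P ψ r)
    (hm : m.eval 0 = 1) : coeff 1 r = ρ.derivative.eval 0 / 2 := by
  have h2 := congrArg (coeff 1) S.theta_r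
  simp only [coeff_theta, coeff_one_mul, S.const_P, constantCoeff_theta, constantCoeff_ofNat,
    constantCoeff_aeval S.const_v, Polynomial.coeff_zero_eq_eval_zero, S.coeff_v, S.const_v, hm,
    map_mul (constantCoeff (R := ℂ))] at h2
  push_cast at h2
  linear_combination h2 / 2

theorem exists_X_mul_modularSystem (m ρ c : Polynomial ℂ) (hm : m.coeff 0 = 1)
    (hρ : ρ.coeff 0 = 1) : ∃ g P ψ r, ModularSystem m ρ c (X * g) P ψ r := by
  obtain ⟨v, P, ψ, r, S⟩ := exists_modularSystem m ρ c hm hρ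
  obtain ⟨g, rfl⟩ := exists_X_mul_eq S.const_v
  exact ⟨g, P, ψ, r, S⟩

end

end MSeries

/-! ### Eta quotients in terms of the differential systems -/

namespace MSeries
open Polynomial
open scoped PowerSeries

/-- The modular system of level six. -/
abbrev LevelSystemSix (g P ψ r : ℂ⟦X⟧) : Prop :=
  ModularSystem (1) (1 + 20 * X + 64 * X ^ 2) (-8 - 64 * X) (PowerSeries.X * g) P ψ r

/-- The modular system of level ten. -/
abbrev LevelSystemTen (g P ψ r : ℂ⟦X⟧) : Prop :=
  ModularSystem (1 - 4 * X) (1 + 4 * X - 16 * X ^ 2)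
    (4 + 44 * X - 480 * X ^ 2 + 960 * X ^ 3) (PowerSeries.X * g) P ψ r

/-- The modular system of level fourteen. -/
abbrev LevelSystemFourteen (g P ψ r : ℂ⟦X⟧) : Prop :=
  ModularSystem (1) (1 + 14 * X + 61 * X ^ 2 + 112 * X ^ 3 + 64 * X ^ 4)
    (-8 - 88 * X - 288 * X ^ 2 - 256 * X ^ 3) (PowerSeries.X * g) P ψ r

/-- The modular system of level fifteen. -/
abbrev LevelSystemFifteen (g P ψ r : ℂ⟦X⟧) : Prop :=
  ModularSystem (1) (1 + 10 * X + 47 * X ^ 2 + 90 * X ^ 3 + 81 * X ^ 4)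
    (-6 - 69 * X - 234 * X ^ 2 - 324 * X ^ 3) (PowerSeries.X * g) P ψ r

/-- In the sum over a conjugate pair the terms `±a` cancel, leaving multiples of `ψ` and `P r`.
These match the logarithmic derivatives of `P` and `v`; the other levels are analogous. -/
theorem exists_levelSix : ∃ g P ψ r : ℂ⟦X⟧, LevelSystemSix g P ψ r ∧
    g * (eulerProduct 1 * eulerProduct 3) ^ 6 = (eulerProduct 2 * eulerProduct 6) ^ 6 ∧
    P ^ 2 * g = (eulerProduct 1 * eulerProduct 2 * eulerProduct 3 * eulerProduct 6) ^ 2 := by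
  obtain ⟨g, P, ψ, r, S⟩ := exists_X_mul_modularSystem (1) (1 + 20 * X + 64 * X ^ 2) (-8 - 64 * X)
    (by simp) (by simp)
  obtain ⟨y1, y3⟩ := eisensteinPairSix_1_3.eq_scaledE2 S (by norm_num) (by norm_num)
  obtain ⟨y2, y6⟩ := eisensteinPairSix_2_6.eq_scaledE2 S (by norm_num) (by norm_num)
  have e1 := hasLogDeriv_eulerProduct (d := 1) (by norm_num)
  have e2 := hasLogDeriv_eulerProduct (d := 2) (by norm_num)
  have e3 := hasLogDeriv_eulerProduct (d := 3) (by norm_num)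
  have e6 := hasLogDeriv_eulerProduct (d := 6) (by norm_num)
  have hg := S.hasLogDeriv_g
  have hP := S.hasLogDeriv_P
  rw [← y1] at e1
  rw [← y2] at e2
  rw [← y3] at e3
  rw [← y6] at e6
  refine ⟨g, P, ψ, r, S, (hg.mul ((e1.mul e3).pow 6)).eq ((e2.mul e6).pow 6) ?_,
    ((hP.pow 2).mul hg).eq ((((e1.mul e2).mul e3).mul e6).pow 2) ?_⟩ <;>
  · simp [map_ofNat]
    ring

theorem exists_levelTen : ∃ g P ψ r : ℂ⟦X⟧, LevelSystemTen g P ψ r ∧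
    g * (eulerProduct 1 * eulerProduct 5) ^ 4 =
      (1 - 4 * (PowerSeries.X * g)) * (eulerProduct 2 * eulerProduct 10) ^ 4 ∧
    P ^ 4 * (g * (1 - 4 * (PowerSeries.X * g))) ^ 3 =
      (eulerProduct 1 * eulerProduct 2 * eulerProduct 5 * eulerProduct 10) ^ 4 := by
  obtain ⟨g, P, ψ, r, S⟩ := exists_X_mul_modularSystem (1 - 4 * X) (1 + 4 * X - 16 * X ^ 2)
    (4 + 44 * X - 480 * X ^ 2 + 960 * X ^ 3) (by simp) (by simp)
  obtain ⟨y1, y5⟩ := eisensteinPairTen_1_5.eq_scaledE2 S (by norm_num) (by norm_num)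
  obtain ⟨y2, y10⟩ := eisensteinPairTen_2_10.eq_scaledE2 S (by norm_num) (by norm_num)
  have e1 := hasLogDeriv_eulerProduct (d := 1) (by norm_num)
  have e2 := hasLogDeriv_eulerProduct (d := 2) (by norm_num)
  have e5 := hasLogDeriv_eulerProduct (d := 5) (by norm_num)
  have e10 := hasLogDeriv_eulerProduct (d := 10) (by norm_num)
  have hg := S.hasLogDeriv_g
  have hP := S.hasLogDeriv_P
  have hv : HasLogDeriv (1 - 4 * (PowerSeries.X * g)) (24 * (-4 * (PowerSeries.X * g) * P * r)) :=
    ⟨by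
      rw [map_sub, theta.map_one_eq_zero, Derivation.leibniz, theta_ofNat, S.theta_v]
      simp [map_ofNat]
      ring, by simp⟩
  rw [← y1] at e1
  rw [← y2] at e2
  rw [← y5] at e5
  rw [← y10] at e10
  refine ⟨g, P, ψ, r, S, (hg.mul ((e1.mul e5).pow 4)).eq (hv.mul ((e2.mul e10).pow 4)) ?_,
    ((hP.pow 4).mul ((hg.mul hv).pow 3)).eq ((((e1.mul e2).mul e5).mul e10).pow 4) ?_⟩ <;>
  · simp [map_ofNat]
    ring

theorem exists_levelFourteen : ∃ g P ψ r : ℂ⟦X⟧, LevelSystemFourteen g P ψ r ∧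
    g * (eulerProduct 1 * eulerProduct 7) ^ 3 = (eulerProduct 2 * eulerProduct 14) ^ 3 ∧
    P * g = eulerProduct 1 * eulerProduct 2 * eulerProduct 7 * eulerProduct 14 := by
  obtain ⟨g, P, ψ, r, S⟩ := exists_X_mul_modularSystem (1)
    (1 + 14 * X + 61 * X ^ 2 + 112 * X ^ 3 + 64 * X ^ 4)
    (-8 - 88 * X - 288 * X ^ 2 - 256 * X ^ 3) (by simp) (by simp)
  obtain ⟨y1, y7⟩ := eisensteinPairFourteen_1_7.eq_scaledE2 S (by norm_num) (by norm_num)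
  obtain ⟨y2, y14⟩ := eisensteinPairFourteen_2_14.eq_scaledE2 S (by norm_num) (by norm_num)
  have e1 := hasLogDeriv_eulerProduct (d := 1) (by norm_num)
  have e2 := hasLogDeriv_eulerProduct (d := 2) (by norm_num)
  have e7 := hasLogDeriv_eulerProduct (d := 7) (by norm_num)
  have e14 := hasLogDeriv_eulerProduct (d := 14) (by norm_num)
  have hg := S.hasLogDeriv_g
  have hP := S.hasLogDeriv_P
  rw [← y1] at e1
  rw [← y2] at e2
  rw [← y7] at e7
  rw [← y14] at e14
  refine ⟨g, P, ψ, r, S, (hg.mul ((e1.mul e7).pow 3)).eq ((e2.mul e14).pow 3) ?_,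
    (hP.mul hg).eq (((e1.mul e2).mul e7).mul e14) ?_⟩ <;>
  · simp [map_ofNat]
    ring

theorem exists_levelFifteen : ∃ g P ψ r : ℂ⟦X⟧, LevelSystemFifteen g P ψ r ∧
    g * (eulerProduct 1 * eulerProduct 5) ^ 2 = (eulerProduct 3 * eulerProduct 15) ^ 2 ∧
    P * g = eulerProduct 1 * eulerProduct 3 * eulerProduct 5 * eulerProduct 15 := by
  obtain ⟨g, P, ψ, r, S⟩ := exists_X_mul_modularSystem (1)
    (1 + 10 * X + 47 * X ^ 2 + 90 * X ^ 3 + 81 * X ^ 4)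
    (-6 - 69 * X - 234 * X ^ 2 - 324 * X ^ 3) (by simp) (by simp)
  obtain ⟨y1, y5⟩ := eisensteinPairFifteen_1_5.eq_scaledE2 S (by norm_num) (by norm_num)
  obtain ⟨y3, y15⟩ := eisensteinPairFifteen_3_15.eq_scaledE2 S (by norm_num) (by norm_num)
  have e1 := hasLogDeriv_eulerProduct (d := 1) (by norm_num)
  have e3 := hasLogDeriv_eulerProduct (d := 3) (by norm_num)
  have e5 := hasLogDeriv_eulerProduct (d := 5) (by norm_num)
  have e15 := hasLogDeriv_eulerProduct (d := 15) (by norm_num)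
  have hg := S.hasLogDeriv_g
  have hP := S.hasLogDeriv_P
  rw [← y1] at e1
  rw [← y3] at e3
  rw [← y5] at e5
  rw [← y15] at e15
  refine ⟨g, P, ψ, r, S, (hg.mul ((e1.mul e5).pow 2)).eq ((e3.mul e15).pow 2) ?_,
    (hP.mul hg).eq (((e1.mul e3).mul e5).mul e15) ?_⟩ <;>
  · simp [map_ofNat]
    ring

end MSeries

/-! ### The substitution `q ↦ -q` -/

namespace MSeries
open PowerSeries

theorem coeff_evalNegHom (f : ℂ⟦X⟧) (n : ℕ) : coeff n (evalNegHom f) = (-1) ^ n * coeff n f :=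
  coeff_rescale f (-1) n

theorem constantCoeff_evalNegHom (f : ℂ⟦X⟧) : constantCoeff (evalNegHom f) = constantCoeff f := by
  rw [← coeff_zero_eq_constantCoeff_apply, coeff_evalNegHom]; simp

theorem evalNegHom_C (a : ℂ) : evalNegHom (C a) = C a := by
  ext n
  rw [coeff_evalNegHom, coeff_C]
  split_ifs with h <;> simp [h]

theorem theta_evalNegHom (f : ℂ⟦X⟧) : theta (evalNegHom f) = evalNegHom (theta f) := by
  ext n
  rw [coeff_theta, coeff_evalNegHom, coeff_evalNegHom, coeff_theta]
  ring

theorem X_pow_dvd_evalNegHom {f : ℂ⟦X⟧} {n : ℕ} (h : X ^ n ∣ f) : X ^ n ∣ evalNegHom f := by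
  rw [X_pow_dvd_iff] at h ⊢
  intro m hm
  rw [coeff_evalNegHom, h m hm, mul_zero]

theorem eq_of_X_pow_dvd_sub {f g : ℂ⟦X⟧} (h : ∀ n, X ^ (n + 1) ∣ f - g) : f = g := by
  ext n
  rw [← sub_eq_zero, ← map_sub]
  exact X_pow_dvd_iff.mp (h n) n n.lt_succ_self

/-- `theta` commutes with `q ↦ -q`, and the relations have constant coefficients. -/
theorem Uniformization.evalNeg {b₁ b₂ b₃ b₄ b₅ : ℂ} {t E ω l : ℂ⟦X⟧}
    (U : Uniformization b₁ b₂ b₃ b₄ b₅ t E ω l) : Uniformization b₁ b₂ b₃ b₄ b₅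
      (evalNegHom t) (evalNegHom E) (evalNegHom ω) (evalNegHom l) where
  theta_t := by rw [theta_evalNegHom, U.theta_t, map_mul]
  omega_sq := by
    have := congrArg evalNegHom U.omega_sq
    simpa only [map_mul, map_pow, map_sub, map_add, map_ofNat, map_one, evalNegHom_C] using this
  theta_E := by rw [theta_evalNegHom, U.theta_E, map_mul]
  theta_l := by
    have := congrArg evalNegHom U.theta_l
    simpa only [map_mul, map_pow, map_sub, map_add, map_ofNat, map_one, evalNegHom_C,
      theta_evalNegHom] using this
  const_t := by rw [constantCoeff_evalNegHom, U.const_t]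
  coeff_t := by rw [coeff_evalNegHom]; simp [U.coeff_t]
  const_E := by rw [constantCoeff_evalNegHom, U.const_E]

theorem evalNegHom_eulerPartial {d : ℕ} (hd : Even d) (N : ℕ) :
    evalNegHom (eulerPartial d N) = eulerPartial d N := by
  rw [eulerPartial, map_prod]
  refine Finset.prod_congr rfl fun n _ ↦ ?_
  rw [map_sub, map_one, map_pow, evalNegHom_X, (hd.mul_right _).neg_pow]

theorem evalNegHom_eulerProduct {d : ℕ} (hd : Even d) (hd0 : d ≠ 0) :
    evalNegHom (eulerProduct d) = eulerProduct d := by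
  refine eq_of_X_pow_dvd_sub fun n ↦ ?_
  have h := X_pow_dvd_eulerProduct_sub hd0 n
  have h' := X_pow_dvd_evalNegHom h
  rw [map_sub, evalNegHom_eulerPartial hd] at h'
  convert h'.sub h using 1
  ring

theorem eulerPartial_succ (d N : ℕ) :
    eulerPartial d (N + 1) = eulerPartial d N * (1 - X ^ (d * (N + 1))) :=
  Finset.prod_range_succ ..

/-- An odd exponent contributes `(1 - x)(1 + x) = 1 - x²`, an even one `(1 - x)²`. The length `2 *
N` keeps the two kinds in pairs. -/
theorem eulerPartial_mul_evalNegHom {d : ℕ} (hd : Odd d) (N : ℕ) :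
    eulerPartial d (2 * N) * evalNegHom (eulerPartial d (2 * N)) * eulerPartial (4 * d) N =
      eulerPartial (2 * d) N ^ 2 * eulerPartial (2 * d) (2 * N) := by
  induction N with
  | zero => simp [eulerPartial]
  | succ N ih =>
    have ho : Odd (d * (2 * N + 1)) := hd.mul ⟨N, rfl⟩
    have he : Even (d * (2 * N + 1 + 1)) := by
      rw [show d * (2 * N + 1 + 1) = 2 * (d * (N + 1)) by ring]; exact even_two_mul _
    rw [show 2 * (N + 1) = 2 * N + 1 + 1 by ring]
    simp only [eulerPartial_succ, map_mul, map_sub, map_one, map_pow, evalNegHom_X, ho.neg_pow,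
      he.neg_pow]
    have e1 : (X : ℂ⟦X⟧) ^ (d * (2 * N + 1 + 1)) = (X ^ (d * (N + 1))) ^ 2 := by
      rw [← pow_mul]; congr 1; ring
    have e2 : (X : ℂ⟦X⟧) ^ (4 * d * (N + 1)) = (X ^ (d * (N + 1))) ^ 4 := by
      rw [← pow_mul]; congr 1; ring
    have e3 : (X : ℂ⟦X⟧) ^ (2 * d * (N + 1)) = (X ^ (d * (N + 1))) ^ 2 := by
      rw [← pow_mul]; congr 1; ring
    have e4 : (X : ℂ⟦X⟧) ^ (2 * d * (2 * N + 1)) = (X ^ (d * (2 * N + 1))) ^ 2 := by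
      rw [← pow_mul]; congr 1; ring
    have e5 : (X : ℂ⟦X⟧) ^ (2 * d * (2 * N + 1 + 1)) = (X ^ (d * (N + 1))) ^ 4 := by
      rw [← pow_mul]; congr 1; ring
    rw [e1, e2, e3, e4, e5]
    set z := (X : ℂ⟦X⟧) ^ (d * (N + 1))
    set o := (X : ℂ⟦X⟧) ^ (d * (2 * N + 1))
    linear_combination (1 - o ^ 2) * (1 - z ^ 2) ^ 2 * (1 - z ^ 4) * ih

theorem eulerProduct_mul_evalNegHom {d : ℕ} (hd : Odd d) :
    eulerProduct d * evalNegHom (eulerProduct d) * eulerProduct (4 * d) =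
      eulerProduct (2 * d) ^ 3 := by
  have hd0 : d ≠ 0 := by rintro rfl; simp at hd
  refine eq_of_X_pow_dvd_sub fun n ↦ ?_
  have le : n + 1 ≤ 2 * n + 1 := by omega
  have h1 := (pow_dvd_pow X le).trans (X_pow_dvd_eulerProduct_sub hd0 (2 * n))
  have h1' := X_pow_dvd_evalNegHom h1
  rw [map_sub] at h1'
  have h4 := X_pow_dvd_eulerProduct_sub (d := 4 * d) (by omega) n
  have h2 := X_pow_dvd_eulerProduct_sub (d := 2 * d) (by omega) n
  have h2' := (pow_dvd_pow X le).trans (X_pow_dvd_eulerProduct_sub (d := 2 * d) (by omega) (2 * n))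
  have hl := dvd_mul_sub_mul (dvd_mul_sub_mul h1 h1') h4
  have hr := dvd_mul_sub_mul (h2.trans (sub_dvd_pow_sub_pow _ _ 2)) h2'
  rw [eulerPartial_mul_evalNegHom hd] at hl
  convert hl.sub hr using 1
  ring

end MSeries

/-! ### The six cases -/

namespace MSeries
open PowerSeries

section eta

/-- The series `q ^ (1 / 24)`. -/
noncomputable def qRoot : HahnSeries ℚ ℂ := HahnSeries.single (1 / 24) 1

theorem qRoot_pow (n : ℕ) : qRoot ^ n = HahnSeries.single ((n : ℚ) / 24) 1 := by
  rw [qRoot, HahnSeries.single_pow, one_pow, nsmul_eq_mul, mul_one_div]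

theorem qRoot_ne_zero : qRoot ≠ 0 := by simp [qRoot]

theorem toHahn_X : toHahn X = qRoot ^ 24 := by
  rw [qRoot_pow, toHahn, HahnSeries.ofPowerSeries_X]; norm_num

theorem toHahn_C (c : ℂ) : toHahn (C c) = HahnSeries.C c := HahnSeries.ofPowerSeries_C c

theorem toHahn_ne_zero {f : ℂ⟦X⟧} (hf : f ≠ 0) : toHahn f ≠ 0 := by
  rw [← map_zero toHahn]
  exact HahnSeries.ofPowerSeries_injective.ne hf

theorem etaQ_eq (d : ℕ) : etaQ d = qRoot ^ d * toHahn (eulerProduct d) := by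
  rw [qRoot_pow]; rfl

theorem eulerProduct_ne_zero {d : ℕ} (hd : d ≠ 0) : eulerProduct d ≠ 0 := fun h ↦ by
  simpa [h] using constantCoeff_eulerProduct hd

theorem etaQ_ne_zero {d : ℕ} (hd : d ≠ 0) : etaQ d ≠ 0 := by
  rw [etaQ_eq]
  exact mul_ne_zero (pow_ne_zero _ qRoot_ne_zero) (toHahn_ne_zero (eulerProduct_ne_zero hd))

/-- All Hauptmoduln except that of case 12 have the shape `1/v + c + κ v`, with inverse `v/(1 + cv +
κv²)`. -/
theorem add_div_add_mul_toHahn {a b : HahnSeries ℚ ℂ} (ha : a ≠ 0) (hb : b ≠ 0) {v τ : ℂ⟦X⟧}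
    (hv : toHahn v * a = b) {c : ℂ} {κ : ℂ⟦X⟧}
    {κ' : HahnSeries ℚ ℂ} (hκ : toHahn κ = κ') (hτ : τ * (1 + C c * v + κ * v ^ 2) = v) :
    (HahnSeries.C c + a / b + κ' * (b / a)) * toHahn τ = 1 := by
  have hx : toHahn v ≠ 0 := fun h ↦ hb (by rw [← hv, h, zero_mul])
  have h := congrArg toHahn hτ
  simp only [map_mul, map_add, map_one, map_pow, toHahn_C, hκ] at h
  rw [← hv]
  field_simp
  linear_combination h

end eta

theorem exists_mul_eq {W : ℂ⟦X⟧} (hW : constantCoeff W = 1) (g : ℂ⟦X⟧) : ∃ u, u * W = g := by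
  obtain ⟨w, hw⟩ := (isUnit_iff_constantCoeff.mpr
    (by rw [hW]; exact isUnit_one) : IsUnit W).exists_left_inv
  exact ⟨g * w, by rw [mul_assoc, hw, mul_one]⟩

theorem constantCoeff_of_mul_eq {u W g : ℂ⟦X⟧} (h : u * W = g) (hW : constantCoeff W = 1)
    (hg : constantCoeff g = 1) : constantCoeff u = 1 := by
  simpa [hW, hg] using congrArg constantCoeff h

/-- `W` is the common denominator: `τ = vT/W` and `1 - aτ = Q/W`, so `t = vT/Q`, and `M(τ) = P W/√η`
gives `E = P Q/√η`. -/
theorem ParametrizationCertificate.exists_generator {m ρ c T Q η : Polynomial ℂ}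
    {b₁ b₂ b₃ b₄ b₅ : ℂ} (K : ParametrizationCertificate m ρ c T Q η b₁ b₂ b₃ b₄ b₅)
    {v P ψ r : ℂ⟦X⟧} (S : ModularSystem m ρ c v P ψ r) {n : MIndex} {u Φ Mq : ℂ⟦X⟧} {p k : ℕ}
    (M : MSeriesData n u Φ Mq p k) (hL : operatorL n = opD3 b₁ b₂ b₃ b₄ b₅) {a : ℂ}
    (ha : coeff 1 Mq = a) {W : ℂ⟦X⟧} (hW : constantCoeff W = 1)
    (hQ : (1 - C a * (X * u)) * W = Polynomial.aeval v Q)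
    (hT : X * u * W = v * Polynomial.aeval v T)
    (hη : Mq ^ 2 * Polynomial.aeval v η = P ^ 2 * W ^ 2) :
    ∃ F : ℂ⟦X⟧, IsAnalyticGenerator (operatorL n) F ∧
      ∃ M : ℂ⟦X⟧, (IsMSeries n M ∧ ∀ M' : ℂ⟦X⟧, IsMSeries n M' → M' = M) ∧
        normalization M = F := by
  have hW0 : W ≠ 0 := by rintro rfl; simp at hW
  obtain ⟨t, ht⟩ := exists_mul_eq (W := Polynomial.aeval v Q) (by
    rw [constantCoeff_aeval S.const_v, Polynomial.coeff_zero_eq_eval_zero, K.hQ0])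
    (v * Polynomial.aeval v T)
  subst ha
  set E := (1 - C (coeff 1 Mq) * (X * u)) * Mq with hE
  obtain ⟨ω, l, U⟩ := K.exists_uniformization (E := E) S ht
    (by rw [← hQ, hE]; linear_combination (1 - C (coeff 1 Mq) * (X * u)) ^ 2 * hη)
    (by simp [hE, M.const_Mq])
  refine M.exists_generator hL (mul_right_cancel₀ hW0 ?_) hE U
  rw [mul_assoc, hQ, ht, hT]

section levels

variable {g P ψ r : ℂ⟦X⟧}

theorem etaPlus_six_eq : etaQ 1 * etaQ 2 * etaQ 3 * etaQ 6 = HahnSeries.single (1 / 2) 1 *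
    toHahn (eulerProduct 1 * eulerProduct 2 * eulerProduct 3 * eulerProduct 6) := by
  have : HahnSeries.single (1 / 2) 1 = qRoot ^ 12 := by rw [qRoot_pow]; norm_num
  simp only [this, etaQ_eq, map_mul]
  ring

theorem T6A_mul {u : ℂ⟦X⟧} {c : ℂ}
    (hg : g * (eulerProduct 1 * eulerProduct 3) ^ 6 = (eulerProduct 2 * eulerProduct 6) ^ 6)
    (hu : u * (1 + C (c + 6) * (X * g) + 64 * (X * g) ^ 2) = g) :
    T6A c * toHahn (X * u) = 1 := by
  have ne {d : ℕ} (hd : d ≠ 0) := pow_ne_zero 6 (etaQ_ne_zero hd)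
  refine add_div_add_mul_toHahn (κ := 64) (v := X * g) (mul_ne_zero (ne (by simp)) (ne (by simp)))
    (mul_ne_zero (ne (by simp)) (ne (by simp))) ?_ (map_ofNat _ 64) ?_
  · have := congrArg toHahn hg
    simp only [map_mul, map_pow] at this
    simp only [etaQ_eq, map_mul, toHahn_X]
    -- Powers of `q^(1/24)`: `24 + 6 (1 + 3) = 6 (2 + 6) = 48`, the first 24 coming from `v = X g`.
    linear_combination qRoot ^ 48 * this
  · linear_combination X * hu

/-- With `w = v/(1 - 4v)`, the constant 4 makes `1/w + 8 + 16w` a square over `w`, namely `1/(v(1 -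
4v))`. -/
theorem T10A_mul {c : ℂ} (hc : c = 4)
    (hg : g * (eulerProduct 1 * eulerProduct 5) ^ 4 =
      (1 - 4 * (X * g)) * (eulerProduct 2 * eulerProduct 10) ^ 4) :
    T10A c * toHahn (X * (g * (1 - 4 * (X * g)))) = 1 := by
  subst hc
  have ne {d : ℕ} (hd : d ≠ 0) := pow_ne_zero 4 (etaQ_ne_zero hd)
  obtain ⟨w, hw⟩ := exists_mul_eq (W := 1 - 4 * (X * g)) (by simp) 1
  refine add_div_add_mul_toHahn (κ := 16) (v := X * (g * w))
    (mul_ne_zero (ne (by simp)) (ne (by simp)))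
    (mul_ne_zero (ne (by simp)) (ne (by simp))) ?_ (map_ofNat _ 16) ?_
  · have hg' : g * w * (eulerProduct 1 * eulerProduct 5) ^ 4 =
        (eulerProduct 2 * eulerProduct 10) ^ 4 := by
      linear_combination w * hg + (eulerProduct 2 * eulerProduct 10) ^ 4 * hw
    have := congrArg toHahn hg'
    simp only [map_mul, map_pow] at this
    simp only [etaQ_eq, map_mul, toHahn_X]
    linear_combination qRoot ^ 48 * this
  · have : (C (4 + 4 : ℂ) : ℂ⟦X⟧) = 8 := by norm_num [map_ofNat]
    rw [this]
    linear_combination X * g * (w - 2 * (1 - 4 * (X * g)) * w +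
      (1 - 4 * (X * g)) * (w * (1 - 4 * (X * g)) - 1)) * hw

theorem T14A_mul {u : ℂ⟦X⟧} {c : ℂ}
    (hg : g * (eulerProduct 1 * eulerProduct 7) ^ 3 = (eulerProduct 2 * eulerProduct 14) ^ 3)
    (hu : u * (1 + C (c + 3) * (X * g) + 8 * (X * g) ^ 2) = g) :
    T14A c * toHahn (X * u) = 1 := by
  have ne {d : ℕ} (hd : d ≠ 0) := pow_ne_zero 3 (etaQ_ne_zero hd)
  refine add_div_add_mul_toHahn (κ := 8) (v := X * g) (mul_ne_zero (ne (by simp)) (ne (by simp)))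
    (mul_ne_zero (ne (by simp)) (ne (by simp))) ?_ (map_ofNat _ 8) ?_
  · have := congrArg toHahn hg
    simp only [map_mul, map_pow] at this
    simp only [etaQ_eq, map_mul, toHahn_X]
    linear_combination qRoot ^ 48 * this
  · linear_combination X * hu

theorem T15A_mul {u : ℂ⟦X⟧} {c : ℂ}
    (hg : g * (eulerProduct 1 * eulerProduct 5) ^ 2 = (eulerProduct 3 * eulerProduct 15) ^ 2)
    (hu : u * (1 + C (c + 2) * (X * g) + 9 * (X * g) ^ 2) = g) :
    T15A c * toHahn (X * u) = 1 := by
  have ne {d : ℕ} (hd : d ≠ 0) := pow_ne_zero 2 (etaQ_ne_zero hd)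
  refine add_div_add_mul_toHahn (κ := 9) (v := X * g) (mul_ne_zero (ne (by simp)) (ne (by simp)))
    (mul_ne_zero (ne (by simp)) (ne (by simp))) ?_ (map_ofNat _ 9) ?_
  · have := congrArg toHahn hg
    simp only [map_mul, map_pow] at this
    simp only [etaQ_eq, map_mul, toHahn_X]
    linear_combination qRoot ^ 36 * this
  · linear_combination X * hu

theorem const_eulerProduct_mul {a b c d : ℕ} (ha : a ≠ 0) (hb : b ≠ 0) (hc : c ≠ 0) (hd : d ≠ 0) :
    constantCoeff (eulerProduct a * eulerProduct b * eulerProduct c * eulerProduct d) = 1 := by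
  simp [constantCoeff_eulerProduct, ha, hb, hc, hd]

/-- The existence of the M-series and the identification of its normalization. -/
abbrev NormalizationProperty (n : MIndex) : Prop :=
  ∃ F : ℂ⟦X⟧, IsAnalyticGenerator (operatorL n) F ∧
    ∃ M : ℂ⟦X⟧, (IsMSeries n M ∧ ∀ M' : ℂ⟦X⟧, IsMSeries n M' → M' = M) ∧ normalization M = F

theorem normalizationProperty_six_two : NormalizationProperty .six_two := by
  obtain ⟨g, P, ψ, r, S, hg, hP⟩ := exists_levelSix
  -- The constant 10 makes `H_n = (1 + 8v)²/v`, so the square root of `H_n` is rational up to `√v`.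
  have hW : constantCoeff (1 + 16 * (X * g) + 64 * (X * g) ^ 2) = 1 := by simp
  obtain ⟨u, hu⟩ := exists_mul_eq hW g
  have h16 : (C (10 + 6 : ℂ) : ℂ⟦X⟧) = 16 := by norm_num [map_ofNat]
  have M : MSeriesData .six_two u (eulerProduct 1 * eulerProduct 2 * eulerProduct 3 *
      eulerProduct 6) (P * (1 + 8 * (X * g))) 1 2 :=
    { hk := by norm_num
      hauptmodul_mul := T6A_mul hg (by rw [h16]; exact hu)
      etaPlus_eq := by simpa [etaPlus] using etaPlus_six_eq
      pow_eq := by linear_combination hP + P ^ 2 * hu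
      const_u := constantCoeff_of_mul_eq hu hW S.const_g
      const_Φ := const_eulerProduct_mul (by simp) (by simp) (by simp) (by simp)
      const_Mq := by simp [S.const_P] }
  -- The linear coefficient of `P(1 + 8v)` is `-4 + 8 = 4`.
  refine certificateSixTwo.exists_generator S M rfl (a := 4) ?_ hW ?_ ?_ ?_
  · have : coeff 1 (8 * (X * g)) = 8 := by
      simp [coeff_one_mul, S.const_g, constantCoeff_ofNat]
    norm_num [coeff_one_mul, S.coeff_one_P, S.const_P, this, coeff_one]
  · simp [map_ofNat]
    linear_combination -4 * X * hu
  · simp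
    linear_combination X * hu
  · simp [map_ofNat]
    ring

theorem normalizationProperty_six_three : NormalizationProperty .six_three := by
  obtain ⟨g, P, ψ, r, S, hg, hP⟩ := exists_levelSix
  -- The constant 14 makes `H_n = ρ(v)/v = r²/v`, so the M-series takes the value `P r`.
  have hW : constantCoeff (1 + 20 * (X * g) + 64 * (X * g) ^ 2) = 1 := by simp
  obtain ⟨u, hu⟩ := exists_mul_eq hW g
  have hr := S.r_sq
  simp [map_ofNat] at hr
  have h20 : (C (14 + 6 : ℂ) : ℂ⟦X⟧) = 20 := by norm_num [map_ofNat]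
  have M : MSeriesData .six_three u (eulerProduct 1 * eulerProduct 2 * eulerProduct 3 *
      eulerProduct 6) (P * r) 1 2 :=
    { hk := by norm_num
      hauptmodul_mul := T6A_mul hg (by rw [h20]; exact hu)
      etaPlus_eq := by simpa [etaPlus] using etaPlus_six_eq
      pow_eq := by linear_combination hP + P ^ 2 * hu + P ^ 2 * u * hr
      const_u := constantCoeff_of_mul_eq hu hW S.const_g
      const_Φ := const_eulerProduct_mul (by simp) (by simp) (by simp) (by simp)
      const_Mq := by simp [S.const_P, S.const_r] }
  refine certificateSixThree.exists_generator S M rfl (a := 6) ?_ hW ?_ ?_ ?_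
  · norm_num [coeff_one_mul, S.coeff_one_P, S.const_P, S.coeff_one_r, S.const_r]
  · simp [map_ofNat]
    linear_combination -6 * X * hu
  · simp
    linear_combination X * hu
  · simp [map_ofNat]
    linear_combination P ^ 2 * (1 + 20 * (X * g) + 64 * (X * g) ^ 2) * hr

theorem normalizationProperty_ten : NormalizationProperty .ten := by
  obtain ⟨g, P, ψ, r, S, hg, hP⟩ := exists_levelTen
  have M : MSeriesData .ten (g * (1 - 4 * (X * g))) (eulerProduct 1 * eulerProduct 2 *
      eulerProduct 5 * eulerProduct 10) P 3 4 :=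
    { hk := by norm_num
      hauptmodul_mul := T10A_mul rfl hg
      etaPlus_eq := by
        have : HahnSeries.single (((3 : ℕ) : ℚ) / (4 : ℕ)) 1 = qRoot ^ 18 := by
          rw [qRoot_pow]; norm_num
        simp only [etaPlus, this, etaQ_eq, map_mul]
        ring
      pow_eq := hP
      const_u := by simp [S.const_g]
      const_Φ := const_eulerProduct_mul (by simp) (by simp) (by simp) (by simp)
      const_Mq := S.const_P }
  refine certificateTen.exists_generator S M rfl (a := 2) (W := 1) ?_ (by simp) ?_ ?_ ?_
  · norm_num [S.coeff_one_P]
  · simp [map_ofNat]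
    ring
  · simp [map_ofNat]
    ring
  · simp

theorem normalizationProperty_fourteen (s : ℂ) : NormalizationProperty (.fourteen s) := by
  obtain ⟨g, P, ψ, r, S, hg, hP⟩ := exists_levelFourteen
  have hW : constantCoeff (1 + C (s + 3) * (X * g) + 8 * (X * g) ^ 2) = 1 := by simp
  obtain ⟨u, hu⟩ := exists_mul_eq hW g
  have M : MSeriesData (.fourteen s) u (eulerProduct 1 * eulerProduct 2 * eulerProduct 7 *
      eulerProduct 14) (P * (1 + C (s + 3) * (X * g) + 8 * (X * g) ^ 2)) 1 1 :=
    { hk := by norm_num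
      hauptmodul_mul := T14A_mul hg hu
      etaPlus_eq := by
        have : HahnSeries.single (((1 : ℕ) : ℚ) / (1 : ℕ)) 1 = qRoot ^ 24 := by
          rw [qRoot_pow]; norm_num
        simp only [etaPlus, this, etaQ_eq, map_mul]
        ring
      pow_eq := by linear_combination hP + P * hu
      const_u := constantCoeff_of_mul_eq hu hW S.const_g
      const_Φ := const_eulerProduct_mul (by simp) (by simp) (by simp) (by simp)
      const_Mq := by rw [map_mul, hW, S.const_P, one_mul] }
  have hs : (C (s + 3) : ℂ⟦X⟧) = C s + 3 := by rw [map_add, map_ofNat]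
  -- The linear coefficient `s - 1` moves with the constant term of `H_n`, so `1/t = H_n - (s - 1)`
  -- and the operator do not depend on `s`.
  refine certificateFourteen.exists_generator S M rfl (a := s - 1) ?_ hW ?_ ?_ ?_
  · have : coeff 1 (1 + C (s + 3) * (X * g) + 8 * (X * g) ^ 2) = s + 3 := by
      simp [coeff_one_mul, S.const_g, coeff_one, pow_two]
    rw [coeff_one_mul, S.coeff_one_P, S.const_P, hW, this]
    norm_num
    ring
  · rw [hs] at hu ⊢
    simp [map_ofNat]
    linear_combination -(C s - 1) * X * hu
  · rw [hs] at hu ⊢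
    simp
    linear_combination X * hu
  · simp
    ring

theorem normalizationProperty_fifteen (s : ℂ) : NormalizationProperty (.fifteen s) := by
  obtain ⟨g, P, ψ, r, S, hg, hP⟩ := exists_levelFifteen
  have hW : constantCoeff (1 + C (s + 2) * (X * g) + 9 * (X * g) ^ 2) = 1 := by simp
  obtain ⟨u, hu⟩ := exists_mul_eq hW g
  have M : MSeriesData (.fifteen s) u (eulerProduct 1 * eulerProduct 3 * eulerProduct 5 *
      eulerProduct 15) (P * (1 + C (s + 2) * (X * g) + 9 * (X * g) ^ 2)) 1 1 :=
    { hk := by norm_num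
      hauptmodul_mul := T15A_mul hg hu
      etaPlus_eq := by
        have : HahnSeries.single (((1 : ℕ) : ℚ) / (1 : ℕ)) 1 = qRoot ^ 24 := by
          rw [qRoot_pow]; norm_num
        simp only [etaPlus, this, etaQ_eq, map_mul]
        ring
      pow_eq := by linear_combination hP + P * hu
      const_u := constantCoeff_of_mul_eq hu hW S.const_g
      const_Φ := const_eulerProduct_mul (by simp) (by simp) (by simp) (by simp)
      const_Mq := by rw [map_mul, hW, S.const_P, one_mul] }
  have hs : (C (s + 2) : ℂ⟦X⟧) = C s + 2 := by rw [map_add, map_ofNat]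
  refine certificateFifteen.exists_generator S M rfl (a := s - 1) ?_ hW ?_ ?_ ?_
  · have : coeff 1 (1 + C (s + 2) * (X * g) + 9 * (X * g) ^ 2) = s + 2 := by
      simp [coeff_one_mul, S.const_g, coeff_one, pow_two]
    rw [coeff_one_mul, S.coeff_one_P, S.const_P, hW, this]
    norm_num
    ring
  · rw [hs] at hu ⊢
    simp [map_ofNat]
    linear_combination -(C s - 1) * X * hu
  · rw [hs] at hu ⊢
    simp
    linear_combination X * hu
  · simp
    ring

/-- For odd `d`, `q ↦ -q` turns the Euler product of `d` into that of `2d` cubed over those of `d`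
and `4d`, and it fixes those of even `d`. It carries `1/v` of level six to minus the Hauptmodul of
case 12, and the eta product of level six to that of case 12. -/
theorem normalizationProperty_twelve : NormalizationProperty .twelve := by
  obtain ⟨g, P, ψ, r, S, hg, hP⟩ := exists_levelSix
  have n2 := evalNegHom_eulerProduct (d := 2) (by decide) (by simp)
  have n6 := evalNegHom_eulerProduct (d := 6) (by decide) (by simp)
  have n1 := eulerProduct_mul_evalNegHom (d := 1) (by decide)
  have n3 := eulerProduct_mul_evalNegHom (d := 3) (by decide)
  norm_num at n1 n3
  have ne (d : ℕ) (hd : d ≠ 0) := eulerProduct_ne_zero hd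
  have hg' := congrArg evalNegHom hg
  have hP' := congrArg evalNegHom hP
  simp only [map_mul, map_pow, n2, n6] at hg' hP'
  have hΦ : evalNegHom (eulerProduct 1 * eulerProduct 2 * eulerProduct 3 * eulerProduct 6) *
      (eulerProduct 1 * eulerProduct 3 * eulerProduct 4 * eulerProduct 12) =
      eulerProduct 2 ^ 4 * eulerProduct 6 ^ 4 := by
    simp only [map_mul, n2, n6]
    linear_combination eulerProduct 2 * eulerProduct 6 * (eulerProduct 6 ^ 3 * n1 +
      eulerProduct 1 * evalNegHom (eulerProduct 1) * eulerProduct 4 * n3)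
  have hh : evalNegHom g * (eulerProduct 2 * eulerProduct 6) ^ 12 =
      (eulerProduct 1 * eulerProduct 3 * eulerProduct 4 * eulerProduct 12) ^ 6 := by
    refine mul_right_cancel₀ (b := (eulerProduct 2 * eulerProduct 6) ^ 6)
      (pow_ne_zero _ (mul_ne_zero (ne 2 (by simp)) (ne 6 (by simp)))) ?_
    have e : (eulerProduct 2 * eulerProduct 6) ^ 12 * (eulerProduct 2 * eulerProduct 6) ^ 6 =
        (eulerProduct 2 ^ 3 * eulerProduct 6 ^ 3) ^ 6 := by ring
    rw [mul_assoc, e, ← n1, ← n3]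
    linear_combination (eulerProduct 1 * eulerProduct 3 * eulerProduct 4 * eulerProduct 12) ^ 6 *
      hg'
  have M : MSeriesData .twelve (evalNegHom g) (evalNegHom (eulerProduct 1 * eulerProduct 2 *
      eulerProduct 3 * eulerProduct 6)) (evalNegHom P) 1 2 :=
    { hk := by norm_num
      hauptmodul_mul := by
        have h := congrArg toHahn hh
        simp only [map_mul, map_pow] at h
        have q1 := etaQ_ne_zero (d := 1) (by simp)
        have q3 := etaQ_ne_zero (d := 3) (by simp)
        have q4 := etaQ_ne_zero (d := 4) (by simp)
        have q12 := etaQ_ne_zero (d := 12) (by simp)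
        rw [hauptmodul, T12A, sub_self, map_zero, zero_add]
        field_simp
        simp only [etaQ_eq, map_mul, toHahn_X]
        linear_combination qRoot ^ 120 * h
      etaPlus_eq := by
        have h := congrArg toHahn hΦ
        simp only [map_mul, map_pow] at h
        have : HahnSeries.single (((1 : ℕ) : ℚ) / (2 : ℕ)) 1 = qRoot ^ 12 := by
          rw [qRoot_pow]; norm_num
        have q1 := etaQ_ne_zero (d := 1) (by simp)
        have q3 := etaQ_ne_zero (d := 3) (by simp)
        have q4 := etaQ_ne_zero (d := 4) (by simp)
        have q12 := etaQ_ne_zero (d := 12) (by simp)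
        rw [etaPlus, this, div_eq_iff (by simp [q1, q3, q4, q12])]
        simp only [etaQ_eq, map_mul]
        linear_combination -qRoot ^ 32 * h
      pow_eq := by
        simp only [map_mul, n2, n6]
        linear_combination hP'
      const_u := by rw [constantCoeff_evalNegHom, S.const_g]
      const_Φ := by
        rw [constantCoeff_evalNegHom]
        exact const_eulerProduct_mul (by simp) (by simp) (by simp) (by simp)
      const_Mq := by rw [constantCoeff_evalNegHom, S.const_P] }
  -- The sign compensates for `X ↦ -X`: after the substitution `t` begins with `+X`.
  obtain ⟨t, ht⟩ := exists_mul_eq (W := 1 + 4 * (X * g)) (by simp) (-(X * g))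
  obtain ⟨ω, l, U⟩ := certificateTwelve.exists_uniformization (t := t)
    (E := P * (1 + 4 * (X * g))) S
    (by simp [map_ofNat, ht]) (by simp [map_ofNat]; ring) (by simp [S.const_P])
  have ha : coeff 1 (evalNegHom P) = 4 := by
    norm_num [coeff_evalNegHom, S.coeff_one_P]
  have h4 : (C (4 : ℂ) : ℂ⟦X⟧) = 4 := map_ofNat C 4
  have ht' := congrArg evalNegHom ht
  simp only [map_mul, map_add, map_one, map_ofNat, map_neg, evalNegHom_X] at ht'
  refine M.exists_generator rfl ?_ ?_ U.evalNeg
  · rw [ha, h4]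
    linear_combination ht'
  · rw [ha, h4]
    simp only [map_mul, map_add, map_one, map_ofNat, evalNegHom_X]
    ring

end levels

end MSeries

theorem mainTheorem2 (n : MIndex) :
    ∃ F : PowerSeries ℂ, IsAnalyticGenerator (operatorL n) F ∧
      ∃ M : PowerSeries ℂ, (IsMSeries n M ∧ ∀ M' : PowerSeries ℂ, IsMSeries n M' → M' = M) ∧
        normalization M = F := by
  cases n with
  | six_two => exact MSeries.normalizationProperty_six_two
  | six_three => exact MSeries.normalizationProperty_six_three
  | ten => exact MSeries.normalizationProperty_ten
  | twelve => exact MSeries.normalizationProperty_twelve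
  | fourteen s => exact MSeries.normalizationProperty_fourteen s
  | fifteen s => exact MSeries.normalizationProperty_fifteen s
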